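/- Let $\mathbb G=\mathbb R^{d_1}\oplus\mathbb R^{d_2}$ be a step-2 Carnot group in exponential coordinates: there are vectors $w_{ij}=-w_{ji}\in\mathbb R^{d_2}$ ($1\le i,j\le d_1$) that span $\mathbb R^{d_2}$, and, with $[a,b]:=\sum_{i,j}w_{ij}a_ib_j$ for $a,b\in\mathbb R^{d_1}$, the group law is $$(x^{(1)},x^{(2)})\,(y^{(1)},y^{(2)})=\bigl(x^{(1)}+y^{(1)},\;x^{(2)}+y^{(2)}+\tfrac12[x^{(1)},y^{(1)}]\bigr).$$ Let $V_1,\dots,V_{d_1}$ be the left-invariant vector fields that equal $e_1,\dots,e_{d_1}$ at the identity. An absolutely continuous curve $\gamma:[0,1]\to\mathbb G$ is horizontal if $\dot\gamma_t\in\mathrm{span}\{V_i(\gamma_t): i\le d_1\}$ for a.e. $t$. Let $|\cdot|$ be the left-invariant Riemannian metric that is Euclidean at the identity, and let $d_{cc}(x,y)$ be the infimum of the lengths $\int_0^1|\dot\gamma_t|\,dt$ of the horizontal curves $\gamma$ from $x$ to $y$. Let $\Omega_{\mathbb G}=C_0([0,1],\mathbb G)$ be the space of continuous paths started from the identity, with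 the metric $d_\infty(X,Y)=\sup_{t\in[0,1]}d_{cc}(X_t,Y_t)$. For $n\in\mathbb N$ and $t^n_k=k2^{-n}$, define the discretised cost $C_n:\Omega_{\mathbb G}\times\Omega_{\mathbb G}\to[0,\infty)$ by $$C_n(X,Y)=\Bigl(2^n\sum_{k=1}^{2^n}d_{cc}\bigl(X_{t^n_{k-1}}^{-1}X_{t^n_k},\,Y_{t^n_{k-1}}^{-1}Y_{t^n_k}\bigr)^2\Bigr)^{1/2}.$$ For an absolutely continuous $a:[0,1]\to\mathbb R^{d_1}$ with $a_0=0$, let $\Psi(a)_t=\bigl(a_t,\tfrac12\int_0^t[a_s,\dot a_s]\,ds\bigr)$ be its horizontal lift. Let $\mathcal H$ be the Cameron–Martin space of absolutely continuous $h:[0,1]\to\mathbb R^{d_1}$ with $h_0=0$ and $\|h\|_{\mathcal H}:=(\int_0^1|\dot h_t|^2\,dt)^{1/2}<\infty$. For $h\in\mathcal H$ and $X\in\Omega_{\mathbb G}$, the shift $T_hX\in\Omega_{\mathbb G}$ is the $d_\infty$-limit of $\Psi(a^n+h)$, where $(a^n)$ is any sequence of absolutely continuous curves started from $0$ with $\Psi(a^n)\to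 X$ in $d_\infty$. Such sequences exist, and the limit exists and does not depend on the choice. Define $$C_{\mathcal H}(X,Y)=\begin{cases}\|h\|_{\mathcal H},&\text{if }Y=T_hX\text{ for some }h\in\mathcal H,\\+\infty,&\text{otherwise.}\end{cases}$$ Then $C_n$ $\Gamma$-converges to $C_{\mathcal H}$ on $\Omega_{\mathbb G}\times\Omega_{\mathbb G}$ with the uniform topology, that is: 1. whenever $(X^n,Y^n)\to(X,Y)$ in $\Omega_{\mathbb G}\times\Omega_{\mathbb G}$, we have $C_{\mathcal H}(X,Y)\le\liminf_{n\to\infty}C_n(X^n,Y^n)$; 2. for every $(X,Y)\in\Omega_{\mathbb G}\times\Omega_{\mathbb G}$ there is a sequence $(X^n,Y^n)\to(X,Y)$ with $\limsup_{n\to\infty}C_n(X^n,Y^n)\le C_{\mathcal H}(X,Y)$. -/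

import Mathlib

open Filter Topology MeasureTheory Set
open scoped ENNReal

noncomputable section

/-- A step-2 Carnot group in exponential coordinates, given by the structure constants `w i j` of an
adapted orthonormal basis: the group is `ℝ^{d₁} ⊕ ℝ^{d₂}`, where the first layer `𝒱₁` has the basis
`V_1, …, V_{d₁}`, and `[V_i, V_j] = ∑_k w_{ij}^k V_k` lies in the second layer `𝒱₂ ≅ ℝ^{d₂}`.
The last field says `𝒱₂ = [𝒱₁, 𝒱₁]`. -/
structure StepTwoCarnotGroup (d₁ d₂ : ℕ) where
  /-- the structure constants -/
  w : Fin d₁ → Fin d₁ → EuclideanSpace ℝ (Fin d₂)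
  skew : ∀ i j, w i j = -w j i
  span_eq_top : Submodule.span ℝ (Set.range fun p : Fin d₁ × Fin d₁ => w p.1 p.2) = ⊤

namespace StepTwoCarnotGroup

variable {d₁ d₂ : ℕ} (G : StepTwoCarnotGroup d₁ d₂)

/-- The bracket `[x, y] = ∑_{i,j} w_{ij} x_i y_j` of the first layer. -/
def bracket (x y : EuclideanSpace ℝ (Fin d₁)) : EuclideanSpace ℝ (Fin d₂) :=
  ∑ i, ∑ j, (x i * y j) • G.w i j

lemma bracket_add_left (x x' y : EuclideanSpace ℝ (Fin d₁)) :
    G.bracket (x + x') y = G.bracket x y + G.bracket x' y := by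
  simp only [bracket, PiLp.add_apply, add_mul, add_smul, Finset.sum_add_distrib]

lemma bracket_add_right (x y y' : EuclideanSpace ℝ (Fin d₁)) :
    G.bracket x (y + y') = G.bracket x y + G.bracket x y' := by
  simp only [bracket, PiLp.add_apply, mul_add, add_smul, Finset.sum_add_distrib]

lemma bracket_swap (x y : EuclideanSpace ℝ (Fin d₁)) :
    G.bracket x y = -G.bracket y x := by
  unfold bracket
  rw [Finset.sum_comm, ← Finset.sum_neg_distrib]
  refine Finset.sum_congr rfl fun j _ => ?_
  rw [← Finset.sum_neg_distrib]
  refine Finset.sum_congr rfl fun i _ => ?_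
  rw [G.skew i j, smul_neg, mul_comm]

lemma bracket_neg_left (x y : EuclideanSpace ℝ (Fin d₁)) :
    G.bracket (-x) y = -G.bracket x y := by
  simp only [bracket, PiLp.neg_apply, neg_mul, neg_smul, Finset.sum_neg_distrib]

lemma bracket_self (x : EuclideanSpace ℝ (Fin d₁)) : G.bracket x x = 0 := by
  have h := G.bracket_swap x x
  rwa [eq_neg_iff_add_eq_zero, ← two_smul ℝ, smul_eq_zero_iff_right two_ne_zero] at h

lemma bracket_zero_left (y : EuclideanSpace ℝ (Fin d₁)) : G.bracket 0 y = 0 := by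
  simp [bracket]

lemma bracket_zero_right (x : EuclideanSpace ℝ (Fin d₁)) : G.bracket x 0 = 0 := by
  simp [bracket]

/-- The underlying manifold `ℝ^{d₁} ⊕ ℝ^{d₂}` of the group. Its vector space structure also serves
for all its tangent spaces. The norm used here (a maximum of Euclidean norms) enters only through
the topology, through derivatives and through absolute continuity, none of which depends on the
choice of a norm. -/
def Carrier (_ : StepTwoCarnotGroup d₁ d₂) : Type :=
  EuclideanSpace ℝ (Fin d₁) × EuclideanSpace ℝ (Fin d₂)

instance : NormedAddCommGroup G.Carrier :=
  inferInstanceAs (NormedAddCommGroup (EuclideanSpace ℝ (Fin d₁) × EuclideanSpace ℝ (Fin d₂)))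

instance : NormedSpace ℝ G.Carrier :=
  inferInstanceAs (NormedSpace ℝ (EuclideanSpace ℝ (Fin d₁) × EuclideanSpace ℝ (Fin d₂)))

/-- The group law `x y = (x⁽¹⁾ + y⁽¹⁾, x⁽²⁾ + y⁽²⁾ + ½ [x⁽¹⁾, y⁽¹⁾])`, with neutral element `(0, 0)`
and inverse `(-x⁽¹⁾, -x⁽²⁾)`. -/
instance : Group G.Carrier where
  mul x y := (x.1 + y.1, x.2 + y.2 + (1 / 2 : ℝ) • G.bracket x.1 y.1)
  one := (0, 0)
  inv x := (-x.1, -x.2)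
  mul_assoc x y z := by
    refine Prod.ext (add_assoc x.1 y.1 z.1) ?_
    change x.2 + y.2 + (1 / 2 : ℝ) • G.bracket x.1 y.1 + z.2
        + (1 / 2 : ℝ) • G.bracket (x.1 + y.1) z.1
      = x.2 + (y.2 + z.2 + (1 / 2 : ℝ) • G.bracket y.1 z.1)
        + (1 / 2 : ℝ) • G.bracket x.1 (y.1 + z.1)
    rw [bracket_add_left, bracket_add_right, smul_add, smul_add]
    abel
  one_mul x := by
    refine Prod.ext (zero_add x.1) ?_
    change 0 + x.2 + (1 / 2 : ℝ) • G.bracket 0 x.1 = x.2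
    simp [bracket_zero_left]
  mul_one x := by
    refine Prod.ext (add_zero x.1) ?_
    change x.2 + 0 + (1 / 2 : ℝ) • G.bracket x.1 0 = x.2
    simp [bracket_zero_right]
  inv_mul_cancel x := by
    refine Prod.ext (neg_add_cancel x.1) ?_
    change -x.2 + x.2 + (1 / 2 : ℝ) • G.bracket (-x.1) x.1 = 0
    simp [bracket_neg_left, bracket_self]

/-- The differential at the identity of the left multiplication `y ↦ x y = x + dLeft x y`
(`dLeft x` is linear), applied to the tangent vector `v`. -/
def dLeft (x v : G.Carrier) : G.Carrier :=
  (v.1, v.2 + (1 / 2 : ℝ) • G.bracket x.1 v.1)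

/-- The left-invariant vector fields `V_1, …, V_{d₁}` spanning the first layer. -/
def V (i : Fin d₁) (x : G.Carrier) : G.Carrier :=
  G.dLeft x (EuclideanSpace.single i (1 : ℝ), (0 : EuclideanSpace ℝ (Fin d₂)))

/-- The length of a tangent vector `v` at `x` for the left-invariant metric which is the Euclidean
one of `ℝ^{d₁} ⊕ ℝ^{d₂}` at the identity (`dLeft x⁻¹` is the inverse of `dLeft x`). -/
def tangentNorm (x v : G.Carrier) : ℝ :=
  Real.sqrt (‖(G.dLeft x⁻¹ v).1‖ ^ 2 + ‖(G.dLeft x⁻¹ v).2‖ ^ 2)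

/-- `γ` restricted to `[0, 1]` is an absolutely continuous horizontal curve. -/
def IsHorizontal (γ : ℝ → G.Carrier) : Prop :=
  AbsolutelyContinuousOnInterval γ 0 1 ∧
    ∀ᵐ t ∂(volume.restrict (Icc (0 : ℝ) 1)),
      deriv γ t ∈ Submodule.span ℝ (Set.range fun i => G.V i (γ t))

/-- The length `∫₀¹ |γ̇_t| dt`. -/
def curveLength (γ : ℝ → G.Carrier) : ℝ≥0∞ :=
  ∫⁻ t in Icc (0 : ℝ) 1, ENNReal.ofReal (G.tangentNorm (γ t) (deriv γ t))

/-- The Carnot–Carathéodory distance. -/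
def dcc (x y : G.Carrier) : ℝ≥0∞ :=
  ⨅ (γ : ℝ → G.Carrier) (_ : G.IsHorizontal γ) (_ : γ 0 = x) (_ : γ 1 = y), G.curveLength γ

/-- The space `C₀([0, 1], G)` of continuous paths started from the identity. -/
def PathSpace : Type :=
  {X : unitInterval → G.Carrier // Continuous X ∧ X 0 = 1}

/-- The uniform distance `sup_t dcc (X_t, Y_t)`. -/
def dInf (X Y : unitInterval → G.Carrier) : ℝ≥0∞ :=
  ⨆ t, G.dcc (X t) (Y t)

/-- The (maximum) product distance on pairs of paths. -/
def dPair (p q : G.PathSpace × G.PathSpace) : ℝ≥0∞ :=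
  max (G.dInf p.1.1 q.1.1) (G.dInf p.2.1 q.2.1)

/-- The canonical lift of an absolutely continuous `h : [0, 1] → ℝ^{d₁}` with `h_0 = 0`, namely
`t ↦ (h_t, ½ ∫₀ᵗ [h_s, ḣ_s] ds)`. -/
def lift (h : ℝ → EuclideanSpace ℝ (Fin d₁)) : unitInterval → G.Carrier :=
  fun t => (h t, (1 / 2 : ℝ) • ∫ s in (0 : ℝ)..t, G.bracket (h s) (deriv h s))

end StepTwoCarnotGroup

/-- `h` restricted to `[0, 1]` is absolutely continuous and starts from the origin. Here and below
only the values of `h` on `[0, 1]` are relevant. -/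
def IsAC0 {d : ℕ} (h : ℝ → EuclideanSpace ℝ (Fin d)) : Prop :=
  AbsolutelyContinuousOnInterval h 0 1 ∧ h 0 = 0

/-- `h` restricted to `[0, 1]` belongs to the Cameron–Martin space. -/
def IsCameronMartin {d : ℕ} (h : ℝ → EuclideanSpace ℝ (Fin d)) : Prop :=
  IsAC0 h ∧ MemLp (deriv h) 2 (volume.restrict (Icc (0 : ℝ) 1))

/-- The Cameron–Martin norm `(∫₀¹ |ḣ_t|² dt)^{1/2}`. -/
def cameronMartinNorm {d : ℕ} (h : ℝ → EuclideanSpace ℝ (Fin d)) : ℝ≥0∞ :=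
  (∫⁻ t in Icc (0 : ℝ) 1, ‖deriv h t‖ₑ ^ 2) ^ (1 / 2 : ℝ)

/-- The dyadic time `k 2⁻ⁿ`. -/
def dyadicTime (n : ℕ) (k : Fin (2 ^ n + 1)) : unitInterval :=
  ⟨(k : ℝ) / 2 ^ n, by positivity, by
    rw [div_le_one (by positivity)]
    exact_mod_cast Nat.lt_succ_iff.mp k.2⟩

/-- `Γ`-convergence with respect to a distance function. -/
def GammaConverges {E : Type*} (d : E → E → ℝ≥0∞) (F : ℕ → E → ℝ≥0∞) (F' : E → ℝ≥0∞) : Prop :=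
  (∀ (x : E) (u : ℕ → E), Tendsto (fun n => d (u n) x) atTop (𝓝 0) →
      F' x ≤ liminf (fun n => F n (u n)) atTop) ∧
    ∀ x : E, ∃ u : ℕ → E, Tendsto (fun n => d (u n) x) atTop (𝓝 0) ∧
      limsup (fun n => F n (u n)) atTop ≤ F' x

namespace StepTwoCarnotGroup

variable {d₁ d₂ : ℕ} (G : StepTwoCarnotGroup d₁ d₂)

/-- `a` is a sequence of curves in `AC₀([0, 1], ℝ^{d₁})` whose lifts, which are absolutely continuous
horizontal curves, converge uniformly to `X`. -/
def IsApproximation (a : ℕ → ℝ → EuclideanSpace ℝ (Fin d₁)) (X : G.PathSpace) : Prop :=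
  (∀ n, IsAC0 (a n)) ∧ Tendsto (fun n => G.dInf (G.lift (a n)) X.1) atTop (𝓝 0)

/-- `Y = T_h X`, where the shift `T_h X` is the uniform limit of the lifts of `aₙ + h` for
approximations `a` of `X`. It is required that `X` has an approximation and that every
approximation leads to the same limit `Y`. -/
def IsShift (h : ℝ → EuclideanSpace ℝ (Fin d₁)) (X Y : G.PathSpace) : Prop :=
  (∃ a, G.IsApproximation a X) ∧
    ∀ a, G.IsApproximation a X →
      Tendsto (fun n => G.dInf (G.lift (fun t => a n t + h t)) Y.1) atTop (𝓝 0)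

/-- The cost `C_ℋ (X, Y)`: it is `‖h‖_ℋ` if `Y = T_h X` for some `h ∈ ℋ`, and `∞` otherwise. (As
`h` is then determined on `[0, 1]` by `h = Y⁽¹⁾ - X⁽¹⁾`, the infimum is over at most one value.) -/
def shiftCost (p : G.PathSpace × G.PathSpace) : ℝ≥0∞ :=
  ⨅ (h : ℝ → EuclideanSpace ℝ (Fin d₁)) (_ : IsCameronMartin h) (_ : G.IsShift h p.1 p.2),
    cameronMartinNorm h

/-- The dyadic increments `X_{t_{k-1}}⁻¹ X_{t_k}`, `t_k = k 2⁻ⁿ`, of a path. -/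
def dyadicIncrement (n : ℕ) (X : G.PathSpace) (k : Fin (2 ^ n)) : G.Carrier :=
  (X.1 (dyadicTime n k.castSucc))⁻¹ * X.1 (dyadicTime n k.succ)

/-- The discretised cost `C_n (X, Y)`. -/
def discreteCost (n : ℕ) (p : G.PathSpace × G.PathSpace) : ℝ≥0∞ :=
  (2 ^ n * ∑ k : Fin (2 ^ n),
    G.dcc (G.dyadicIncrement n p.1 k) (G.dyadicIncrement n p.2 k) ^ 2) ^ (1 / 2 : ℝ)

end StepTwoCarnotGroup

end

/-!
Write `P_t = Y_t X_t⁻¹`. If `a` is absolutely continuous, integration by parts (`lift_add`) shows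
that the lift of `a + h` is the lift of `a` multiplied from the left by
`(h_t, ∫₀ᵗ [a_s + h_s / 2, ḣ_s] ds)`. This factor (`shiftFactor`) depends on `a` only through its
values, so it passes to the uniform limit, and `Y = T_h X` means that `P` is the factor belonging to
`X⁽¹⁾` and `h` (`isShift_iff`). That `X` is a limit of lifts at all is a polygonal approximation
(`exists_isApproximation`), which rests on Chow's theorem in quantitative form: every group element
is a product of boundedly many exponentials of horizontal vectors of controlled length
(`exists_isShortProduct`). Together with the opposite bounds `‖x⁽¹⁾‖ ≤ d_cc(1, x)` and
`‖x⁽²⁾‖ ≤ C d_cc(1, x)²` this also identifies uniform convergence for `d_cc` with uniform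
convergence of the coordinates (`comap_dcc_one`, `tendsto_dInf_iff`).

For `p = y x⁻¹` and `p' = y' x'⁻¹` the distance between the increments `x⁻¹ x'` and `y⁻¹ y'` is the
distance from the identity to a conjugate of `p⁻¹ p'` (`dcc_increments`), whose layers are
`p'⁽¹⁾ - p⁽¹⁾` and `p'⁽²⁾ - p⁽²⁾ - [m, p'⁽¹⁾ - p⁽¹⁾]`, where `m` is the mean of the first layers
of `x'` and `y'` (`conj_snd`). So the discretised cost measures at the same time the energy of the
first layer of `P` and the failure of its second layer to be a Riemann sum for
`∫ [X⁽¹⁾ + h / 2, ḣ]`.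

* Lower bound. If the costs of `(Xⁿ, Yⁿ)` stay below `L`, then for every fixed `p` the energy of
  `h = Y⁽¹⁾ - X⁽¹⁾` on the grid of mesh `2⁻ᵖ` is at most `L²`. Hence `h` is absolutely continuous,
  by the Cauchy–Schwarz inequality, and has Cameron–Martin norm at most `L`, by Fatou's lemma
  (`isCameronMartin_of_dyadic_energy_le`). In the second layer the errors on the fine grid are
  quadratic in the distances, and their sum is `O(2⁻ⁿ)`. Replacing the fine Riemann sum by the one
  of mesh `2⁻ᵖ` costs only the oscillation of the mean first layer (`norm_sub_coarse_sum_le`).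
  Letting first `n` and then `p` tend to infinity yields `Y = T_h X` (`isShift_of_discreteCost_le`).
* Recovery sequence. Keep `X`, and replace the integral in the factor by the Riemann sum of mesh
  `2⁻ⁿ` with the evaluation points of `conj_snd`. Over each cell of the grid, the increment of the
  resulting path is the one of `X` times the exponential of the increment of `h`. So its squared
  cost is at most the energy of `h` on the grid, which is at most `‖h‖_ℋ²` by the Cauchy–Schwarz
  inequality (`discreteShift`, `discreteCost_discreteShift_le`).
-/

/-! ### Absolutely continuous curves in Euclidean space -/

namespace AbsolutelyContinuousOnInterval

variable {E F : Type*} [NormedAddCommGroup E] [NormedAddCommGroup F] {f g : ℝ → E} {a b : ℝ}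

lemma lipschitz_comp (hf : AbsolutelyContinuousOnInterval f a b) {K : NNReal} {φ : E → F}
    (hφ : LipschitzWith K φ) : AbsolutelyContinuousOnInterval (fun t => φ (f t)) a b := by
  have h0 : Tendsto (fun E : ℕ × (ℕ → ℝ × ℝ) =>
      K * ∑ i ∈ Finset.range E.1, dist (f (E.2 i).1) (f (E.2 i).2))
      (totalLengthFilter ⊓ 𝓟 (disjWithin a b)) (𝓝 0) := by
    simpa using Tendsto.const_mul (K : ℝ) hf
  refine squeeze_zero (fun t => ?_) (fun t => ?_) h0
  · positivity
  · rw [Finset.mul_sum]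
    exact Finset.sum_le_sum fun i _ => hφ.dist_le_mul _ _

lemma clm_comp [NormedSpace ℝ E] [NormedSpace ℝ F] (hf : AbsolutelyContinuousOnInterval f a b)
    (L : E →L[ℝ] F) : AbsolutelyContinuousOnInterval (fun t => L (f t)) a b :=
  hf.lipschitz_comp L.lipschitz

lemma finset_sum {ι : Type*} {s : Finset ι} {f : ι → ℝ → E}
    (hf : ∀ i ∈ s, AbsolutelyContinuousOnInterval (f i) a b) :
    AbsolutelyContinuousOnInterval (fun t => ∑ i ∈ s, f i t) a b := by
  classical
  induction s using Finset.induction_on with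
  | empty =>
    simpa using ((LipschitzWith.const (0 : E)).lipschitzOnWith
      (s := uIcc a b)).absolutelyContinuousOnInterval
  | insert i s his ih =>
    simp only [Finset.sum_insert his]
    exact (hf i (Finset.mem_insert_self i s)).fun_add
      (ih fun j hj => hf j (Finset.mem_insert_of_mem hj))

lemma ae_differentiableAt_finiteDimensional [NormedSpace ℝ E] [FiniteDimensional ℝ E]
    (hf : AbsolutelyContinuousOnInterval f a b) :
    ∀ᵐ x : ℝ, x ∈ uIcc a b → DifferentiableAt ℝ f x :=
  hf.boundedVariationOn.ae_differentiableAt_of_mem_uIcc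

variable {d : ℕ} {u : ℝ → EuclideanSpace ℝ (Fin d)}

lemma ae_deriv_apply (hu : AbsolutelyContinuousOnInterval u a b) (i : Fin d) :
    ∀ᵐ x : ℝ, x ∈ uIcc a b → deriv (fun t => u t i) x = deriv u x i := by
  filter_upwards [hu.ae_differentiableAt_finiteDimensional] with x hx hxab
  exact ((EuclideanSpace.proj (𝕜 := ℝ) i).hasFDerivAt.comp_hasDerivAt x
    (hx hxab).hasDerivAt).deriv

lemma intervalIntegrable_deriv_euclidean (hu : AbsolutelyContinuousOnInterval u a b) :
    IntervalIntegrable (deriv u) volume a b := by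
  rw [intervalIntegrable_iff]
  refine Integrable.of_eval_piLp fun i => ?_
  have h := (hu.clm_comp (EuclideanSpace.proj (𝕜 := ℝ) i)).intervalIntegrable_deriv
  rw [intervalIntegrable_iff] at h
  refine h.congr ?_
  rw [EventuallyEq, ae_restrict_iff' measurableSet_uIoc]
  filter_upwards [hu.ae_deriv_apply i] with x hx hxab
  exact hx (uIoc_subset_uIcc hxab)

lemma integral_deriv_eq_sub_euclidean (hu : AbsolutelyContinuousOnInterval u a b) :
    ∫ t in a..b, deriv u t = u b - u a := by
  ext i
  have h1 := (EuclideanSpace.proj (𝕜 := ℝ) i).intervalIntegral_comp_comm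
    hu.intervalIntegrable_deriv_euclidean
  have h2 := (hu.clm_comp (EuclideanSpace.proj (𝕜 := ℝ) i)).integral_deriv_eq_sub
  change _ = u b i - u a i
  refine Eq.trans h1.symm (Eq.trans ?_ h2)
  refine intervalIntegral.integral_congr_ae ?_
  filter_upwards [hu.ae_deriv_apply i] with x hx hxab
  exact (hx (uIoc_subset_uIcc hxab)).symm

end AbsolutelyContinuousOnInterval

namespace StepTwoCarnotGroup

variable {d₁ d₂ : ℕ} (G : StepTwoCarnotGroup d₁ d₂)

/-! ### The bracket as a continuous bilinear map -/

/-- A bound for the operator norm of the bracket. -/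
noncomputable def bracketBound : ℝ := 1 + ∑ i, ∑ j, ‖G.w i j‖

lemma one_le_bracketBound : 1 ≤ G.bracketBound :=
  le_add_of_nonneg_right (Finset.sum_nonneg fun _ _ => Finset.sum_nonneg fun _ _ => norm_nonneg _)

lemma bracketBound_pos : 0 < G.bracketBound := one_pos.trans_le G.one_le_bracketBound

lemma norm_bracket_le (x y : EuclideanSpace ℝ (Fin d₁)) :
    ‖G.bracket x y‖ ≤ G.bracketBound * ‖x‖ * ‖y‖ := by
  have h : ‖G.bracket x y‖ ≤ (∑ i, ∑ j, ‖G.w i j‖) * (‖x‖ * ‖y‖) := by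
    simp only [bracket, Finset.sum_mul]
    refine (norm_sum_le _ _).trans (Finset.sum_le_sum fun i _ => ?_)
    refine (norm_sum_le _ _).trans (Finset.sum_le_sum fun j _ => ?_)
    rw [norm_smul, norm_mul, mul_comm]
    gcongr
    · exact PiLp.norm_apply_le x i
    · exact PiLp.norm_apply_le y j
  have h' : 0 ≤ ‖x‖ * ‖y‖ := by positivity
  rw [bracketBound]
  linarith

lemma bracket_smul_left (c : ℝ) (x y : EuclideanSpace ℝ (Fin d₁)) :
    G.bracket (c • x) y = c • G.bracket x y := by
  simp only [bracket, PiLp.smul_apply, smul_eq_mul, Finset.smul_sum, smul_smul, mul_assoc]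

lemma bracket_smul_right (c : ℝ) (x y : EuclideanSpace ℝ (Fin d₁)) :
    G.bracket x (c • y) = c • G.bracket x y := by
  rw [bracket_swap, bracket_smul_left, G.bracket_swap x y, smul_neg]

/-- The bracket as a continuous bilinear map. -/
noncomputable def bracketL : EuclideanSpace ℝ (Fin d₁) →L[ℝ] EuclideanSpace ℝ (Fin d₁) →L[ℝ]
    EuclideanSpace ℝ (Fin d₂) :=
  (LinearMap.mk₂ ℝ G.bracket G.bracket_add_left G.bracket_smul_left G.bracket_add_right
    G.bracket_smul_right).mkContinuous₂ G.bracketBound G.norm_bracket_le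

@[simp] lemma bracketL_apply (x y : EuclideanSpace ℝ (Fin d₁)) :
    G.bracketL x y = G.bracket x y := rfl

lemma bracket_sub_left (x x' y : EuclideanSpace ℝ (Fin d₁)) :
    G.bracket (x - x') y = G.bracket x y - G.bracket x' y := by
  simp only [← bracketL_apply, map_sub, sub_apply]

lemma bracket_sub_right (x y y' : EuclideanSpace ℝ (Fin d₁)) :
    G.bracket x (y - y') = G.bracket x y - G.bracket x y' := by
  simp only [← bracketL_apply, map_sub]

lemma bracket_neg_right (x y : EuclideanSpace ℝ (Fin d₁)) :
    G.bracket x (-y) = -G.bracket x y := by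
  simp only [← bracketL_apply, map_neg]

lemma continuous_bracket :
    Continuous fun p : EuclideanSpace ℝ (Fin d₁) × EuclideanSpace ℝ (Fin d₁) =>
      G.bracket p.1 p.2 :=
  G.bracketL.continuous₂

lemma _root_.Continuous.bracket {T : Type*} [TopologicalSpace T]
    {f g : T → EuclideanSpace ℝ (Fin d₁)} (hf : Continuous f) (hg : Continuous g) :
    Continuous fun t => G.bracket (f t) (g t) :=
  G.continuous_bracket.comp (hf.prodMk hg)

lemma intervalIntegrable_bracket {f g : ℝ → EuclideanSpace ℝ (Fin d₁)} {a b : ℝ}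
    (hf : ContinuousOn f (uIcc a b)) (hg : IntervalIntegrable g volume a b) :
    IntervalIntegrable (fun t => G.bracket (f t) (g t)) volume a b := by
  obtain ⟨C, hC⟩ := isCompact_uIcc.exists_bound_of_continuousOn hf
  have hfm : AEStronglyMeasurable f (volume.restrict (uIoc a b)) :=
    (hf.mono uIoc_subset_uIcc).aestronglyMeasurable measurableSet_uIoc
  rw [intervalIntegrable_iff] at hg ⊢
  have hm : AEStronglyMeasurable (fun t => G.bracket (f t) (g t)) (volume.restrict (uIoc a b)) :=
    G.bracketL.aestronglyMeasurable_comp₂ hfm hg.aestronglyMeasurable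
  refine (hg.norm.const_mul (G.bracketBound * C)).mono' hm ?_
  refine (ae_restrict_mem measurableSet_uIoc).mono fun t ht => ?_
  refine (G.norm_bracket_le _ _).trans ?_
  exact mul_le_mul_of_nonneg_right
    (mul_le_mul_of_nonneg_left (hC t (uIoc_subset_uIcc ht)) G.bracketBound_pos.le) (norm_nonneg _)

lemma absolutelyContinuousOnInterval_bracket {f g : ℝ → EuclideanSpace ℝ (Fin d₁)} {a b : ℝ}
    (hf : AbsolutelyContinuousOnInterval f a b) (hg : AbsolutelyContinuousOnInterval g a b) :
    AbsolutelyContinuousOnInterval (fun t => G.bracket (f t) (g t)) a b := by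
  unfold bracket
  refine .finset_sum fun i _ => .finset_sum fun j _ => ?_
  have h1 := (hf.clm_comp (EuclideanSpace.proj (𝕜 := ℝ) i)).fun_mul
    (hg.clm_comp (EuclideanSpace.proj (𝕜 := ℝ) j))
  exact h1.clm_comp (ContinuousLinearMap.toSpanSingleton ℝ (G.w i j))

/-- Integration by parts for the bracket of two absolutely continuous curves. -/
lemma integral_bracket_deriv {f g : ℝ → EuclideanSpace ℝ (Fin d₁)} {a b : ℝ}
    (hf : AbsolutelyContinuousOnInterval f a b) (hg : AbsolutelyContinuousOnInterval g a b) :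
    ∫ t in a..b, G.bracket (f t) (deriv g t) =
      G.bracket (f b) (g b) - G.bracket (f a) (g a) + ∫ t in a..b, G.bracket (g t) (deriv f t) := by
  rw [← (G.absolutelyContinuousOnInterval_bracket hf hg).integral_deriv_eq_sub_euclidean,
    ← intervalIntegral.integral_add
      (G.absolutelyContinuousOnInterval_bracket hf hg).intervalIntegrable_deriv_euclidean
      (G.intervalIntegrable_bracket hg.continuousOn hf.intervalIntegrable_deriv_euclidean)]
  refine intervalIntegral.integral_congr_ae ?_
  filter_upwards [hf.ae_differentiableAt_finiteDimensional,
    hg.ae_differentiableAt_finiteDimensional] with t h1 h2 ht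
  have h1 := (h1 (uIoc_subset_uIcc ht)).hasDerivAt
  have h2 := (h2 (uIoc_subset_uIcc ht)).hasDerivAt
  have h3 : HasDerivAt (fun t => G.bracket (f t) (g t))
      (G.bracket (f t) (deriv g t) + G.bracket (deriv f t) (g t)) t := by
    exact (G.bracketL.isBoundedBilinearMap.hasFDerivAt (f t, g t)).comp_hasDerivAt t
      (h1.prodMk h2)
  rw [h3.deriv, G.bracket_swap (g t)]
  abel

end StepTwoCarnotGroup

namespace StepTwoCarnotGroup

variable {d₁ d₂ : ℕ} (G : StepTwoCarnotGroup d₁ d₂)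

/-! ### Algebra of the group and of its left translations -/

variable {G}

@[ext] lemma Carrier.ext {x y : G.Carrier} (h1 : x.1 = y.1) (h2 : x.2 = y.2) : x = y :=
  Prod.ext h1 h2

@[simp] lemma mul_fst (x y : G.Carrier) : (x * y).1 = x.1 + y.1 := rfl

@[simp] lemma mul_snd (x y : G.Carrier) :
    (x * y).2 = x.2 + y.2 + (1 / 2 : ℝ) • G.bracket x.1 y.1 := rfl

@[simp] lemma one_fst : (1 : G.Carrier).1 = 0 := rfl

@[simp] lemma one_snd : (1 : G.Carrier).2 = 0 := rfl

@[simp] lemma inv_fst (x : G.Carrier) : (x⁻¹).1 = -x.1 := rfl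

@[simp] lemma inv_snd (x : G.Carrier) : (x⁻¹).2 = -x.2 := rfl

lemma Carrier.smul_fst (c : ℝ) (x : G.Carrier) : (c • x).1 = c • x.1 := rfl

lemma Carrier.smul_snd (c : ℝ) (x : G.Carrier) : (c • x).2 = c • x.2 := rfl

@[simp] lemma dLeft_fst (x v : G.Carrier) : (G.dLeft x v).1 = v.1 := rfl

@[simp] lemma dLeft_snd (x v : G.Carrier) :
    (G.dLeft x v).2 = v.2 + (1 / 2 : ℝ) • G.bracket x.1 v.1 := rfl

lemma dLeft_dLeft (x y v : G.Carrier) : G.dLeft x (G.dLeft y v) = G.dLeft (x * y) v := by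
  ext1
  · rfl
  · simp only [dLeft_snd, dLeft_fst, mul_fst, bracket_add_left, smul_add]
    abel

lemma dLeft_one (v : G.Carrier) : G.dLeft 1 v = v := by
  ext1
  · rfl
  · simp [bracket_zero_left]

lemma mul_eq_add_dLeft (x y : G.Carrier) : x * y = x + G.dLeft x y := by
  ext1
  · rfl
  · exact add_assoc _ _ _

instance : FiniteDimensional ℝ G.Carrier :=
  inferInstanceAs (FiniteDimensional ℝ (EuclideanSpace ℝ (Fin d₁) × EuclideanSpace ℝ (Fin d₂)))

/-- The differential of a left translation, as a continuous linear equivalence. -/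
noncomputable def dLeftEquiv (x : G.Carrier) : G.Carrier ≃L[ℝ] G.Carrier :=
  LinearEquiv.toContinuousLinearEquiv
    { toFun := G.dLeft x
      invFun := G.dLeft x⁻¹
      left_inv := fun v => by rw [dLeft_dLeft, inv_mul_cancel, dLeft_one]
      right_inv := fun v => by rw [dLeft_dLeft, mul_inv_cancel, dLeft_one]
      map_add' := fun v v' => by
        ext1
        · rfl
        · change (v.2 + v'.2) + (1 / 2 : ℝ) • G.bracket x.1 (v.1 + v'.1) = _
          rw [bracket_add_right, smul_add]
          exact add_add_add_comm _ _ _ _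
      map_smul' := fun c v => by
        ext1
        · rfl
        · change c • v.2 + (1 / 2 : ℝ) • G.bracket x.1 (c • v.1) =
            c • (v.2 + (1 / 2 : ℝ) • G.bracket x.1 v.1)
          rw [bracket_smul_right, smul_add, smul_comm] }

lemma deriv_mul_left (g : G.Carrier) (γ : ℝ → G.Carrier) (t : ℝ) :
    deriv (fun s => g * γ s) t = G.dLeft g (deriv γ t) := by
  have h : (fun s => g * γ s) = fun s => g + dLeftEquiv g (γ s) := by
    funext s
    exact mul_eq_add_dLeft g (γ s)
  rw [h, deriv_const_add]
  by_cases hγ : DifferentiableAt ℝ γ t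
  · exact ((dLeftEquiv g).hasFDerivAt.comp_hasDerivAt t hγ.hasDerivAt).deriv
  · have hγ' : ¬DifferentiableAt ℝ (fun s => dLeftEquiv g (γ s)) t := fun h' =>
      hγ ((dLeftEquiv g).comp_differentiableAt_iff.mp h')
    rw [deriv_zero_of_not_differentiableAt hγ, deriv_zero_of_not_differentiableAt hγ']
    exact (map_zero (dLeftEquiv g)).symm

/-! ### Horizontal curves -/

lemma mem_span_V_iff (x v : G.Carrier) :
    v ∈ Submodule.span ℝ (Set.range fun i => G.V i x) ↔ v.2 = (1 / 2 : ℝ) • G.bracket x.1 v.1 := by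
  constructor
  · intro hv
    induction hv using Submodule.span_induction with
    | mem v hv =>
      obtain ⟨i, rfl⟩ := hv
      exact zero_add _
    | zero =>
      change (0 : EuclideanSpace ℝ (Fin d₂)) = (1 / 2 : ℝ) • G.bracket x.1 0
      rw [bracket_zero_right, smul_zero]
    | add u v _ _ hu hv =>
      change u.2 + v.2 = (1 / 2 : ℝ) • G.bracket x.1 (u.1 + v.1)
      rw [bracket_add_right, smul_add, hu, hv]
    | smul c v _ hv =>
      change c • v.2 = (1 / 2 : ℝ) • G.bracket x.1 (c • v.1)
      rw [bracket_smul_right, hv, smul_comm]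
  · intro hv
    have h : v = ∑ i, v.1 i • G.V i x := by
      let e : Fin d₁ → G.Carrier := fun i => (EuclideanSpace.single i (1 : ℝ), 0)
      have h0 : ∑ i, v.1 i • e i = ((v.1, 0) : G.Carrier) := by
        refine Prod.ext (Prod.fst_sum.trans ?_) (Prod.snd_sum.trans ?_)
        · ext j
          simp only [Carrier.smul_fst]
          simp [e, Finset.sum_apply, Pi.single_apply]
        · simp only [Carrier.smul_snd]
          simp [e]
      have h1 : v = dLeftEquiv x (∑ i, v.1 i • e i) := by
        rw [h0]
        ext1
        · rfl
        · exact hv.trans (zero_add _).symm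
      refine h1.trans ((map_sum (dLeftEquiv x) _ _).trans (Finset.sum_congr rfl fun i _ => ?_))
      exact map_smul (dLeftEquiv x) _ _
    rw [h]
    exact Submodule.sum_mem _ fun i _ =>
      Submodule.smul_mem _ _ (Submodule.subset_span ⟨i, rfl⟩)

lemma norm_fst_le_tangentNorm (x v : G.Carrier) : ‖v.1‖ ≤ G.tangentNorm x v := by
  refine Real.le_sqrt_of_sq_le ?_
  rw [dLeft_fst]
  exact le_add_of_nonneg_right (sq_nonneg _)

lemma tangentNorm_of_horizontal {x v : G.Carrier} (h : v.2 = (1 / 2 : ℝ) • G.bracket x.1 v.1) :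
    G.tangentNorm x v = ‖v.1‖ := by
  have h2 : (G.dLeft x⁻¹ v).2 = 0 := by
    rw [dLeft_snd, inv_fst, bracket_neg_left, h, smul_neg, add_neg_cancel]
  rw [tangentNorm, h2, dLeft_fst, norm_zero, zero_pow two_ne_zero, add_zero,
    Real.sqrt_sq (norm_nonneg _)]

lemma tangentNorm_mul_left (g x v : G.Carrier) :
    G.tangentNorm (g * x) (G.dLeft g v) = G.tangentNorm x v := by
  rw [tangentNorm, dLeft_dLeft, mul_inv_rev, inv_mul_cancel_right, tangentNorm]

lemma IsHorizontal.mul_left {γ : ℝ → G.Carrier} (hγ : G.IsHorizontal γ) (g : G.Carrier) :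
    G.IsHorizontal fun t => g * γ t := by
  refine ⟨?_, ?_⟩
  · have h1 := hγ.1.clm_comp (dLeftEquiv g : G.Carrier →L[ℝ] G.Carrier)
    have h2 : (fun t => g * γ t) = fun t => g + dLeftEquiv g (γ t) := by
      funext s
      exact mul_eq_add_dLeft g (γ s)
    rw [h2]
    exact h1.lipschitz_comp (LipschitzWith.of_dist_le_mul (K := 1) fun a b => by simp)
  · filter_upwards [hγ.2] with t ht
    rw [mem_span_V_iff] at ht ⊢
    rw [deriv_mul_left, dLeft_snd, ht, dLeft_fst, mul_fst, bracket_add_left, smul_add, add_comm]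

lemma curveLength_mul_left (γ : ℝ → G.Carrier) (g : G.Carrier) :
    G.curveLength (fun t => g * γ t) = G.curveLength γ := by
  simp only [curveLength, deriv_mul_left, tangentNorm_mul_left]

lemma dcc_mul_left_le (g x y : G.Carrier) : G.dcc (g * x) (g * y) ≤ G.dcc x y := by
  refine le_iInf₂ fun γ hγ => le_iInf₂ fun h0 h1 => ?_
  rw [← curveLength_mul_left γ g]
  exact iInf₂_le_of_le _ (hγ.mul_left g)
    (iInf₂_le_of_le (congrArg (g * ·) h0) (congrArg (g * ·) h1) le_rfl)

lemma dcc_mul_left (g x y : G.Carrier) : G.dcc (g * x) (g * y) = G.dcc x y := by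
  refine le_antisymm (dcc_mul_left_le g x y) ?_
  simpa using dcc_mul_left_le g⁻¹ (g * x) (g * y)

lemma dcc_eq_dcc_one (x y : G.Carrier) : G.dcc x y = G.dcc 1 (x⁻¹ * y) := by
  rw [← dcc_mul_left x⁻¹ x y, inv_mul_cancel]

section Estimates

variable {γ : ℝ → G.Carrier}

lemma absolutelyContinuousOnInterval_fst (hγ : AbsolutelyContinuousOnInterval γ 0 1) :
    AbsolutelyContinuousOnInterval (fun t => (γ t).1) 0 1 :=
  hγ.clm_comp (ContinuousLinearMap.fst ℝ (EuclideanSpace ℝ (Fin d₁)) (EuclideanSpace ℝ (Fin d₂)))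

lemma absolutelyContinuousOnInterval_snd (hγ : AbsolutelyContinuousOnInterval γ 0 1) :
    AbsolutelyContinuousOnInterval (fun t => (γ t).2) 0 1 :=
  hγ.clm_comp (ContinuousLinearMap.snd ℝ (EuclideanSpace ℝ (Fin d₁)) (EuclideanSpace ℝ (Fin d₂)))

lemma ae_deriv_fst (hγ : AbsolutelyContinuousOnInterval γ 0 1) :
    ∀ᵐ t ∂(volume.restrict (Icc (0 : ℝ) 1)), deriv (fun t => (γ t).1) t = (deriv γ t).1 := by
  rw [ae_restrict_iff' measurableSet_Icc]
  filter_upwards [hγ.ae_differentiableAt_finiteDimensional] with t ht ht'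
  rw [uIcc_of_le zero_le_one] at ht
  exact ((ContinuousLinearMap.fst ℝ (EuclideanSpace ℝ (Fin d₁)) (EuclideanSpace ℝ
    (Fin d₂))).hasFDerivAt.comp_hasDerivAt t (ht ht').hasDerivAt).deriv

lemma ae_deriv_snd (hγ : AbsolutelyContinuousOnInterval γ 0 1) :
    ∀ᵐ t ∂(volume.restrict (Icc (0 : ℝ) 1)), deriv (fun t => (γ t).2) t = (deriv γ t).2 := by
  rw [ae_restrict_iff' measurableSet_Icc]
  filter_upwards [hγ.ae_differentiableAt_finiteDimensional] with t ht ht'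
  rw [uIcc_of_le zero_le_one] at ht
  exact ((ContinuousLinearMap.snd ℝ (EuclideanSpace ℝ (Fin d₁)) (EuclideanSpace ℝ
    (Fin d₂))).hasFDerivAt.comp_hasDerivAt t (ht ht').hasDerivAt).deriv

lemma lintegral_enorm_deriv_fst_le (hγ : AbsolutelyContinuousOnInterval γ 0 1) :
    ∫⁻ t in Icc (0 : ℝ) 1, ‖deriv (fun t => (γ t).1) t‖ₑ ≤ G.curveLength γ := by
  refine lintegral_mono_ae ?_
  filter_upwards [ae_deriv_fst hγ] with t ht
  rw [ht, ← ofReal_norm]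
  exact ENNReal.ofReal_le_ofReal (norm_fst_le_tangentNorm _ _)

lemma enorm_fst_sub_le_curveLength (hγ : AbsolutelyContinuousOnInterval γ 0 1) {t : ℝ}
    (ht : t ∈ Icc (0 : ℝ) 1) : ‖(γ t).1 - (γ 0).1‖ₑ ≤ G.curveLength γ := by
  have hac := (absolutelyContinuousOnInterval_fst hγ).mono (c := 0) (d := t) (by
    rw [uIcc_of_le ht.1, uIcc_of_le zero_le_one]
    exact Icc_subset_Icc_right ht.2)
  rw [← hac.integral_deriv_eq_sub_euclidean, intervalIntegral.integral_of_le ht.1]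
  refine (enorm_integral_le_lintegral_enorm _).trans ?_
  refine (lintegral_mono_set ?_).trans (lintegral_enorm_deriv_fst_le hγ)
  exact Ioc_subset_Icc_self.trans (Icc_subset_Icc_right ht.2)

/-- A horizontal curve of length `ℓ` from the identity stays within `ℓ` of the origin in the first
layer, so that the area swept in the second layer is at most a multiple of `ℓ²`. -/
lemma IsHorizontal.enorm_snd_le (hγ : G.IsHorizontal γ) (h0 : γ 0 = 1) :
    ‖(γ 1).2‖ₑ ≤ ENNReal.ofReal G.bracketBound * G.curveLength γ ^ 2 := by
  have h1 := (absolutelyContinuousOnInterval_snd hγ.1).integral_deriv_eq_sub_euclidean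
  rw [h0, one_snd, sub_zero, intervalIntegral.integral_of_le zero_le_one] at h1
  rw [← h1]
  refine (enorm_integral_le_lintegral_enorm _).trans ?_
  refine (lintegral_mono_set Ioc_subset_Icc_self).trans ?_
  calc ∫⁻ t in Icc (0 : ℝ) 1, ‖deriv (fun t => (γ t).2) t‖ₑ
      ≤ ∫⁻ t in Icc (0 : ℝ) 1, ENNReal.ofReal G.bracketBound * G.curveLength γ *
          ‖deriv (fun t => (γ t).1) t‖ₑ := by
        refine lintegral_mono_ae ?_
        filter_upwards [ae_deriv_fst hγ.1, ae_deriv_snd hγ.1, hγ.2,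
          ae_restrict_mem measurableSet_Icc] with t ht1 ht2 ht3 ht
        rw [mem_span_V_iff] at ht3
        have h2 : ‖(γ t).1‖ₑ ≤ G.curveLength γ := by
          simpa [h0] using enorm_fst_sub_le_curveLength hγ.1 ht
        refine le_trans ?_ (mul_le_mul_left (mul_le_mul_right h2 _) _)
        rw [ht1, ht2, ht3, ← ofReal_norm, ← ofReal_norm, ← ofReal_norm,
          ← ENNReal.ofReal_mul G.bracketBound_pos.le,
          ← ENNReal.ofReal_mul (mul_nonneg G.bracketBound_pos.le (norm_nonneg _))]
        refine ENNReal.ofReal_le_ofReal ?_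
        rw [norm_smul]
        refine le_trans ?_ (G.norm_bracket_le _ _)
        refine mul_le_of_le_one_left (norm_nonneg _) ?_
        norm_num
    _ = ENNReal.ofReal G.bracketBound * G.curveLength γ *
          ∫⁻ t in Icc (0 : ℝ) 1, ‖deriv (fun t => (γ t).1) t‖ₑ :=
        lintegral_const_mul _ (measurable_deriv _).enorm
    _ ≤ ENNReal.ofReal G.bracketBound * G.curveLength γ * G.curveLength γ := by
        gcongr
        exact lintegral_enorm_deriv_fst_le hγ.1
    _ = _ := by rw [mul_assoc, sq]

end Estimates

lemma enorm_fst_le_dcc_one (x : G.Carrier) : ‖x.1‖ₑ ≤ G.dcc 1 x := by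
  refine le_iInf₂ fun γ hγ => le_iInf₂ fun h0 h1 => ?_
  simpa [h0, h1] using enorm_fst_sub_le_curveLength hγ.1 (right_mem_Icc.mpr zero_le_one)

lemma norm_fst_le_toReal_dcc {x : G.Carrier} (hx : G.dcc 1 x ≠ ⊤) :
    ‖x.1‖ ≤ (G.dcc 1 x).toReal := by
  have := ENNReal.toReal_mono hx (enorm_fst_le_dcc_one x)
  rwa [toReal_enorm] at this

lemma norm_snd_le_toReal_dcc_sq {x : G.Carrier} (hx : G.dcc 1 x ≠ ⊤) :
    ‖x.2‖ ≤ G.bracketBound * (G.dcc 1 x).toReal ^ 2 := by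
  have hC := G.bracketBound_pos
  have h : ENNReal.ofReal √(‖x.2‖ / G.bracketBound) ≤ G.dcc 1 x := by
    refine le_iInf₂ fun γ hγ => le_iInf₂ fun h0 h1 => ?_
    by_cases hl : G.curveLength γ = ⊤
    · simp [hl]
    have h2 := hγ.enorm_snd_le h0
    have h3 := ENNReal.toReal_mono (by finiteness) h2
    rw [toReal_enorm, ENNReal.toReal_mul, ENNReal.toReal_pow, ENNReal.toReal_ofReal hC.le, h1] at h3
    refine ENNReal.ofReal_le_of_le_toReal (Real.sqrt_le_iff.mpr ⟨ENNReal.toReal_nonneg, ?_⟩)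
    rwa [div_le_iff₀' hC]
  have h4 := ENNReal.toReal_mono hx h
  rw [ENNReal.toReal_ofReal (Real.sqrt_nonneg _), Real.sqrt_le_iff, div_le_iff₀' hC] at h4
  exact h4.2

end StepTwoCarnotGroup

namespace StepTwoCarnotGroup

variable {d₁ d₂ : ℕ} (G : StepTwoCarnotGroup d₁ d₂)

/-! ### Products of exponentials of horizontal vectors -/

/-- The exponential of a vector of the first layer. -/
def expo (v : EuclideanSpace ℝ (Fin d₁)) : G.Carrier := (v, (0 : EuclideanSpace ℝ (Fin d₂)))

/-- The element of the second layer, which is central, with coordinates `c`. -/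
def central (c : EuclideanSpace ℝ (Fin d₂)) : G.Carrier := ((0 : EuclideanSpace ℝ (Fin d₁)), c)

/-- The product `exp (v 0) * ⋯ * exp (v (n - 1))` of exponentials of vectors of the first layer. -/
noncomputable def polyProd (v : ℕ → EuclideanSpace ℝ (Fin d₁)) : ℕ → G.Carrier
  | 0 => 1
  | n + 1 => polyProd v n * G.expo (v n)

variable {G}

@[simp] lemma expo_fst (v : EuclideanSpace ℝ (Fin d₁)) : (G.expo v).1 = v := rfl

@[simp] lemma expo_snd (v : EuclideanSpace ℝ (Fin d₁)) : (G.expo v).2 = 0 := rfl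

@[simp] lemma central_fst (c : EuclideanSpace ℝ (Fin d₂)) : (G.central c).1 = 0 := rfl

@[simp] lemma central_snd (c : EuclideanSpace ℝ (Fin d₂)) : (G.central c).2 = c := rfl

lemma polyProd_zero (v : ℕ → EuclideanSpace ℝ (Fin d₁)) : G.polyProd v 0 = 1 := rfl

lemma polyProd_succ (v : ℕ → EuclideanSpace ℝ (Fin d₁)) (n : ℕ) :
    G.polyProd v (n + 1) = G.polyProd v n * G.expo (v n) := rfl

lemma polyProd_congr {v v' : ℕ → EuclideanSpace ℝ (Fin d₁)} {n : ℕ} (h : ∀ i < n, v i = v' i) :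
    G.polyProd v n = G.polyProd v' n := by
  induction n with
  | zero => rfl
  | succ n ih =>
    rw [polyProd_succ, polyProd_succ, ih fun i hi => h i (hi.trans n.lt_succ_self),
      h n n.lt_succ_self]

lemma polyProd_add (v : ℕ → EuclideanSpace ℝ (Fin d₁)) (m n : ℕ) :
    G.polyProd v (m + n) = G.polyProd v m * G.polyProd (fun i => v (m + i)) n := by
  induction n with
  | zero => exact (mul_one _).symm
  | succ n ih => rw [← add_assoc, polyProd_succ, ih, polyProd_succ, mul_assoc]

lemma polyProd_fst (v : ℕ → EuclideanSpace ℝ (Fin d₁)) (n : ℕ) :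
    (G.polyProd v n).1 = ∑ i ∈ Finset.range n, v i := by
  induction n with
  | zero => rfl
  | succ n ih => rw [Finset.sum_range_succ, ← ih]; rfl

/-- `x` is a product of `n` exponentials of vectors of the first layer of norm at most `r`. -/
def IsShortProduct (n : ℕ) (r : ℝ) (x : G.Carrier) : Prop :=
  ∃ v : ℕ → EuclideanSpace ℝ (Fin d₁), G.polyProd v n = x ∧ ∀ i, ‖v i‖ ≤ r

lemma IsShortProduct.mul {m n : ℕ} {r : ℝ} {x y : G.Carrier} (hx : IsShortProduct m r x)
    (hy : IsShortProduct n r y) : IsShortProduct (m + n) r (x * y) := by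
  obtain ⟨v, rfl, hv⟩ := hx
  obtain ⟨v', rfl, hv'⟩ := hy
  refine ⟨fun i => if i < m then v i else v' (i - m), ?_, fun i => ?_⟩
  · rw [polyProd_add]
    congr 1
    · exact polyProd_congr fun i hi => by simp [hi]
    · exact polyProd_congr fun i _ => by simp
  · dsimp only
    split_ifs
    exacts [hv i, hv' _]

lemma isShortProduct_expo {r : ℝ} {v : EuclideanSpace ℝ (Fin d₁)} (hv : ‖v‖ ≤ r) :
    IsShortProduct 1 r (G.expo v) :=
  ⟨fun _ => v, one_mul _, fun _ => hv⟩

/-- Every multiple of a structure vector `w i j` is the commutator of two exponentials whose lengths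
are the square root of its size. -/
lemma isShortProduct_smul_w {r c : ℝ} (hr : 0 ≤ r) (hc : |c| ≤ r ^ 2) (i j : Fin d₁) :
    IsShortProduct 4 r (G.central (c • G.w i j)) := by
  set a : EuclideanSpace ℝ (Fin d₁) := (Real.sign c * √|c|) • EuclideanSpace.single i (1 : ℝ)
    with ha
  set b : EuclideanSpace ℝ (Fin d₁) := √|c| • EuclideanSpace.single j (1 : ℝ) with hb
  have hs : √|c| ≤ r := Real.sqrt_le_iff.mpr ⟨hr, hc⟩
  have hbr : ‖b‖ ≤ r := by
    rw [hb, norm_smul]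
    simpa [abs_of_nonneg (Real.sqrt_nonneg _)] using hs
  have har : ‖a‖ ≤ r := by
    rw [ha, norm_smul]
    rcases lt_trichotomy c 0 with h | h | h
    · simpa [Real.sign_of_neg h, abs_of_nonneg (Real.sqrt_nonneg _)] using hs
    · simpa [h] using hr
    · simpa [Real.sign_of_pos h, abs_of_nonneg (Real.sqrt_nonneg _)] using hs
  have hab : G.bracket a b = c • G.w i j := by
    rw [ha, hb, bracket_smul_left, bracket_smul_right, smul_smul]
    have h1 : G.bracket (EuclideanSpace.single i (1 : ℝ)) (EuclideanSpace.single j 1) =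
        G.w i j := by
      simp [bracket]
    rw [h1, mul_assoc, Real.mul_self_sqrt (abs_nonneg c)]
    congr 1
    rcases lt_trichotomy c 0 with h | h | h
    · simp [Real.sign_of_neg h, abs_of_neg h]
    · simp [h]
    · simp [Real.sign_of_pos h, abs_of_pos h]
  have h : G.central (c • G.w i j) = G.expo a * G.expo b * G.expo (-a) * G.expo (-b) := by
    ext1
    · change 0 = a + b + -a + -b
      abel
    · simp only [central_snd, mul_snd, mul_fst, expo_fst, expo_snd, ← hab, bracket_add_left,
        bracket_neg_right, bracket_neg_left, bracket_self, G.bracket_swap b a]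
      module
  rw [h]
  exact (((isShortProduct_expo har).mul (isShortProduct_expo hbr)).mul
    (isShortProduct_expo (by rwa [norm_neg]))).mul (isShortProduct_expo (by rwa [norm_neg]))

variable (G) in
/-- Chow's theorem in quantitative form: every element is a product of a fixed number of
exponentials, with lengths controlled by the homogeneous size `‖x⁽¹⁾‖ + ‖x⁽²⁾‖^{1/2}`. -/
lemma exists_isShortProduct : ∃ (M : ℕ) (K : ℝ), 0 < M ∧ ∀ x : G.Carrier,
    IsShortProduct M (‖x.1‖ + K * √‖x.2‖) x := by
  have hsurj : Function.Surjective
      (Fintype.linearCombination ℝ fun p : Fin d₁ × Fin d₁ => G.w p.1 p.2) := by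
    rw [← LinearMap.range_eq_top, Fintype.range_linearCombination, G.span_eq_top]
  obtain ⟨R, hR⟩ := LinearMap.exists_rightInverse_of_surjective _
    (LinearMap.range_eq_top.mpr hsurj)
  set R' := LinearMap.toContinuousLinearMap R
  refine ⟨1 + Finset.univ.card (α := Fin d₁ × Fin d₁) * 4, √‖R'‖, by omega, fun x => ?_⟩
  set r : ℝ := ‖x.1‖ + √‖R'‖ * √‖x.2‖
  have hr : 0 ≤ r := by positivity
  have hc : ∀ p, |R' x.2 p| ≤ r ^ 2 := fun p => by
    calc |R' x.2 p| ≤ ‖R' x.2‖ := norm_le_pi_norm (R' x.2) p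
      _ ≤ ‖R'‖ * ‖x.2‖ := R'.le_opNorm _
      _ = (√‖R'‖ * √‖x.2‖) ^ 2 := by
        rw [mul_pow, Real.sq_sqrt (norm_nonneg _), Real.sq_sqrt (norm_nonneg _)]
      _ ≤ r ^ 2 := by
        gcongr
        exact le_add_of_nonneg_left (norm_nonneg _)
  have hsum : ∀ s : Finset (Fin d₁ × Fin d₁), IsShortProduct (s.card * 4) r
      (G.central (∑ p ∈ s, R' x.2 p • G.w p.1 p.2)) := by
    intro s
    induction s using Finset.induction_on with
    | empty =>
      rw [Finset.sum_empty, Finset.card_empty, zero_mul]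
      exact ⟨fun _ => 0, rfl, fun _ => by simpa using hr⟩
    | insert p s hp ih =>
      rw [Finset.sum_insert hp, Finset.card_insert_of_notMem hp, add_mul, add_comm, one_mul]
      have h : G.central (R' x.2 p • G.w p.1 p.2 + ∑ q ∈ s, R' x.2 q • G.w q.1 q.2) =
          G.central (R' x.2 p • G.w p.1 p.2) * G.central (∑ q ∈ s, R' x.2 q • G.w q.1 q.2) := by
        ext1
        · exact (add_zero 0).symm
        · simp only [mul_snd, central_fst, central_snd, bracket_zero_left, smul_zero, add_zero]
      rw [h]
      exact (isShortProduct_smul_w hr (hc p) p.1 p.2).mul ih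
  have hx : x = G.expo x.1 * G.central (∑ p, R' x.2 p • G.w p.1 p.2) := by
    have h2 : ∑ p, R' x.2 p • G.w p.1 p.2 = x.2 := LinearMap.congr_fun hR x.2
    rw [h2]
    ext1
    · exact (add_zero x.1).symm
    · simp only [mul_snd, central_fst, central_snd, bracket_zero_right, smul_zero, add_zero,
        expo_snd, zero_add]
  have h1 : ‖x.1‖ ≤ r := le_add_of_nonneg_right (by positivity)
  have h2 := (isShortProduct_expo (G := G) h1).mul (hsum Finset.univ)
  rwa [← hx] at h2

end StepTwoCarnotGroup

namespace StepTwoCarnotGroup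

variable {d₁ d₂ : ℕ} (G : StepTwoCarnotGroup d₁ d₂)

/-! ### Horizontal lifts of Lipschitz curves -/

/-- The horizontal lift of a curve in the first layer, as a curve on the whole line. -/
noncomputable def liftCurve (a : ℝ → EuclideanSpace ℝ (Fin d₁)) (t : ℝ) : G.Carrier :=
  (a t, (1 / 2 : ℝ) • ∫ s in (0 : ℝ)..t, G.bracket (a s) (deriv a s))

lemma lift_eq_liftCurve (a : ℝ → EuclideanSpace ℝ (Fin d₁)) (t : unitInterval) :
    G.lift a t = G.liftCurve a t := rfl

section Lipschitz

variable {a : ℝ → EuclideanSpace ℝ (Fin d₁)} {K : NNReal}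

lemma intervalIntegrable_bracket_deriv (ha : LipschitzWith K a) (s t : ℝ) :
    IntervalIntegrable (fun r => G.bracket (a r) (deriv a r)) volume s t :=
  G.intervalIntegrable_bracket ha.continuous.continuousOn
    (ha.lipschitzOnWith.absolutelyContinuousOnInterval).intervalIntegrable_deriv_euclidean

lemma ae_hasDerivAt_liftCurve (ha : LipschitzWith K a) :
    ∀ᵐ t ∂(volume.restrict (Icc (0 : ℝ) 1)), HasDerivAt (G.liftCurve a)
      (deriv a t, (1 / 2 : ℝ) • G.bracket (a t) (deriv a t)) t := by
  rw [ae_restrict_iff' measurableSet_Icc]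
  filter_upwards [(ha.lipschitzOnWith (s := uIcc 0 1)).absolutelyContinuousOnInterval
    |>.ae_differentiableAt_finiteDimensional,
    (G.intervalIntegrable_bracket_deriv ha 0 1).ae_hasDerivAt_integral] with t h1 h2 ht
  rw [uIcc_of_le zero_le_one] at h1 h2
  exact (h1 ht).hasDerivAt.prodMk
    ((h2 ht 0 (left_mem_Icc.mpr zero_le_one)).const_smul (1 / 2 : ℝ))

lemma isHorizontal_liftCurve (ha : LipschitzWith K a) {S : ℝ} (hS : ∀ t, ‖a t‖ ≤ S) :
    G.IsHorizontal (G.liftCurve a) := by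
  have hS0 : 0 ≤ S := (norm_nonneg _).trans (hS 0)
  have hC := G.bracketBound_pos
  have hB : ∀ t, ‖G.bracket (a t) (deriv a t)‖ ≤ G.bracketBound * S * K := fun t => by
    refine (G.norm_bracket_le _ _).trans ?_
    have := norm_deriv_le_of_lipschitz (x₀ := t) ha
    gcongr
    exact hS t
  refine ⟨?_, ?_⟩
  · have h2 : LipschitzWith (Real.toNNReal (G.bracketBound * S * K))
        fun t => (1 / 2 : ℝ) • ∫ s in (0 : ℝ)..t, G.bracket (a s) (deriv a s) := by
      refine LipschitzWith.of_dist_le_mul fun t s => ?_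
      rw [dist_eq_norm, ← smul_sub, intervalIntegral.integral_interval_sub_left
        (G.intervalIntegrable_bracket_deriv ha 0 t) (G.intervalIntegrable_bracket_deriv ha 0 s),
        norm_smul, Real.coe_toNNReal _ (by positivity), Real.dist_eq]
      refine (mul_le_of_le_one_left (norm_nonneg _) (by norm_num)).trans ?_
      exact intervalIntegral.norm_integral_le_of_norm_le_const fun r _ => hB r
    have h3 : LipschitzWith (max K (Real.toNNReal (G.bracketBound * S * K))) (G.liftCurve a) :=
      ha.prodMk h2
    exact h3.lipschitzOnWith.absolutelyContinuousOnInterval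
  · filter_upwards [G.ae_hasDerivAt_liftCurve ha] with t ht
    refine (mem_span_V_iff _ _).mpr ?_
    rw [ht.deriv]
    rfl

lemma curveLength_liftCurve (ha : LipschitzWith K a) :
    G.curveLength (G.liftCurve a) = ∫⁻ t in Icc (0 : ℝ) 1, ‖deriv a t‖ₑ := by
  refine lintegral_congr_ae ?_
  filter_upwards [G.ae_hasDerivAt_liftCurve ha] with t ht
  have h : (deriv (G.liftCurve a) t).2 =
      (1 / 2 : ℝ) • G.bracket (G.liftCurve a t).1 (deriv (G.liftCurve a) t).1 := by
    rw [ht.deriv]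
    rfl
  rw [tangentNorm_of_horizontal h, ofReal_norm, ht.deriv]

end Lipschitz

/-! ### Polygons -/

/-- An upper bound for an integral over `[0, 1]` in terms of bounds on the intervals of a uniform
grid. -/
lemma _root_.lintegral_Icc_le_sum {N : ℕ} (hN : 0 < N) {f : ℝ → ℝ≥0∞} {c : ℕ → ℝ≥0∞}
    (h : ∀ i < N, ∀ t ∈ Ioo ((i : ℝ) / N) ((i + 1 : ℝ) / N), f t ≤ c i) :
    ∫⁻ t in Icc (0 : ℝ) 1, f t ≤ ∑ i ∈ Finset.range N, ENNReal.ofReal (1 / N) * c i := by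
  have hN' : (0 : ℝ) < N := by exact_mod_cast hN
  have hcover : Ico (0 : ℝ) 1 ⊆ ⋃ i : Fin N, Ico ((i : ℝ) / N) ((i + 1 : ℝ) / N) := by
    intro t ht
    have h0 : 0 ≤ N * t := mul_nonneg hN'.le ht.1
    have h1 : ⌊N * t⌋₊ < N := by
      rw [Nat.floor_lt h0]
      exact mul_lt_of_lt_one_right hN' ht.2
    refine mem_iUnion.mpr ⟨⟨⌊N * t⌋₊, h1⟩, ?_, ?_⟩
    · rw [div_le_iff₀' hN']
      exact Nat.floor_le h0
    · rw [lt_div_iff₀' hN']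
      exact Nat.lt_floor_add_one _
  have hedge : ∀ i < N, ∫⁻ t in Ico ((i : ℝ) / N) ((i + 1 : ℝ) / N), f t ≤
      ENNReal.ofReal (1 / N) * c i := by
    intro i hi
    rw [setLIntegral_congr Ioo_ae_eq_Ico.symm]
    refine (setLIntegral_mono_ae' measurableSet_Ioo (ae_of_all _ fun t ht => h i hi t ht)).trans ?_
    rw [setLIntegral_const, Real.volume_Ioo, ← sub_div, add_sub_cancel_left, mul_comm]
  rw [setLIntegral_congr Ico_ae_eq_Icc.symm]
  refine ((lintegral_mono_set hcover).trans (lintegral_iUnion_le _ _)).trans ?_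
  rw [tsum_fintype, ← Fin.sum_univ_eq_sum_range fun i => ENNReal.ofReal (1 / N) * c i]
  exact Finset.sum_le_sum fun i _ => hedge i i.2

/-- The polygon with `N` edges `v 0, …, v (N - 1)` starting from the origin, each edge being run
through at constant speed in time `1 / N`. The closed formula makes it bounded and Lipschitz on the
whole line. -/
noncomputable def _root_.polygon {d : ℕ} (N : ℕ) (v : ℕ → EuclideanSpace ℝ (Fin d)) (t : ℝ) :
    EuclideanSpace ℝ (Fin d) :=
  ∑ i ∈ Finset.range N, max 0 (min (N * t - i) 1) • v i

section Polygon

variable {d N : ℕ} {v : ℕ → EuclideanSpace ℝ (Fin d)}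

lemma _root_.exists_lipschitzWith_polygon (N : ℕ) (v : ℕ → EuclideanSpace ℝ (Fin d)) :
    ∃ K, LipschitzWith K (polygon N v) := by
  refine ⟨Real.toNNReal (∑ i ∈ Finset.range N, N * ‖v i‖), LipschitzWith.of_dist_le_mul
    fun t s => ?_⟩
  rw [Real.coe_toNNReal _ (Finset.sum_nonneg fun _ _ => by positivity), dist_eq_norm, polygon,
    polygon, ← Finset.sum_sub_distrib, Finset.sum_mul]
  refine norm_sum_le_of_le _ fun i _ => ?_
  have h : |max 0 (min (N * t - i) 1) - max 0 (min (N * s - i) 1)| ≤ N * |t - s| := by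
    have h1 : LipschitzWith 1 fun x : ℝ => max 0 (min x 1) :=
      (LipschitzWith.id.min_const 1).const_max 0
    have h2 := h1.dist_le_mul (N * t - i) (N * s - i)
    rw [Real.dist_eq, Real.dist_eq, NNReal.coe_one, one_mul] at h2
    refine h2.trans (le_of_eq ?_)
    rw [sub_sub_sub_cancel_right, ← mul_sub, abs_mul, Nat.abs_cast]
  rw [← sub_smul, norm_smul, Real.norm_eq_abs, Real.dist_eq]
  nlinarith [norm_nonneg (v i)]

lemma _root_.norm_polygon_le (t : ℝ) : ‖polygon N v t‖ ≤ ∑ i ∈ Finset.range N, ‖v i‖ := by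
  refine norm_sum_le_of_le _ fun i _ => ?_
  rw [norm_smul]
  refine mul_le_of_le_one_left (norm_nonneg _) ?_
  rw [Real.norm_eq_abs, abs_of_nonneg (le_max_left _ _)]
  exact max_le zero_le_one (min_le_right _ _)

lemma _root_.polygon_eq {j : ℕ} (hj : j < N) {t : ℝ} (h1 : j ≤ N * t) (h2 : N * t ≤ j + 1) :
    polygon N v t = ∑ i ∈ Finset.range j, v i + (N * t - j) • v j := by
  obtain ⟨m, rfl⟩ : ∃ m, N = j + 1 + m := ⟨N - (j + 1), by omega⟩
  rw [polygon, Finset.sum_range_add, Finset.sum_range_succ]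
  rw [Finset.sum_eq_zero (s := Finset.range m), add_zero]
  · congr 1
    · refine Finset.sum_congr rfl fun i hi => ?_
      have hi' : (i : ℝ) + 1 ≤ j := by exact_mod_cast Finset.mem_range.mp hi
      rw [min_eq_right (by linarith), max_eq_right zero_le_one, one_smul]
    · rw [min_eq_left (by linarith), max_eq_right (by linarith)]
  · intro i _
    have : (0 : ℝ) ≤ i := Nat.cast_nonneg i
    rw [max_eq_left, zero_smul]
    refine (min_le_left _ _).trans ?_
    push_cast at h2 ⊢
    linarith

lemma _root_.polygon_zero_right : polygon N v 0 = 0 := by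
  refine Finset.sum_eq_zero fun i _ => ?_
  rw [max_eq_left, zero_smul]
  refine (min_le_left _ _).trans ?_
  simp

lemma _root_.hasDerivAt_polygon {j : ℕ} (hj : j < N) {t : ℝ} (h1 : j < N * t)
    (h2 : N * t < j + 1) : HasDerivAt (polygon N v) ((N : ℝ) • v j) t := by
  have h : HasDerivAt (fun t : ℝ => ∑ i ∈ Finset.range j, v i + (N * t - j) • v j)
      ((N : ℝ) • v j) t := by
    have h0 : HasDerivAt (fun t : ℝ => N * t - (j : ℝ)) N t := by
      simpa using ((hasDerivAt_id t).const_mul (N : ℝ)).sub_const (j : ℝ)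
    simpa using (h0.smul_const (v j)).const_add (∑ i ∈ Finset.range j, v i)
  refine h.congr_of_eventuallyEq ?_
  have hc : Continuous fun t : ℝ => N * t := by fun_prop
  filter_upwards [hc.continuousAt.eventually (Ioo_mem_nhds h1 h2)] with s hs
  exact polygon_eq hj hs.1.le hs.2.le

variable {w : ℕ → EuclideanSpace ℝ (Fin d₁)}

/-- The lift of a polygon in the course of its edge `j`. -/
lemma liftCurve_polygon {j : ℕ} (hj : j < N) {t : ℝ} (h1 : j ≤ N * t) (h2 : N * t ≤ j + 1) :
    G.liftCurve (polygon N w) t = G.polyProd w j * G.expo ((N * t - j) • w j) := by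
  have hN : (0 : ℝ) < N := by exact_mod_cast (Nat.zero_le j).trans_lt hj
  obtain ⟨K, hK⟩ := exists_lipschitzWith_polygon N w
  -- the area swept during part of the edge `j`
  have hedge : ∀ j < N, ∀ t : ℝ, j ≤ N * t → N * t ≤ j + 1 →
      ∫ s in ((j : ℝ) / N)..t, G.bracket (polygon N w s) (deriv (polygon N w) s) =
        (N * t - j) • G.bracket (G.polyProd w j).1 (w j) := by
    intro j hj t h1 h2
    have hjt : (j : ℝ) / N ≤ t := by rwa [div_le_iff₀' hN]
    rw [intervalIntegral.integral_congr_Ioo_of_le hjt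
      (g := fun _ => (N : ℝ) • G.bracket (G.polyProd w j).1 (w j)),
      intervalIntegral.integral_const, smul_smul]
    · congr 1
      field_simp
    · intro s hs
      have h3 : (j : ℝ) < N * s := by
        have := hs.1
        rwa [div_lt_iff₀' hN] at this
      have h4 : N * s < j + 1 := (mul_lt_mul_of_pos_left hs.2 hN).trans_le h2
      simp only
      rw [(hasDerivAt_polygon hj h3 h4).deriv, polygon_eq hj h3.le h4.le, bracket_smul_right,
        bracket_add_left, bracket_smul_left, bracket_self, smul_zero, add_zero, polyProd_fst]
  have hnode : ∀ j ≤ N,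
      (1 / 2 : ℝ) • ∫ s in (0 : ℝ)..((j : ℝ) / N),
        G.bracket (polygon N w s) (deriv (polygon N w) s) = (G.polyProd w j).2 := by
    intro j hj
    induction j with
    | zero => simp [polyProd_zero]
    | succ j ih =>
      rw [← intervalIntegral.integral_add_adjacent_intervals
        (G.intervalIntegrable_bracket_deriv hK 0 (j / N))
        (G.intervalIntegrable_bracket_deriv hK (j / N) _), smul_add, ih (by omega),
        hedge j (by omega) _ (by field_simp; simp) (by field_simp; simp), polyProd_succ, mul_snd,
        expo_snd, expo_fst, add_zero]
      congr 2
      have : (N : ℝ) * (((j + 1 : ℕ) : ℝ) / N) - j = 1 := by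
        field_simp
        simp
      rw [this, one_smul]
  ext1
  · change polygon N w t = _
    rw [polygon_eq hj h1 h2, mul_fst, expo_fst, polyProd_fst]
  · change (1 / 2 : ℝ) • (∫ s in (0 : ℝ)..t, _) = _
    rw [← intervalIntegral.integral_add_adjacent_intervals
        (G.intervalIntegrable_bracket_deriv hK 0 (j / N))
        (G.intervalIntegrable_bracket_deriv hK (j / N) _), smul_add, hnode j hj.le,
        hedge j hj t h1 h2, mul_snd, expo_snd, expo_fst, add_zero, bracket_smul_right]

lemma lintegral_enorm_deriv_polygon_le (hN : 0 < N) :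
    ∫⁻ t in Icc (0 : ℝ) 1, ‖deriv (polygon N v) t‖ₑ ≤ ∑ i ∈ Finset.range N, ‖v i‖ₑ := by
  have hN' : (0 : ℝ) < N := by exact_mod_cast hN
  refine (lintegral_Icc_le_sum hN (c := fun i => ‖(N : ℝ) • v i‖ₑ) fun i hi t ht => ?_).trans
    (le_of_eq (Finset.sum_congr rfl fun i _ => ?_))
  · rw [(hasDerivAt_polygon hi ?_ ?_).deriv]
    · rw [← div_lt_iff₀' hN']
      exact ht.1
    · rw [← lt_div_iff₀' hN']
      exact ht.2
  · rw [enorm_smul, ← ofReal_norm (N : ℝ), ← mul_assoc, ← ENNReal.ofReal_mul (by positivity),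
      Real.norm_eq_abs, Nat.abs_cast, one_div_mul_cancel hN'.ne', ENNReal.ofReal_one, one_mul]

/-- A product of exponentials is reached by the lift of a polygon. -/
lemma dcc_one_polyProd_le (w : ℕ → EuclideanSpace ℝ (Fin d₁)) (n : ℕ) :
    G.dcc 1 (G.polyProd w (n + 1)) ≤ ∑ i ∈ Finset.range (n + 1), ‖w i‖ₑ := by
  obtain ⟨K, hK⟩ := exists_lipschitzWith_polygon (n + 1) w
  have h0 : G.liftCurve (polygon (n + 1) w) 0 = 1 := by
    rw [G.liftCurve_polygon n.succ_pos (by simp) (by simp), polyProd_zero, one_mul]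
    ext1 <;> simp
  have h1 : G.liftCurve (polygon (n + 1) w) 1 = G.polyProd w (n + 1) := by
    rw [G.liftCurve_polygon n.lt_succ_self (by simp) (by simp), polyProd_succ]
    simp
  refine (iInf₂_le_of_le _ (G.isHorizontal_liftCurve hK norm_polygon_le)
    (iInf₂_le_of_le h0 h1 le_rfl)).trans ?_
  rw [G.curveLength_liftCurve hK]
  exact lintegral_enorm_deriv_polygon_le n.succ_pos

end Polygon

lemma dcc_one_expo_le (v : EuclideanSpace ℝ (Fin d₁)) : G.dcc 1 (G.expo v) ≤ ‖v‖ₑ := by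
  have h := G.dcc_one_polyProd_le (fun _ => v) 0
  rwa [polyProd_succ, polyProd_zero, one_mul, zero_add, Finset.sum_range_one] at h

variable {G} in
lemma IsShortProduct.dcc_one_le {n : ℕ} {r : ℝ} {x : G.Carrier} (hx : IsShortProduct n r x)
    (hn : 0 < n) : G.dcc 1 x ≤ ENNReal.ofReal (n * r) := by
  obtain ⟨v, rfl, hv⟩ := hx
  obtain ⟨m, rfl⟩ := Nat.exists_eq_succ_of_ne_zero hn.ne'
  refine (G.dcc_one_polyProd_le v m).trans ?_
  refine (Finset.sum_le_card_nsmul _ _ (ENNReal.ofReal r) fun i _ => ?_).trans ?_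
  · rw [← ofReal_norm]
    exact ENNReal.ofReal_le_ofReal (hv i)
  · rw [Finset.card_range, nsmul_eq_mul, ENNReal.ofReal_mul (Nat.cast_nonneg _),
      ENNReal.ofReal_natCast]

end StepTwoCarnotGroup

namespace StepTwoCarnotGroup

variable {d₁ d₂ : ℕ} {G : StepTwoCarnotGroup d₁ d₂}

/-! ### The Carnot–Carathéodory topology -/

lemma continuous_fst_carrier : Continuous fun x : G.Carrier => x.1 :=
  continuous_fst (X := EuclideanSpace ℝ (Fin d₁)) (Y := EuclideanSpace ℝ (Fin d₂))

lemma continuous_snd_carrier : Continuous fun x : G.Carrier => x.2 :=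
  continuous_snd (X := EuclideanSpace ℝ (Fin d₁)) (Y := EuclideanSpace ℝ (Fin d₂))

lemma continuous_carrier_iff {T : Type*} [TopologicalSpace T] {f : T → G.Carrier} :
    Continuous f ↔ (Continuous fun t => (f t).1) ∧ Continuous fun t => (f t).2 :=
  continuous_prodMk (f := fun t => (f t).1) (g := fun t => (f t).2)

lemma tendsto_carrier_iff {T : Type*} {l : Filter T} {f : T → G.Carrier} {x : G.Carrier} :
    Tendsto f l (𝓝 x) ↔
      Tendsto (fun t => (f t).1) l (𝓝 x.1) ∧ Tendsto (fun t => (f t).2) l (𝓝 x.2) :=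
  Prod.tendsto_iff (Y := EuclideanSpace ℝ (Fin d₁)) (Z := EuclideanSpace ℝ (Fin d₂)) f x

instance : IsTopologicalGroup G.Carrier where
  continuous_mul := by
    have h1 := continuous_fst_carrier (G := G)
    have h2 := continuous_snd_carrier (G := G)
    refine continuous_carrier_iff.mpr ⟨?_, ?_⟩
    · exact (h1.comp continuous_fst).add (h1.comp continuous_snd)
    · have h3 := Continuous.bracket G (h1.comp continuous_fst) (h1.comp continuous_snd)
      exact ((h2.comp continuous_fst).add (h2.comp continuous_snd)).add
        (h3.const_smul (1 / 2 : ℝ))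
  continuous_inv := continuous_carrier_iff.mpr
    ⟨continuous_fst_carrier.neg, continuous_snd_carrier.neg⟩

/-- The Carnot–Carathéodory distance to the identity induces the Euclidean topology there. -/
lemma comap_dcc_one : comap (G.dcc 1) (𝓝 0) = 𝓝 1 := by
  refine le_antisymm ?_ ?_
  · have h := tendsto_comap (f := G.dcc 1) (x := 𝓝 0)
    have htop : ∀ᶠ x in comap (G.dcc 1) (𝓝 0), G.dcc 1 x ≠ ⊤ :=
      h.eventually_ne ENNReal.zero_ne_top
    have h' : Tendsto (fun x => (G.dcc 1 x).toReal) (comap (G.dcc 1) (𝓝 0)) (𝓝 0) :=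
      (ENNReal.tendsto_toReal ENNReal.zero_ne_top).comp h
    have h'' : Tendsto (fun x => G.bracketBound * (G.dcc 1 x).toReal ^ 2) (comap (G.dcc 1) (𝓝 0))
        (𝓝 0) := by
      simpa using (h'.pow 2).const_mul G.bracketBound
    have h1 : Tendsto (fun x : G.Carrier => x.1) (comap (G.dcc 1) (𝓝 0)) (𝓝 0) :=
      squeeze_zero_norm' (htop.mono fun x hx => norm_fst_le_toReal_dcc hx) h'
    have h2 : Tendsto (fun x : G.Carrier => x.2) (comap (G.dcc 1) (𝓝 0)) (𝓝 0) :=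
      squeeze_zero_norm' (htop.mono fun x hx => norm_snd_le_toReal_dcc_sq hx) h''
    exact (tendsto_carrier_iff (f := id) (x := (1 : G.Carrier))).mpr ⟨h1, h2⟩
  · rw [← tendsto_iff_comap]
    obtain ⟨M, K, hM, h⟩ := G.exists_isShortProduct
    refine tendsto_of_tendsto_of_tendsto_of_le_of_le tendsto_const_nhds ?_ (fun x => zero_le)
      fun x => (h x).dcc_one_le hM
    have hc : Continuous fun x : G.Carrier => ENNReal.ofReal (M * (‖x.1‖ + K * √‖x.2‖)) := by
      refine ENNReal.continuous_ofReal.comp ?_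
      have h1 := (continuous_fst_carrier (G := G)).norm
      have h2 := (continuous_snd_carrier (G := G)).norm
      fun_prop
    have := hc.tendsto 1
    simpa using this

lemma tendsto_dcc_one_iff {T : Type*} {l : Filter T} {f : T → G.Carrier} :
    Tendsto (fun t => G.dcc 1 (f t)) l (𝓝 0) ↔ Tendsto f l (𝓝 1) := by
  rw [← comap_dcc_one, tendsto_comap_iff]
  rfl

/-- Convergence in the uniform Carnot–Carathéodory distance to a bounded path is uniform convergence
of the coordinates. -/
lemma tendsto_dInf_iff {ι : Type*} {l : Filter ι} {F : ι → unitInterval → G.Carrier}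
    {X : unitInterval → G.Carrier} {B : ℝ} (hB : ∀ t, ‖(X t).1‖ ≤ B) :
    Tendsto (fun n => G.dInf (F n) X) l (𝓝 0) ↔
      TendstoUniformly (fun n t => (F n t).1) (fun t => (X t).1) l ∧
      TendstoUniformly (fun n t => (F n t).2) (fun t => (X t).2) l := by
  have h1 : Tendsto (fun n => G.dInf (F n) X) l (𝓝 0) ↔
      Tendsto (fun q : ι × unitInterval => G.dcc 1 ((F q.1 q.2)⁻¹ * X q.2)) (l ×ˢ ⊤) (𝓝 0) := by
    simp only [← dcc_eq_dcc_one, ENNReal.tendsto_nhds_zero, dInf, iSup_le_iff]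
    refine forall₂_congr fun ε _ => ?_
    rw [← principal_univ, eventually_prod_principal_iff]
    simp
  have h2 : ∀ {V : Type _} [NormedAddCommGroup V] (f : ι → unitInterval → V)
      (g : unitInterval → V), TendstoUniformly f g l ↔
        Tendsto (fun q : ι × unitInterval => f q.1 q.2 - g q.2) (l ×ˢ ⊤) (𝓝 0) := by
    intro V _ f g
    rw [tendstoUniformly_iff_tendsto, uniformity_eq_comap_nhds_zero, tendsto_comap_iff]
    rfl
  rw [h1, tendsto_dcc_one_iff, tendsto_carrier_iff, h2, h2]
  have h3 : Tendsto (fun q : ι × unitInterval => ((F q.1 q.2)⁻¹ * X q.2).1) (l ×ˢ ⊤)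
      (𝓝 (1 : G.Carrier).1) ↔
      Tendsto (fun q : ι × unitInterval => (F q.1 q.2).1 - (X q.2).1) (l ×ˢ ⊤) (𝓝 0) := by
    rw [← tendsto_neg_iff]
    simp [sub_eq_add_neg, add_comm]
  rw [h3]
  refine and_congr_right fun h => ?_
  -- the bracket of the first layers is negligible, since it vanishes on the diagonal
  have h4 : Tendsto (fun q : ι × unitInterval => (1 / 2 : ℝ) • G.bracket (F q.1 q.2).1 (X q.2).1)
      (l ×ˢ ⊤) (𝓝 0) := by
    have h5 : Tendsto (fun q : ι × unitInterval =>
        (G.bracketBound * ‖(F q.1 q.2).1 - (X q.2).1‖) * B) (l ×ˢ ⊤) (𝓝 0) := by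
      simpa using (h.norm.const_mul G.bracketBound).mul_const B
    refine squeeze_zero_norm (fun q => ?_) h5
    have h6 : G.bracket (F q.1 q.2).1 (X q.2).1 =
        G.bracket ((F q.1 q.2).1 - (X q.2).1) (X q.2).1 := by
      rw [bracket_sub_left, bracket_self, sub_zero]
    rw [norm_smul, h6]
    refine (mul_le_of_le_one_left (norm_nonneg _) (by norm_num)).trans ?_
    refine (G.norm_bracket_le _ _).trans ?_
    have := G.bracketBound_pos
    gcongr
    exact hB _
  have h7 : ∀ q : ι × unitInterval, ((F q.1 q.2)⁻¹ * X q.2).2 =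
      -((F q.1 q.2).2 - (X q.2).2) - (1 / 2 : ℝ) • G.bracket (F q.1 q.2).1 (X q.2).1 := fun q => by
    rw [mul_snd, inv_snd, inv_fst, bracket_neg_left]
    module
  simp only [h7, one_snd]
  constructor
  · intro h8
    have := (h8.add h4).neg
    simpa using this
  · intro h8
    have := h8.neg.sub h4
    simpa using this

namespace PathSpace

variable (X : G.PathSpace)

lemma continuous_fst : Continuous fun t => (X.1 t).1 := continuous_fst_carrier.comp X.2.1

lemma fst_zero : (X.1 0).1 = 0 := by rw [X.2.2, one_fst]

lemma exists_bound : ∃ B : ℝ, ∀ t, ‖(X.1 t).1‖ ≤ B := by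
  obtain ⟨B, hB⟩ := isCompact_univ.exists_bound_of_continuousOn X.continuous_fst.continuousOn
  exact ⟨B, fun t => hB t (mem_univ t)⟩

lemma tendsto_dInf_iff {ι : Type*} {l : Filter ι} {F : ι → unitInterval → G.Carrier} :
    Tendsto (fun n => G.dInf (F n) X.1) l (𝓝 0) ↔
      TendstoUniformly (fun n t => (F n t).1) (fun t => (X.1 t).1) l ∧
      TendstoUniformly (fun n t => (F n t).2) (fun t => (X.1 t).2) l :=
  StepTwoCarnotGroup.tendsto_dInf_iff X.exists_bound.choose_spec

/-- Uniform continuity of a path, in terms of its increments. -/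
lemma exists_increment_mem {U : Set G.Carrier} (hU : U ∈ 𝓝 1) :
    ∃ δ > 0, ∀ s t : unitInterval, |(s : ℝ) - t| < δ → (X.1 s)⁻¹ * X.1 t ∈ U := by
  obtain ⟨η, hη, hηU⟩ := Metric.mem_nhds_iff.mp hU
  have hc : Continuous fun p : unitInterval × unitInterval => (X.1 p.1)⁻¹ * X.1 p.2 :=
    (X.2.1.comp _root_.continuous_fst).inv.mul (X.2.1.comp _root_.continuous_snd)
  obtain ⟨δ, hδ, h⟩ := Metric.uniformContinuous_iff.mp
    (CompactSpace.uniformContinuous_of_continuous hc) η hη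
  refine ⟨δ, hδ, fun s t hst => hηU ?_⟩
  have h1 := @h (s, t) (s, s) (by
    rw [Prod.dist_eq, dist_self, max_eq_right dist_nonneg]
    rwa [dist_comm])
  simpa using h1

end PathSpace

lemma dInf_self (X : G.PathSpace) : G.dInf X.1 X.1 = 0 := by
  have h : Tendsto (fun _ : ℕ => G.dInf X.1 X.1) atTop (𝓝 0) :=
    X.tendsto_dInf_iff.mpr ⟨Metric.tendstoUniformly_iff.mpr fun ε hε => by simp [hε],
      Metric.tendstoUniformly_iff.mpr fun ε hε => by simp [hε]⟩
  exact tendsto_nhds_unique tendsto_const_nhds h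

/-! ### Density of the lifts of polygons -/

/-- The times `k / N` as points of the unit interval, with value `1` for `k ≥ N`. -/
noncomputable def _root_.gridTime (N k : ℕ) : unitInterval :=
  Set.projIcc 0 1 zero_le_one ((k : ℝ) / N)

lemma _root_.gridTime_coe {N k : ℕ} (h : k ≤ N) : (gridTime N k : ℝ) = (k : ℝ) / N := by
  rw [gridTime, projIcc_of_mem zero_le_one ⟨by positivity, ?_⟩]
  exact div_le_one_of_le₀ (by exact_mod_cast h) (Nat.cast_nonneg N)

lemma _root_.gridTime_zero (N : ℕ) : gridTime N 0 = 0 := by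
  ext
  rw [gridTime_coe (Nat.zero_le N)]
  simp

/-- Joining the points `X_{k/N}` by products of short exponentials yields a polygon whose lift is
close to `X`. -/
lemma exists_dInf_lift_le (X : G.PathSpace) {ε : ℝ≥0∞} (hε : 0 < ε) :
    ∃ a, IsAC0 a ∧ G.dInf (G.lift a) X.1 ≤ ε := by
  obtain ⟨M, K, hM, hMK⟩ := G.exists_isShortProduct
  -- a neighbourhood `U` of the identity with `dcc 1 (z⁻¹ * y) ≤ ε` for `z, y ∈ U`
  have h1 : ∀ᶠ p : G.Carrier × G.Carrier in 𝓝 (1, 1), G.dcc 1 (p.1⁻¹ * p.2) ≤ ε := by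
    have h : Tendsto (fun p : G.Carrier × G.Carrier => p.1⁻¹ * p.2) (𝓝 (1, 1)) (𝓝 1) := by
      have : Continuous fun p : G.Carrier × G.Carrier => p.1⁻¹ * p.2 := by fun_prop
      simpa using this.tendsto (1, 1)
    exact ENNReal.tendsto_nhds_zero.mp (tendsto_dcc_one_iff.mpr h) ε hε
  rw [nhds_prod_eq, eventually_prod_self_iff'] at h1
  obtain ⟨U, hU, hUε⟩ := h1
  -- a radius `ρ` such that every product of at most `M` exponentials of length `ρ` lies in `U`
  obtain ⟨ρ, hρ, hρU⟩ : ∃ ρ : ℝ, 0 < ρ ∧ ∀ z : G.Carrier, G.dcc 1 z ≤ ENNReal.ofReal (M * ρ) →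
      z ∈ U := by
    rw [← comap_dcc_one] at hU
    obtain ⟨W, hW, hWU⟩ := hU
    have h2 : Tendsto (fun ρ : ℝ => ENNReal.ofReal (M * ρ)) (𝓝[>] 0) (𝓝 0) := by
      have : Continuous fun ρ : ℝ => ENNReal.ofReal (M * ρ) :=
        ENNReal.continuous_ofReal.comp (by fun_prop)
      simpa using (this.tendsto 0).mono_left nhdsWithin_le_nhds
    obtain ⟨c, hc, hcW⟩ := ENNReal.nhds_zero_basis_Iic.mem_iff.mp hW
    obtain ⟨ρ, h3, hρ⟩ := ((ENNReal.tendsto_nhds_zero.mp h2 c hc).and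
      self_mem_nhdsWithin).exists
    exact ⟨ρ, hρ, fun z hz => hWU (hcW (hz.trans h3))⟩
  -- a grid on which all increments of `X` are products of such exponentials
  have h2 : ∀ᶠ x : G.Carrier in 𝓝 1, ‖x.1‖ + K * √‖x.2‖ < ρ := by
    have hc : Continuous fun x : G.Carrier => ‖x.1‖ + K * √‖x.2‖ := by
      have h1 := (continuous_fst_carrier (G := G)).norm
      have h2 := (continuous_snd_carrier (G := G)).norm
      fun_prop
    refine hc.continuousAt.eventually_lt_const ?_
    simpa using hρ
  obtain ⟨δ, hδ, hδX⟩ := X.exists_increment_mem (h2.and hU)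
  obtain ⟨N, hN⟩ := exists_nat_gt (1 / δ)
  have hN0 : (0 : ℝ) < N := (one_div_pos.mpr hδ).trans hN
  have hNδ : 1 / (N : ℝ) < δ := by
    rwa [div_lt_iff₀ hN0, ← div_lt_iff₀' hδ]
  have hinc : ∀ k, IsShortProduct M ρ
      ((X.1 (gridTime N k))⁻¹ * X.1 (gridTime N (k + 1))) := fun k => by
    obtain ⟨v, hv, hv'⟩ := hMK ((X.1 (gridTime N k))⁻¹ * X.1 (gridTime N (k + 1)))
    refine ⟨v, hv, fun i => (hv' i).trans (hδX _ _ ?_).1.le⟩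
    refine lt_of_le_of_lt ?_ hNδ
    have h3 := abs_projIcc_sub_projIcc (a := (0 : ℝ)) (b := 1) (c := k / N)
      (d := (k + 1 : ℕ) / N) zero_le_one
    refine h3.trans (le_of_eq ?_)
    rw [← sub_div, abs_div, Nat.abs_cast]
    simp
  choose v hv hvρ using hinc
  set w : ℕ → EuclideanSpace ℝ (Fin d₁) := fun i => v (i / M) (i % M) with hw
  have hwi : ∀ k, ∀ i < M, w (k * M + i) = v k i := fun k i hi => by
    simp only [hw]
    rw [mul_comm k M, Nat.mul_add_div hM, Nat.div_eq_of_lt hi, add_zero, Nat.mul_add_mod,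
      Nat.mod_eq_of_lt hi]
  have hnode : ∀ k, G.polyProd w (k * M) = X.1 (gridTime N k) := by
    intro k
    induction k with
    | zero => rw [zero_mul, polyProd_zero, gridTime_zero, X.2.2]
    | succ k ih =>
      rw [add_mul, one_mul, polyProd_add, ih, polyProd_congr (hwi k), hv, mul_inv_cancel_left]
  obtain ⟨L, hL⟩ := exists_lipschitzWith_polygon (N * M) w
  refine ⟨polygon (N * M) w, ⟨hL.lipschitzOnWith.absolutelyContinuousOnInterval,
    polygon_zero_right⟩, iSup_le fun t => ?_⟩
  have hNM : 0 < N * M := Nat.mul_pos (by exact_mod_cast hN0) hM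
  obtain ⟨j, hj, hj1, hj2⟩ : ∃ j < N * M, (j : ℝ) ≤ (N * M : ℕ) * (t : ℝ) ∧
      (N * M : ℕ) * (t : ℝ) ≤ (j : ℝ) + 1 := by
    rcases eq_or_lt_of_le t.2.2 with ht | ht
    · refine ⟨N * M - 1, by omega, ?_, ?_⟩
      · rw [ht, mul_one]
        exact_mod_cast Nat.sub_le _ _
      · rw [ht, mul_one]
        exact_mod_cast (Nat.sub_add_cancel hNM).ge
    · have h0 : 0 ≤ (N * M : ℕ) * (t : ℝ) := mul_nonneg (Nat.cast_nonneg _) t.2.1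
      refine ⟨⌊(N * M : ℕ) * (t : ℝ)⌋₊, ?_, Nat.floor_le h0, (Nat.lt_floor_add_one _).le⟩
      rw [Nat.floor_lt h0]
      exact mul_lt_of_lt_one_right (by exact_mod_cast hNM) ht
  set k := j / M with hk
  set i := j % M with hi
  have hiM : i < M := Nat.mod_lt _ hM
  have hkN : k < N := Nat.div_lt_of_lt_mul (by rwa [mul_comm] at hj)
  have hji : j = k * M + i := by rw [mul_comm]; exact (Nat.div_add_mod j M).symm
  have hwj : w j = v k i := by rw [hji, hwi k i hiM]
  rw [lift_eq_liftCurve, G.liftCurve_polygon hj hj1 hj2, hwj]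
  set s : ℝ := (N * M : ℕ) * t - j with hs
  set z := G.polyProd (v k) i * G.expo (s • v k i) with hz
  have hz' : G.polyProd w j * G.expo (s • v k i) = X.1 (gridTime N k) * z := by
    rw [hji, polyProd_add, hnode, polyProd_congr fun l hl => hwi k l (hl.trans hiM), hz, mul_assoc]
  have hsv : ‖s • v k i‖ ≤ ρ := by
    rw [norm_smul, Real.norm_eq_abs, abs_of_nonneg (by linarith)]
    exact (mul_le_of_le_one_left (norm_nonneg _) (by linarith)).trans (hvρ k i)
  have hzU : z ∈ U := by
    have h3 : IsShortProduct (i + 1) ρ z :=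
      IsShortProduct.mul ⟨v k, rfl, hvρ k⟩ (isShortProduct_expo hsv)
    refine hρU z ((h3.dcc_one_le i.succ_pos).trans (ENNReal.ofReal_le_ofReal ?_))
    gcongr
    exact_mod_cast hiM
  have hyU : (X.1 (gridTime N k))⁻¹ * X.1 t ∈ U := by
    refine (hδX _ _ ?_).2
    refine lt_of_le_of_lt ?_ hNδ
    have hM' : (0 : ℝ) < M := by exact_mod_cast hM
    have hi' : (i : ℝ) + 1 ≤ M := by exact_mod_cast hiM
    rw [hji] at hj1 hj2
    push_cast at hj1 hj2
    have ht1 : (k : ℝ) ≤ N * t := by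
      refine le_of_mul_le_mul_right ?_ hM'
      linarith [Nat.cast_nonneg (α := ℝ) i]
    have ht2 : N * (t : ℝ) ≤ (k : ℝ) + 1 := by
      refine le_of_mul_le_mul_right ?_ hM'
      linarith
    have ht3 : (k : ℝ) / N - t = -((N * t - k) / N) := by
      field_simp
      ring
    rw [gridTime_coe hkN.le, ht3, abs_neg, abs_of_nonneg (div_nonneg (by linarith) hN0.le)]
    gcongr
    linarith
  rw [hz', dcc_eq_dcc_one, mul_inv_rev, mul_assoc]
  exact hUε z hzU _ hyU

lemma exists_isApproximation (X : G.PathSpace) : ∃ a, G.IsApproximation a X := by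
  have h : ∀ n : ℕ, ∃ a, IsAC0 a ∧ G.dInf (G.lift a) X.1 ≤ (n : ℝ≥0∞)⁻¹ := fun n =>
    exists_dInf_lift_le X (ENNReal.inv_pos.mpr (ENNReal.natCast_ne_top n))
  choose a ha ha' using h
  exact ⟨a, ha, tendsto_of_tendsto_of_tendsto_of_le_of_le tendsto_const_nhds
    ENNReal.tendsto_inv_nat_nhds_zero (fun _ => zero_le) ha'⟩

end StepTwoCarnotGroup

namespace StepTwoCarnotGroup

variable {d₁ d₂ : ℕ} {G : StepTwoCarnotGroup d₁ d₂}

/-! ### The shift by a Cameron–Martin path -/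

/-- The first layer of a path, extended to the line by constants. -/
noncomputable def PathSpace.base (X : G.PathSpace) : ℝ → EuclideanSpace ℝ (Fin d₁) :=
  IccExtend zero_le_one fun t => (X.1 t).1

lemma PathSpace.base_coe (X : G.PathSpace) (t : unitInterval) : X.base t = (X.1 t).1 :=
  IccExtend_val zero_le_one _ t

lemma PathSpace.continuous_base (X : G.PathSpace) : Continuous X.base :=
  X.continuous_fst.Icc_extend'

lemma _root_.IsAC0.mono {d : ℕ} {h : ℝ → EuclideanSpace ℝ (Fin d)} (hh : IsAC0 h) {s t : ℝ}
    (hs : s ∈ Icc (0 : ℝ) 1) (ht : t ∈ Icc (0 : ℝ) 1) : AbsolutelyContinuousOnInterval h s t :=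
  hh.1.mono (by
    rw [uIcc_of_le (zero_le_one' ℝ)]
    exact ordConnected_Icc.uIcc_subset hs ht)

lemma _root_.IsAC0.continuousOn_Icc {d : ℕ} {h : ℝ → EuclideanSpace ℝ (Fin d)} (hh : IsAC0 h) :
    ContinuousOn h (Icc 0 1) := by
  have := hh.1.continuousOn
  rwa [uIcc_of_le zero_le_one] at this

lemma norm_integral_bracket_sub_le {u v g : ℝ → EuclideanSpace ℝ (Fin d₁)} {s t η : ℝ} (hst : s ≤ t)
    (hu : ContinuousOn u (Icc s t)) (hv : ContinuousOn v (Icc s t))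
    (hg : IntervalIntegrable g volume s t) (h : ∀ r ∈ Icc s t, ‖u r - v r‖ ≤ η) :
    ‖(∫ r in s..t, G.bracket (u r) (g r)) - ∫ r in s..t, G.bracket (v r) (g r)‖ ≤
      G.bracketBound * η * ∫ r in s..t, ‖g r‖ := by
  rw [← uIcc_of_le hst] at hu hv
  rw [← intervalIntegral.integral_sub (G.intervalIntegrable_bracket hu hg)
    (G.intervalIntegrable_bracket hv hg), ← intervalIntegral.integral_const_mul]
  refine intervalIntegral.norm_integral_le_of_norm_le hst ?_ (hg.norm.const_mul _)
  refine ae_of_all _ fun r hr => ?_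
  rw [← bracket_sub_left]
  refine (G.norm_bracket_le _ _).trans ?_
  have := G.bracketBound_pos
  gcongr
  exact h r (Ioc_subset_Icc_self hr)

lemma _root_.IsAC0.integral_norm_deriv_le {d : ℕ} {h : ℝ → EuclideanSpace ℝ (Fin d)} (hh : IsAC0 h)
    {t : ℝ} (ht : t ∈ Icc (0 : ℝ) 1) :
    ∫ r in (0 : ℝ)..t, ‖deriv h r‖ ≤ ∫ r in (0 : ℝ)..1, ‖deriv h r‖ :=
  intervalIntegral.integral_mono_interval le_rfl ht.1 ht.2
    (ae_of_all _ fun _ => norm_nonneg _) hh.1.intervalIntegrable_deriv_euclidean.norm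

/-- The second layer of the factor by which the shift by `h` multiplies a path with first layer
`u`. -/
noncomputable def shiftArea (G : StepTwoCarnotGroup d₁ d₂) (u h : ℝ → EuclideanSpace ℝ (Fin d₁))
    (t : ℝ) : EuclideanSpace ℝ (Fin d₂) :=
  ∫ r in (0 : ℝ)..t, G.bracket (u r + (1 / 2 : ℝ) • h r) (deriv h r)

lemma norm_shiftArea_sub_le {u v h : ℝ → EuclideanSpace ℝ (Fin d₁)} {t η : ℝ}
    (hu : ContinuousOn u (Icc 0 1)) (hv : ContinuousOn v (Icc 0 1)) (hh : IsAC0 h)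
    (ht : t ∈ Icc (0 : ℝ) 1) (hη : ∀ r ∈ Icc (0 : ℝ) 1, ‖u r - v r‖ ≤ η) :
    ‖G.shiftArea u h t - G.shiftArea v h t‖ ≤
      G.bracketBound * η * ∫ r in (0 : ℝ)..1, ‖deriv h r‖ := by
  have hsub : Icc (0 : ℝ) t ⊆ Icc 0 1 := Icc_subset_Icc_right ht.2
  have hc := hh.continuousOn_Icc
  have hη0 : 0 ≤ η := (norm_nonneg _).trans (hη 0 (left_mem_Icc.mpr zero_le_one))
  refine (norm_integral_bracket_sub_le (η := η) ht.1
    ((hu.add (hc.const_smul (1 / 2 : ℝ))).mono hsub)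
    ((hv.add (hc.const_smul (1 / 2 : ℝ))).mono hsub)
    (hh.mono (left_mem_Icc.mpr zero_le_one) ht).intervalIntegrable_deriv_euclidean
    fun r hr => ?_).trans ?_
  · change ‖u r + (1 / 2 : ℝ) • h r - (v r + (1 / 2 : ℝ) • h r)‖ ≤ η
    rw [add_sub_add_right_eq_sub]
    exact hη r (hsub hr)
  · have := G.bracketBound_pos
    have := hh.integral_norm_deriv_le ht
    gcongr

/-- The path by which the shift by `h` multiplies a path with first layer `u` from the left. -/
noncomputable def shiftFactor (G : StepTwoCarnotGroup d₁ d₂) (u h : ℝ → EuclideanSpace ℝ (Fin d₁))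
    (t : ℝ) : G.Carrier :=
  (h t, G.shiftArea u h t)

@[simp] lemma shiftFactor_fst (u h : ℝ → EuclideanSpace ℝ (Fin d₁)) (t : ℝ) :
    (G.shiftFactor u h t).1 = h t := rfl

@[simp] lemma shiftFactor_snd (u h : ℝ → EuclideanSpace ℝ (Fin d₁)) (t : ℝ) :
    (G.shiftFactor u h t).2 = G.shiftArea u h t := rfl

/-- Shifting an absolutely continuous curve multiplies its lift from the left; the factor depends
on the curve only through its values, not through its derivative. -/
lemma lift_add {a h : ℝ → EuclideanSpace ℝ (Fin d₁)} (ha : IsAC0 a) (hh : IsAC0 h)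
    (t : unitInterval) :
    G.lift (fun s => a s + h s) t = G.shiftFactor a h t * G.lift a t := by
  have ha' := ha.mono (left_mem_Icc.mpr zero_le_one) t.2
  have hh' := hh.mono (left_mem_Icc.mpr zero_le_one) t.2
  have hia := ha'.intervalIntegrable_deriv_euclidean
  have hih := hh'.intervalIntegrable_deriv_euclidean
  have h1 := G.intervalIntegrable_bracket ha'.continuousOn hia
  have h2 := G.intervalIntegrable_bracket ha'.continuousOn hih
  have h3 := G.intervalIntegrable_bracket hh'.continuousOn hia
  have h4 := G.intervalIntegrable_bracket hh'.continuousOn hih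
  have h5 : ∫ s in (0 : ℝ)..t, G.bracket (a s + h s) (deriv (fun s => a s + h s) s) =
      ∫ s in (0 : ℝ)..t, (G.bracket (a s) (deriv a s) + G.bracket (a s) (deriv h s) +
        G.bracket (h s) (deriv a s) + G.bracket (h s) (deriv h s)) := by
    refine intervalIntegral.integral_congr_ae ?_
    filter_upwards [ha'.ae_differentiableAt_finiteDimensional,
      hh'.ae_differentiableAt_finiteDimensional] with s hs1 hs2 hs
    rw [deriv_fun_add (hs1 (uIoc_subset_uIcc hs)) (hs2 (uIoc_subset_uIcc hs)), bracket_add_left,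
      bracket_add_right, bracket_add_right]
    abel
  have h6 : G.shiftArea a h t = (∫ s in (0 : ℝ)..t, G.bracket (a s) (deriv h s)) +
      (1 / 2 : ℝ) • ∫ s in (0 : ℝ)..t, G.bracket (h s) (deriv h s) := by
    have h7 : IntervalIntegrable (fun s => (1 / 2 : ℝ) • G.bracket (h s) (deriv h s)) volume 0 t :=
      h4.smul (1 / 2 : ℝ)
    rw [← intervalIntegral.integral_smul, ← intervalIntegral.integral_add h2 h7]
    simp only [shiftArea, bracket_add_left, bracket_smul_left]
  ext1
  · exact add_comm _ _
  · change (1 / 2 : ℝ) • _ =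
      G.shiftArea a h t + (1 / 2 : ℝ) • _ + (1 / 2 : ℝ) • G.bracket (h t) (a t)
    rw [h5, intervalIntegral.integral_add ((h1.add h2).add h3) h4,
      intervalIntegral.integral_add (h1.add h2) h3, intervalIntegral.integral_add h1 h2,
      G.integral_bracket_deriv hh' ha', h6, ha.2, bracket_zero_right]
    module

lemma tendsto_dInf_mul_left {ι : Type*} {l : Filter ι} {X : G.PathSpace}
    {F Q : ι → unitInterval → G.Carrier} {P : unitInterval → G.Carrier}
    (hF : Tendsto (fun n => G.dInf (F n) X.1) l (𝓝 0)) {B : ℝ} (hB : ∀ t, ‖(P t).1‖ ≤ B)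
    (h1 : ∀ n t, (Q n t).1 = (P t).1)
    (h2 : TendstoUniformly (fun n t => (Q n t).2) (fun t => (P t).2) l) :
    Tendsto (fun n => G.dInf (fun t => Q n t * F n t) fun t => P t * X.1 t) l (𝓝 0) := by
  have hB0 : 0 ≤ B := (norm_nonneg _).trans (hB 0)
  obtain ⟨B', hB'⟩ := X.exists_bound
  have hF' := X.tendsto_dInf_iff.mp hF
  have hPX : ∀ t, ‖(P t * X.1 t).1‖ ≤ B + B' := fun t => by
    rw [mul_fst]
    exact (norm_add_le _ _).trans (add_le_add (hB t) (hB' t))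
  refine (tendsto_dInf_iff hPX).mpr ⟨?_, ?_⟩
  · have h4 := Metric.tendstoUniformly_iff.mp hF'.1
    refine Metric.tendstoUniformly_iff.mpr fun ε hε => (h4 ε hε).mono fun n hn t => ?_
    rw [mul_fst, mul_fst, h1, dist_add_left]
    exact hn t
  · have h3 : TendstoUniformly (fun n t => (1 / 2 : ℝ) • G.bracket (Q n t).1 (F n t).1)
        (fun t => (1 / 2 : ℝ) • G.bracket (P t).1 (X.1 t).1) l := by
      have hC := G.bracketBound_pos
      rw [Metric.tendstoUniformly_iff]
      intro ε hε
      filter_upwards [Metric.tendstoUniformly_iff.mp hF'.1 (ε / (G.bracketBound * B + 1))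
        (by positivity)] with n hn t
      specialize hn t
      rw [dist_eq_norm, lt_div_iff₀ (by positivity)] at hn
      rw [h1, dist_eq_norm, ← smul_sub, ← bracket_sub_right, norm_smul]
      refine lt_of_le_of_lt (mul_le_of_le_one_left (norm_nonneg _) (by norm_num)) ?_
      refine lt_of_le_of_lt (G.norm_bracket_le _ _) ?_
      have h4 : G.bracketBound * ‖(P t).1‖ ≤ G.bracketBound * B + 1 := by
        have := mul_le_mul_of_nonneg_left (hB t) hC.le
        linarith
      by_cases h5 : ‖(X.1 t).1 - (F n t).1‖ = 0
      · rw [h5, mul_zero]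
        exact hε
      · refine lt_of_le_of_lt ?_ hn
        rw [mul_comm]
        gcongr
    simp only [mul_snd]
    exact (h2.add hF'.2).add h3

/-- The lifts of `aₙ + h` converge to an explicit left multiple of the limit of the lifts of
`aₙ`. -/
lemma IsApproximation.tendsto_lift_add {X : G.PathSpace} {a : ℕ → ℝ → EuclideanSpace ℝ (Fin d₁)}
    (ha : G.IsApproximation a X) {h : ℝ → EuclideanSpace ℝ (Fin d₁)} (hh : IsAC0 h) :
    Tendsto (fun n => G.dInf (G.lift fun s => a n s + h s)
      fun t : unitInterval => G.shiftFactor X.base h t * X.1 t) atTop (𝓝 0) := by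
  obtain ⟨B, hB⟩ := hh.1.exists_bound
  rw [uIcc_of_le zero_le_one] at hB
  have h0 : ∀ n, G.lift (fun s => a n s + h s) =
      fun t : unitInterval => G.shiftFactor (a n) h t * G.lift (a n) t := fun n =>
    funext fun t => lift_add (ha.1 n) hh t
  simp only [h0]
  refine tendsto_dInf_mul_left ha.2 (B := B) (fun t => hB t t.2) (fun n t => rfl) ?_
  have hu := (X.tendsto_dInf_iff.mp ha.2).1
  have hC := G.bracketBound_pos
  set I := ∫ r in (0 : ℝ)..1, ‖deriv h r‖ with hI
  have hI0 : 0 ≤ I := intervalIntegral.integral_nonneg zero_le_one fun _ _ => norm_nonneg _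
  rw [Metric.tendstoUniformly_iff] at hu ⊢
  intro ε hε
  filter_upwards [hu (ε / (G.bracketBound * I + 1)) (by positivity)] with n hn t
  rw [dist_eq_norm]
  refine lt_of_le_of_lt (norm_shiftArea_sub_le (η := ε / (G.bracketBound * I + 1))
    X.continuous_base.continuousOn (ha.1 n).continuousOn_Icc hh t.2 fun r hr => ?_) ?_
  · have := hn ⟨r, hr⟩
    rw [dist_eq_norm, ← X.base_coe] at this
    exact this.le
  · rw [← hI, mul_right_comm, ← mul_div_assoc, div_lt_iff₀ (by positivity)]
    nlinarith

/-- The shift by `h` is left multiplication by an explicit path. -/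
lemma isShift_iff {h : ℝ → EuclideanSpace ℝ (Fin d₁)} (hh : IsAC0 h) {X Y : G.PathSpace} :
    G.IsShift h X Y ↔
      ∀ t : unitInterval, Y.1 t = G.shiftFactor X.base h t * X.1 t := by
  obtain ⟨B, hB⟩ := hh.1.exists_bound
  rw [uIcc_of_le zero_le_one] at hB
  obtain ⟨B', hB'⟩ := X.exists_bound
  constructor
  · rintro ⟨⟨a, ha⟩, h1⟩ t
    have h2 := Y.tendsto_dInf_iff.mp (h1 a ha)
    have hPX : ∀ t : unitInterval, ‖(G.shiftFactor X.base h t * X.1 t).1‖ ≤ B + B' := fun t => by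
      rw [mul_fst]
      exact (norm_add_le _ _).trans (add_le_add (hB t t.2) (hB' t))
    have h3 := (tendsto_dInf_iff hPX).mp (ha.tendsto_lift_add hh)
    exact Carrier.ext (tendsto_nhds_unique (h2.1.tendsto_at t) (h3.1.tendsto_at t))
      (tendsto_nhds_unique (h2.2.tendsto_at t) (h3.2.tendsto_at t))
  · intro h1
    refine ⟨exists_isApproximation X, fun a ha => ?_⟩
    rw [show Y.1 = fun t : unitInterval => G.shiftFactor X.base h t * X.1 t from funext h1]
    exact ha.tendsto_lift_add hh

end StepTwoCarnotGroup

/-! ### Cameron–Martin paths and their dyadic energies -/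

section Energy

variable {d : ℕ} {h : ℝ → EuclideanSpace ℝ (Fin d)}

/-- The Cauchy–Schwarz inequality for the increments of `h` over disjoint intervals. The endpoints
are rounded down to dyadic points, and disjoint intervals of positive length lead to disjoint sets
of dyadic cells. -/
lemma sq_sum_dist_le_of_dyadic_energy_le (hc : Continuous h) {L : ℝ}
    (hE : ∀ p : ℕ, ∑ k ∈ Finset.range (2 ^ p),
      ‖h ((k + 1 : ℕ) / 2 ^ p) - h (k / 2 ^ p)‖ ^ 2 ≤ L ^ 2 / 2 ^ p)
    {n : ℕ} {x y : ℕ → ℝ} (hx : ∀ i < n, 0 ≤ x i) (hxy : ∀ i < n, x i ≤ y i)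
    (hy : ∀ i < n, y i ≤ 1)
    (hd : (Finset.range n : Set ℕ).PairwiseDisjoint fun i => Ioc (x i) (y i)) :
    (∑ i ∈ Finset.range n, dist (h (x i)) (h (y i))) ^ 2 ≤
      L ^ 2 * ∑ i ∈ Finset.range n, (y i - x i) := by
  have hfloor : ∀ z : ℝ, 0 ≤ z →
      Tendsto (fun p : ℕ => (⌊z * 2 ^ p⌋₊ : ℝ) / 2 ^ p) atTop (𝓝 z) := fun z hz =>
    (tendsto_nat_floor_mul_div_atTop hz).comp (tendsto_pow_atTop_atTop_of_one_lt one_lt_two)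
  have hyn : ∀ i < n, 0 ≤ y i := fun i hi => (hx i hi).trans (hxy i hi)
  refine le_of_tendsto_of_tendsto'
    (f := fun p : ℕ => (∑ i ∈ Finset.range n,
      dist (h (⌊x i * 2 ^ p⌋₊ / 2 ^ p)) (h (⌊y i * 2 ^ p⌋₊ / 2 ^ p))) ^ 2)
    (g := fun p : ℕ => L ^ 2 * ∑ i ∈ Finset.range n,
      ((⌊y i * 2 ^ p⌋₊ : ℝ) / 2 ^ p - ⌊x i * 2 ^ p⌋₊ / 2 ^ p)) (b := atTop) ?_ ?_ fun p => ?_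
  · refine (tendsto_finsetSum _ fun i hi => ?_).pow 2
    rw [Finset.mem_range] at hi
    exact ((hc.tendsto _).comp (hfloor _ (hx i hi))).dist
      ((hc.tendsto _).comp (hfloor _ (hyn i hi)))
  · refine (tendsto_finsetSum _ fun i hi => ?_).const_mul _
    rw [Finset.mem_range] at hi
    exact (hfloor _ (hyn i hi)).sub (hfloor _ (hx i hi))
  have h2p : (0 : ℝ) < 2 ^ p := by positivity
  set S : Finset ℕ := (Finset.range n).biUnion fun i =>
    Finset.Ico ⌊x i * 2 ^ p⌋₊ ⌊y i * 2 ^ p⌋₊ with hS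
  have hle : ∀ i < n, ⌊x i * 2 ^ p⌋₊ ≤ ⌊y i * 2 ^ p⌋₊ := fun i hi =>
    Nat.floor_mono (mul_le_mul_of_nonneg_right (hxy i hi) h2p.le)
  have hdisj : (Finset.range n : Set ℕ).PairwiseDisjoint fun i =>
      Finset.Ico ⌊x i * 2 ^ p⌋₊ ⌊y i * 2 ^ p⌋₊ := by
    intro i hi j hj hij
    rw [Function.onFun, Finset.disjoint_left]
    intro k hki hkj
    -- the right endpoint of the cell `k` would belong to both intervals
    have hmem : ∀ i ∈ (Finset.range n : Set ℕ), k ∈ Finset.Ico ⌊x i * 2 ^ p⌋₊ ⌊y i * 2 ^ p⌋₊ →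
        ((k : ℝ) + 1) / 2 ^ p ∈ Ioc (x i) (y i) := by
      intro i hi hk
      rw [Finset.mem_Ico] at hk
      rw [Finset.mem_coe, Finset.mem_range] at hi
      constructor
      · rw [lt_div_iff₀ h2p]
        exact (Nat.lt_floor_add_one _).trans_le (by exact_mod_cast Nat.succ_le_succ hk.1)
      · rw [div_le_iff₀ h2p]
        refine le_trans ?_ (Nat.floor_le (mul_nonneg (hyn i hi) h2p.le))
        exact_mod_cast hk.2
    exact Set.disjoint_left.mp (hd hi hj hij) (hmem i hi hki) (hmem j hj hkj)
  have h1 : ∑ i ∈ Finset.range n,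
      dist (h (⌊x i * 2 ^ p⌋₊ / 2 ^ p)) (h (⌊y i * 2 ^ p⌋₊ / 2 ^ p)) ≤
      ∑ k ∈ S, ‖h ((k + 1 : ℕ) / 2 ^ p) - h (k / 2 ^ p)‖ := by
    rw [hS, Finset.sum_biUnion hdisj]
    refine Finset.sum_le_sum fun i hi => ?_
    refine (dist_le_Ico_sum_dist (fun k : ℕ => h (k / 2 ^ p))
      (hle i (Finset.mem_range.mp hi))).trans (le_of_eq (Finset.sum_congr rfl fun k _ => ?_))
    rw [dist_comm, dist_eq_norm]
  have h3 : S ⊆ Finset.range (2 ^ p) := by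
    refine Finset.biUnion_subset.mpr fun i hi k hk => ?_
    rw [Finset.mem_range] at hi ⊢
    refine (Finset.mem_Ico.mp hk).2.trans_le (Nat.floor_le_of_le ?_)
    push_cast
    exact mul_le_of_le_one_left h2p.le (hy i hi)
  have h4 : (S.card : ℝ) / 2 ^ p = ∑ i ∈ Finset.range n,
      ((⌊y i * 2 ^ p⌋₊ : ℝ) / 2 ^ p - ⌊x i * 2 ^ p⌋₊ / 2 ^ p) := by
    rw [hS, Finset.card_biUnion hdisj, Nat.cast_sum, Finset.sum_div]
    refine Finset.sum_congr rfl fun i hi => ?_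
    rw [Nat.card_Ico, Nat.cast_sub (hle i (Finset.mem_range.mp hi)), sub_div]
  calc _ ≤ (∑ k ∈ S, ‖h ((k + 1 : ℕ) / 2 ^ p) - h (k / 2 ^ p)‖) ^ 2 := by gcongr
    _ ≤ S.card * ∑ k ∈ S, ‖h ((k + 1 : ℕ) / 2 ^ p) - h (k / 2 ^ p)‖ ^ 2 := sq_sum_le_card_mul_sum_sq
    _ ≤ S.card * (L ^ 2 / 2 ^ p) := by
      gcongr
      exact (Finset.sum_le_sum_of_subset_of_nonneg h3 fun _ _ _ => by positivity).trans (hE p)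
    _ = _ := by rw [← h4]; ring

lemma absolutelyContinuousOnInterval_of_dyadic_energy_le (hc : Continuous h) {L : ℝ}
    (hE : ∀ p : ℕ, ∑ k ∈ Finset.range (2 ^ p),
      ‖h ((k + 1 : ℕ) / 2 ^ p) - h (k / 2 ^ p)‖ ^ 2 ≤ L ^ 2 / 2 ^ p) :
    AbsolutelyContinuousOnInterval h 0 1 := by
  rw [absolutelyContinuousOnInterval_iff]
  intro ε hε
  refine ⟨ε ^ 2 / (L ^ 2 + 1), by positivity, ?_⟩
  rintro ⟨n, I⟩ ⟨hI, hd⟩ hlen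
  simp only [uIcc_of_le (zero_le_one' ℝ), Finset.mem_range] at hI
  have hsum := sq_sum_dist_le_of_dyadic_energy_le hc hE (n := n)
    (x := fun i => min (I i).1 (I i).2) (y := fun i => max (I i).1 (I i).2)
    (fun i hi => le_min (hI i hi).1.1 (hI i hi).2.1) (fun i _ => min_le_max)
    (fun i hi => max_le (hI i hi).1.2 (hI i hi).2.2) hd
  have h1 : ∀ i, dist (h (min (I i).1 (I i).2)) (h (max (I i).1 (I i).2)) =
      dist (h (I i).1) (h (I i).2) := fun i => by
    rcases le_total (I i).1 (I i).2 with hle | hle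
    · rw [min_eq_left hle, max_eq_right hle]
    · rw [min_eq_right hle, max_eq_left hle, dist_comm]
  have h2 : ∀ i, max (I i).1 (I i).2 - min (I i).1 (I i).2 = dist (I i).1 (I i).2 := fun i => by
    rw [max_sub_min_eq_abs', Real.dist_eq]
  simp only [h1, h2] at hsum
  simp only at hlen ⊢
  refine lt_of_pow_lt_pow_left₀ 2 hε.le (hsum.trans_lt ?_)
  rw [lt_div_iff₀ (by positivity)] at hlen
  refine lt_of_le_of_lt ?_ hlen
  have : 0 ≤ ∑ i ∈ Finset.range n, dist (I i).1 (I i).2 := Finset.sum_nonneg fun _ _ => dist_nonneg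
  nlinarith

/-- Difference quotients over shrinking intervals around a point of differentiability. -/
lemma HasDerivAt.tendsto_straddle {E : Type*} [NormedAddCommGroup E] [NormedSpace ℝ E] {f : ℝ → E}
    {f' : E} {t : ℝ} (hf : HasDerivAt f f' t) {a b : ℕ → ℝ} (ha : Tendsto a atTop (𝓝 t))
    (hb : Tendsto b atTop (𝓝 t)) (hat : ∀ n, a n ≤ t) (htb : ∀ n, t ≤ b n) (hab : ∀ n, a n < b n) :
    Tendsto (fun n => (b n - a n)⁻¹ • (f (b n) - f (a n))) atTop (𝓝 f') := by
  have h0 := hasDerivAt_iff_isLittleO.mp hf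
  have hA : (fun n => f (a n) - f t - (a n - t) • f') =o[atTop] fun n => b n - a n :=
    (h0.comp_tendsto ha).trans_isBigO (Asymptotics.isBigO_of_le _ fun n => by
      simp only [Function.comp_apply, Real.norm_eq_abs]
      rw [abs_of_nonpos (by linarith [hat n]), abs_of_pos (by linarith [hab n])]
      linarith [htb n])
  have hB : (fun n => f (b n) - f t - (b n - t) • f') =o[atTop] fun n => b n - a n :=
    (h0.comp_tendsto hb).trans_isBigO (Asymptotics.isBigO_of_le _ fun n => by
      simp only [Function.comp_apply, Real.norm_eq_abs]
      rw [abs_of_nonneg (by linarith [htb n]), abs_of_pos (by linarith [hab n])]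
      linarith [hat n])
  have h1 := (hB.sub hA).tendsto_inv_smul_nhds_zero
  refine tendsto_sub_nhds_zero_iff.mp (h1.congr fun n => ?_)
  have h2 : (b n - a n)⁻¹ * (b n - a n) = 1 := inv_mul_cancel₀ (by linarith [hab n])
  have h3 : f (b n) - f t - (b n - t) • f' - (f (a n) - f t - (a n - t) • f') =
      f (b n) - f (a n) - (b n - a n) • f' := by module
  rw [h3, smul_sub, smul_smul, h2, one_smul]

/-- Fatou's lemma for the difference quotients over dyadic cells. -/
lemma lintegral_sq_enorm_deriv_le_of_dyadic_energy_le {L : ℝ}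
    (hac : AbsolutelyContinuousOnInterval h 0 1)
    (hE : ∀ p : ℕ, ∑ k ∈ Finset.range (2 ^ p),
      ‖h ((k + 1 : ℕ) / 2 ^ p) - h (k / 2 ^ p)‖ ^ 2 ≤ L ^ 2 / 2 ^ p) :
    ∫⁻ t in Icc (0 : ℝ) 1, ‖deriv h t‖ₑ ^ 2 ≤ ENNReal.ofReal (L ^ 2) := by
  set g : ℕ → ℕ → ℝ≥0∞ := fun p k =>
    ‖(2 ^ p : ℝ) • (h ((k + 1 : ℕ) / 2 ^ p) - h (k / 2 ^ p))‖ₑ ^ 2 with hg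
  set D : ℕ → ℝ → ℝ≥0∞ := fun p t => g p ⌊t * 2 ^ p⌋₊ with hD
  have hDm : ∀ p, Measurable (D p) := fun p =>
    (measurable_from_nat (f := g p)).comp (Nat.measurable_floor.comp (measurable_id.mul_const _))
  have hlim : ∀ᵐ t ∂(volume.restrict (Icc (0 : ℝ) 1)),
      ‖deriv h t‖ₑ ^ 2 = liminf (fun p => D p t) atTop := by
    rw [ae_restrict_iff' measurableSet_Icc]
    filter_upwards [hac.ae_differentiableAt_finiteDimensional] with t ht ht'
    rw [uIcc_of_le zero_le_one] at ht
    have hpow : Tendsto (fun p : ℕ => (2 : ℝ) ^ p) atTop atTop :=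
      tendsto_pow_atTop_atTop_of_one_lt one_lt_two
    have ha : Tendsto (fun p : ℕ => (⌊t * 2 ^ p⌋₊ : ℝ) / 2 ^ p) atTop (𝓝 t) :=
      (tendsto_nat_floor_mul_div_atTop ht'.1).comp hpow
    have hb : Tendsto (fun p : ℕ => ((⌊t * 2 ^ p⌋₊ + 1 : ℕ) : ℝ) / 2 ^ p) atTop (𝓝 t) := by
      have := ha.add (tendsto_inv_atTop_zero.comp hpow)
      rw [add_zero] at this
      refine this.congr fun p => ?_
      simp only [Function.comp_apply]
      push_cast
      rw [add_div, one_div]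
    have h2p : ∀ p : ℕ, (0 : ℝ) < 2 ^ p := fun p => by positivity
    have hs := (ht ht').hasDerivAt.tendsto_straddle ha hb
      (fun p => by
        rw [div_le_iff₀ (h2p p)]
        exact Nat.floor_le (mul_nonneg ht'.1 (h2p p).le))
      (fun p => by
        rw [le_div_iff₀ (h2p p)]
        push_cast
        exact (Nat.lt_floor_add_one _).le)
      (fun p => by
        refine div_lt_div_of_pos_right ?_ (h2p p)
        push_cast
        exact lt_add_one _)
    have hs' : Tendsto (fun p => D p t) atTop (𝓝 (‖deriv h t‖ₑ ^ 2)) := by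
      refine ((ENNReal.continuous_pow 2).tendsto _).comp (hs.enorm.congr fun p => ?_)
      congr 2
      push_cast
      rw [← sub_div, add_sub_cancel_left, one_div, inv_inv]
    exact hs'.liminf_eq.symm
  rw [lintegral_congr_ae hlim]
  refine (lintegral_liminf_le hDm).trans ?_
  refine liminf_le_of_le (by isBoundedDefault) fun b hb => ?_
  obtain ⟨p, hp⟩ := hb.exists
  refine hp.trans ?_
  have h2p : (0 : ℝ) < 2 ^ p := by positivity
  refine (lintegral_Icc_le_sum (N := 2 ^ p) (by positivity) (c := g p) fun i hi t ht => ?_).trans ?_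
  · refine le_of_eq (congrArg (g p) ?_)
    push_cast at ht
    have h0 : 0 ≤ t := (div_nonneg (Nat.cast_nonneg i) h2p.le).trans ht.1.le
    rw [Nat.floor_eq_iff (mul_nonneg h0 h2p.le)]
    exact ⟨(div_le_iff₀ h2p).mp ht.1.le, (lt_div_iff₀ h2p).mp ht.2⟩
  · have h1 : ∀ i, ENNReal.ofReal (1 / (2 ^ p : ℕ)) * g p i =
        ENNReal.ofReal (2 ^ p * ‖h ((i + 1 : ℕ) / 2 ^ p) - h (i / 2 ^ p)‖ ^ 2) := fun i => by
      simp only [hg]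
      rw [← ofReal_norm, ← ENNReal.ofReal_pow (norm_nonneg _), ← ENNReal.ofReal_mul (by positivity),
        norm_smul, Real.norm_of_nonneg h2p.le]
      congr 1
      push_cast
      field_simp
    simp only [h1]
    rw [← ENNReal.ofReal_sum_of_nonneg fun _ _ => by positivity, ← Finset.mul_sum]
    refine ENNReal.ofReal_le_ofReal ?_
    have := hE p
    rwa [le_div_iff₀' h2p] at this

lemma cameronMartinNorm_eq_eLpNorm :
    cameronMartinNorm h = eLpNorm (deriv h) 2 (volume.restrict (Icc (0 : ℝ) 1)) := by
  rw [cameronMartinNorm, eLpNorm_eq_lintegral_rpow_enorm_toReal two_ne_zero ENNReal.ofNat_ne_top]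
  simp

/-- A continuous path whose dyadic energies are bounded by `L²` belongs to the Cameron–Martin space,
with norm at most `L`. -/
lemma isCameronMartin_of_dyadic_energy_le (hc : Continuous h) (h0 : h 0 = 0) {L : ℝ} (hL : 0 ≤ L)
    (hE : ∀ p : ℕ, ∑ k ∈ Finset.range (2 ^ p),
      ‖h ((k + 1 : ℕ) / 2 ^ p) - h (k / 2 ^ p)‖ ^ 2 ≤ L ^ 2 / 2 ^ p) :
    IsCameronMartin h ∧ cameronMartinNorm h ≤ ENNReal.ofReal L := by
  have hac := absolutelyContinuousOnInterval_of_dyadic_energy_le hc hE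
  have hnorm : cameronMartinNorm h ≤ ENNReal.ofReal L := by
    have h1 := lintegral_sq_enorm_deriv_le_of_dyadic_energy_le hac hE
    have h2 := ENNReal.rpow_le_rpow h1 (by norm_num : (0 : ℝ) ≤ 1 / 2)
    rwa [ENNReal.ofReal_rpow_of_nonneg (sq_nonneg L) (by norm_num), ← Real.sqrt_eq_rpow,
      Real.sqrt_sq hL] at h2
  refine ⟨⟨⟨hac, h0⟩, (measurable_deriv h).aestronglyMeasurable, ?_⟩, hnorm⟩
  rw [← cameronMartinNorm_eq_eLpNorm]
  exact hnorm.trans_lt ENNReal.ofReal_lt_top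

/-- Conversely, the energy of an absolutely continuous path on a uniform grid is at most its
Cameron–Martin energy. -/
lemma IsAC0.grid_energy_le (hh : IsAC0 h) {N : ℕ} (hN : 0 < N) :
    N * ∑ k ∈ Finset.range N, ‖h ((k + 1 : ℕ) / N) - h (k / N)‖ₑ ^ 2 ≤
      ∫⁻ t in Icc (0 : ℝ) 1, ‖deriv h t‖ₑ ^ 2 := by
  have hN' : (0 : ℝ) < N := by exact_mod_cast hN
  have hmem : ∀ k ≤ N, (k : ℝ) / N ∈ Icc (0 : ℝ) 1 := fun k hk =>
    ⟨by positivity, div_le_one_of_le₀ (by exact_mod_cast hk) hN'.le⟩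
  have hmono : Monotone fun k : ℕ => (k : ℝ) / N := fun k l hkl => by
    simp only
    gcongr
  have hcell : ∀ k < N, N * ‖h ((k + 1 : ℕ) / N) - h (k / N)‖ₑ ^ 2 ≤
      ∫⁻ t in Ioc ((k : ℝ) / N) ((k + 1 : ℕ) / N), ‖deriv h t‖ₑ ^ 2 := by
    intro k hk
    rw [← (hh.mono (hmem k hk.le) (hmem (k + 1) hk)).integral_deriv_eq_sub_euclidean,
      intervalIntegral.integral_of_le (hmono k.le_succ)]
    set μ := volume.restrict (Ioc ((k : ℝ) / N) ((k + 1 : ℕ) / N))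
    have h1 : ‖∫ t, deriv h t ∂μ‖ₑ ≤ (∫⁻ t, ‖deriv h t‖ₑ ^ 2 ∂μ) ^ (1 / 2 : ℝ) *
        ENNReal.ofReal (1 / N) ^ (1 / 2 : ℝ) := by
      refine (enorm_integral_le_lintegral_enorm _).trans ?_
      have h2 := ENNReal.lintegral_mul_le_Lp_mul_Lq μ Real.HolderConjugate.two_two
        (measurable_deriv h).enorm.aemeasurable (aemeasurable_const (b := (1 : ℝ≥0∞)))
      simp only [Pi.mul_apply, mul_one, ENNReal.rpow_two, one_pow, lintegral_one] at h2
      have h3 : μ univ = ENNReal.ofReal (1 / N) := by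
        rw [Measure.restrict_apply_univ, Real.volume_Ioc, ← sub_div]
        push_cast
        rw [add_sub_cancel_left]
      rwa [h3] at h2
    have h4 := pow_le_pow_left₀ zero_le h1 2
    have h5 : ∀ a : ℝ≥0∞, (a ^ (1 / 2 : ℝ)) ^ 2 = a := fun a => by
      rw [← ENNReal.rpow_natCast, ← ENNReal.rpow_mul]
      norm_num
    rw [← ENNReal.mul_rpow_of_nonneg _ _ (by norm_num), h5] at h4
    calc _ ≤ (N : ℝ≥0∞) * ((∫⁻ t, ‖deriv h t‖ₑ ^ 2 ∂μ) * ENNReal.ofReal (1 / N)) := by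
          gcongr
      _ = _ := by
          rw [mul_left_comm, ← ENNReal.ofReal_natCast, ← ENNReal.ofReal_mul hN'.le,
            mul_one_div_cancel hN'.ne', ENNReal.ofReal_one, mul_one]
  rw [Finset.mul_sum]
  refine (Finset.sum_le_sum fun k hk => hcell k (Finset.mem_range.mp hk)).trans ?_
  rw [← lintegral_biUnion_finset]
  · refine lintegral_mono_set (iUnion₂_subset fun k hk => ?_)
    have hk := Finset.mem_range.mp hk
    exact Ioc_subset_Icc_self.trans (Icc_subset_Icc (hmem k hk.le).1 (hmem (k + 1) hk).2)
  · exact (hmono.pairwise_disjoint_on_Ioc_succ).set_pairwise _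
  · exact fun k _ => measurableSet_Ioc

end Energy

namespace StepTwoCarnotGroup

variable {d₁ d₂ : ℕ} {G : StepTwoCarnotGroup d₁ d₂}

/-! ### Comparison of increments -/

/-- For `p = y x⁻¹` and `p' = y' x'⁻¹` the increments `x⁻¹ x'` and `y⁻¹ y'` differ by a conjugate of
`p⁻¹ p'`. -/
lemma dcc_increments (x x' y y' : G.Carrier) :
    G.dcc (x⁻¹ * x') (y⁻¹ * y') =
      G.dcc 1 (x'⁻¹ * ((y * x⁻¹)⁻¹ * (y' * x'⁻¹)) * x') := by
  rw [dcc_eq_dcc_one]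
  congr 1
  group

lemma conj_fst (p p' x : G.Carrier) : (x⁻¹ * (p⁻¹ * p') * x).1 = p'.1 - p.1 := by
  simp only [mul_fst, inv_fst]
  abel

lemma conj_snd (p p' x : G.Carrier) :
    (x⁻¹ * (p⁻¹ * p') * x).2 =
      p'.2 - p.2 - G.bracket (x.1 + (1 / 2 : ℝ) • p'.1) (p'.1 - p.1) := by
  simp only [mul_fst, mul_snd, inv_fst, inv_snd, bracket_add_left, bracket_add_right,
    bracket_neg_left, bracket_neg_right, bracket_sub_right, bracket_smul_left, bracket_self,
    G.bracket_swap p.1 x.1, G.bracket_swap p'.1 x.1, G.bracket_swap p'.1 p.1]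
  module

/-! ### Riemann sums for the shift -/

lemma integral_bracket_const_deriv {h : ℝ → EuclideanSpace ℝ (Fin d₁)} {s t : ℝ}
    (hh : AbsolutelyContinuousOnInterval h s t) (c : EuclideanSpace ℝ (Fin d₁)) :
    ∫ r in s..t, G.bracket c (deriv h r) = G.bracket c (h t - h s) := by
  rw [← hh.integral_deriv_eq_sub_euclidean]
  exact (G.bracketL c).intervalIntegral_comp_comm hh.intervalIntegrable_deriv_euclidean

lemma norm_riemannSum_sub_le {h m : ℝ → EuclideanSpace ℝ (Fin d₁)} (hh : IsAC0 h)
    (hm : ContinuousOn m (Icc 0 1)) {τ : ℕ → ℝ} (hτ : Monotone τ) (hτ' : ∀ k, τ k ∈ Icc (0 : ℝ) 1)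
    {c : ℕ → EuclideanSpace ℝ (Fin d₁)} {δ : ℝ} {N : ℕ} (hδ : 0 ≤ δ)
    (hc : ∀ k < N, ∀ r ∈ Icc (τ k) (τ (k + 1)), ‖c k - m r‖ ≤ δ) :
    ‖∑ k ∈ Finset.range N, G.bracket (c k) (h (τ (k + 1)) - h (τ k)) -
        ∫ r in τ 0..τ N, G.bracket (m r) (deriv h r)‖ ≤
      G.bracketBound * δ * ∫ r in (0 : ℝ)..1, ‖deriv h r‖ := by
  have hac : ∀ k l, AbsolutelyContinuousOnInterval h (τ k) (τ l) := fun k l =>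
    hh.mono (hτ' k) (hτ' l)
  have hsub : ∀ k, Icc (τ k) (τ (k + 1)) ⊆ Icc 0 1 := fun k =>
    Icc_subset_Icc (hτ' k).1 (hτ' (k + 1)).2
  have hint : ∀ k, IntervalIntegrable (fun r => G.bracket (m r) (deriv h r)) volume (τ k)
      (τ (k + 1)) := fun k =>
    G.intervalIntegrable_bracket (hm.mono (by rw [uIcc_of_le (hτ k.le_succ)]; exact hsub k))
      (hac k (k + 1)).intervalIntegrable_deriv_euclidean
  rw [← intervalIntegral.sum_integral_adjacent_intervals fun k _ => hint k,
    ← Finset.sum_sub_distrib]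
  have h1 : ∑ k ∈ Finset.range N, ∫ r in τ k..τ (k + 1), ‖deriv h r‖ ≤
      ∫ r in (0 : ℝ)..1, ‖deriv h r‖ := by
    rw [intervalIntegral.sum_integral_adjacent_intervals fun k _ =>
      (hac k (k + 1)).intervalIntegrable_deriv_euclidean.norm]
    exact intervalIntegral.integral_mono_interval (hτ' 0).1 (hτ N.zero_le) (hτ' N).2
      (ae_of_all _ fun _ => norm_nonneg _) hh.1.intervalIntegrable_deriv_euclidean.norm
  refine (norm_sum_le_of_le _ (n := fun k => G.bracketBound * δ * ∫ r in τ k..τ (k + 1),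
    ‖deriv h r‖) fun k hk => ?_).trans ?_
  · rw [← integral_bracket_const_deriv (hac k (k + 1))]
    exact norm_integral_bracket_sub_le (hτ k.le_succ) continuousOn_const (hm.mono (hsub k))
      (hac k (k + 1)).intervalIntegrable_deriv_euclidean (hc k (Finset.mem_range.mp hk))
  · rw [← Finset.mul_sum]
    exact mul_le_mul_of_nonneg_left h1 (mul_nonneg G.bracketBound_pos.le hδ)

/-- The Riemann sum on the grid of mesh `1 / N`, stopped at time `t`, for the integral
`∫₀ᵗ [m_s, ḣ_s] ds`. The right endpoints are the evaluation points because these are the ones which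
occur in `conj_snd`. -/
noncomputable def stoppedSum (G : StepTwoCarnotGroup d₁ d₂) (m h : ℝ → EuclideanSpace ℝ (Fin d₁))
    (N : ℕ) (t : ℝ) : EuclideanSpace ℝ (Fin d₂) :=
  ∑ k ∈ Finset.range N, G.bracket (m (min ((k + 1 : ℕ) / N) t))
    (h (min ((k + 1 : ℕ) / N) t) - h (min (k / N) t))

lemma stoppedSum_node (m h : ℝ → EuclideanSpace ℝ (Fin d₁)) {N j : ℕ} (hj : j ≤ N) :
    G.stoppedSum m h N (j / N) = ∑ k ∈ Finset.range j,
      G.bracket (m ((k + 1 : ℕ) / N)) (h ((k + 1 : ℕ) / N) - h (k / N)) := by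
  have hmono : ∀ k l : ℕ, k ≤ l → (k : ℝ) / N ≤ l / N := fun k l hkl => by gcongr
  obtain ⟨m', rfl⟩ := Nat.exists_eq_add_of_le hj
  rw [stoppedSum, Finset.sum_range_add, Finset.sum_eq_zero (s := Finset.range m'), add_zero]
  · refine Finset.sum_congr rfl fun k hk => ?_
    have hk := Finset.mem_range.mp hk
    rw [min_eq_left (hmono _ _ hk), min_eq_left (hmono _ _ hk.le)]
  · intro k _
    rw [min_eq_right (hmono _ _ (by omega)), min_eq_right (hmono _ _ (by omega)), sub_self,
      bracket_zero_right]

lemma min_mem_Icc {c : ℝ} (hc : 0 ≤ c) (t : unitInterval) : min c (t : ℝ) ∈ Icc (0 : ℝ) 1 :=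
  ⟨le_min hc t.2.1, (min_le_right _ _).trans t.2.2⟩

lemma continuous_stoppedSum {m h : ℝ → EuclideanSpace ℝ (Fin d₁)} (hm : ContinuousOn m (Icc 0 1))
    (hh : ContinuousOn h (Icc 0 1)) (N : ℕ) :
    Continuous fun t : unitInterval => G.stoppedSum m h N t := by
  have hmin : ∀ c : ℝ, Continuous fun t : unitInterval => min c (t : ℝ) := fun c =>
    continuous_const.min continuous_subtype_val
  refine continuous_finsetSum _ fun k _ => Continuous.bracket G ?_ (Continuous.sub ?_ ?_)
  · exact hm.comp_continuous (hmin _) fun t => min_mem_Icc (by positivity) t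
  · exact hh.comp_continuous (hmin _) fun t => min_mem_Icc (by positivity) t
  · exact hh.comp_continuous (hmin _) fun t => min_mem_Icc (by positivity) t

lemma stoppedSum_zero (m h : ℝ → EuclideanSpace ℝ (Fin d₁)) (N : ℕ) :
    G.stoppedSum m h N 0 = 0 := by
  refine Finset.sum_eq_zero fun k _ => ?_
  rw [min_eq_right (by positivity), min_eq_right (by positivity), sub_self, bracket_zero_right]

lemma norm_stoppedSum_sub_le {h m : ℝ → EuclideanSpace ℝ (Fin d₁)} (hh : IsAC0 h)
    (hm : ContinuousOn m (Icc 0 1)) {δ : ℝ} {N : ℕ} (hN : 0 < N)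
    (hδ : ∀ r ∈ Icc (0 : ℝ) 1, ∀ s ∈ Icc (0 : ℝ) 1, |r - s| ≤ 1 / N → ‖m r - m s‖ ≤ δ)
    (t : unitInterval) :
    ‖G.stoppedSum m h N t - ∫ r in (0 : ℝ)..t, G.bracket (m r) (deriv h r)‖ ≤
      G.bracketBound * δ * ∫ r in (0 : ℝ)..1, ‖deriv h r‖ := by
  have hN' : (0 : ℝ) < N := by exact_mod_cast hN
  have hδ0 : 0 ≤ δ := (norm_nonneg _).trans (hδ 0 (left_mem_Icc.mpr zero_le_one) 0
    (left_mem_Icc.mpr zero_le_one) (by simp))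
  have hmem : ∀ k : ℕ, min ((k : ℝ) / N) (t : ℝ) ∈ Icc (0 : ℝ) 1 := fun k =>
    min_mem_Icc (by positivity) t
  have hmono : Monotone fun k : ℕ => min ((k : ℝ) / N) (t : ℝ) := fun k l hkl =>
    min_le_min_right _ (by gcongr)
  have h1 := norm_riemannSum_sub_le (G := G) hh hm (τ := fun k : ℕ => min ((k : ℝ) / N) (t : ℝ))
    hmono hmem (c := fun k => m (min ((k + 1 : ℕ) / N) t)) (N := N) hδ0 fun k _ r hr => by
      refine hδ _ (hmem (k + 1)) r ⟨(hmem k).1.trans hr.1, hr.2.trans (hmem (k + 1)).2⟩ ?_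
      rw [abs_of_nonneg (by linarith [hr.2])]
      have h2 := hr.1
      have h3 : ((k + 1 : ℕ) : ℝ) / N = k / N + 1 / N := by push_cast; rw [add_div]
      rcases le_total ((k : ℝ) / N) t with h4 | h4
      · rw [min_eq_left h4] at h2
        linarith [min_le_left (((k + 1 : ℕ) : ℝ) / N) (t : ℝ)]
      · rw [min_eq_right h4] at h2
        have : (0 : ℝ) ≤ 1 / N := by positivity
        linarith [min_le_right (((k + 1 : ℕ) : ℝ) / N) (t : ℝ)]
  have h0 : min (((0 : ℕ) : ℝ) / N) (t : ℝ) = 0 := by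
    rw [Nat.cast_zero, zero_div, min_eq_left t.2.1]
  have hNt : min ((N : ℝ) / N) (t : ℝ) = t := by rw [div_self hN'.ne', min_eq_right t.2.2]
  rw [h0, hNt] at h1
  exact h1

lemma exists_modulus {m : ℝ → EuclideanSpace ℝ (Fin d₁)} (hm : ContinuousOn m (Icc 0 1)) {δ : ℝ}
    (hδ : 0 < δ) : ∃ N₀ : ℕ, ∀ N ≥ N₀, ∀ r ∈ Icc (0 : ℝ) 1, ∀ s ∈ Icc (0 : ℝ) 1, |r - s| ≤ 1 / N →
      ‖m r - m s‖ ≤ δ := by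
  obtain ⟨η, hη, h⟩ := Metric.uniformContinuousOn_iff.mp
    (isCompact_Icc.uniformContinuousOn_of_continuous hm) δ hδ
  obtain ⟨N₀, hN₀⟩ := exists_nat_one_div_lt hη
  refine ⟨N₀ + 1, fun N hN r hr s hs hrs => ?_⟩
  rw [← dist_eq_norm]
  refine (h r hr s hs ?_).le
  rw [Real.dist_eq]
  refine hrs.trans_lt (lt_of_le_of_lt ?_ hN₀)
  have : ((N₀ : ℝ) + 1) ≤ N := by exact_mod_cast hN
  gcongr

/-! ### The recovery sequence -/

section Recovery

variable {h : ℝ → EuclideanSpace ℝ (Fin d₁)}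

/-- The mean `X⁽¹⁾ + h / 2` of the first layers of `X` and of its shift by `h`. -/
noncomputable def midBase (X : G.PathSpace) (h : ℝ → EuclideanSpace ℝ (Fin d₁)) (t : ℝ) :
    EuclideanSpace ℝ (Fin d₁) :=
  X.base t + (1 / 2 : ℝ) • h t

lemma continuousOn_midBase (X : G.PathSpace) (hh : IsAC0 h) :
    ContinuousOn (midBase X h) (Icc 0 1) :=
  X.continuous_base.continuousOn.add (hh.continuousOn_Icc.const_smul (1 / 2 : ℝ))

/-- The discretisation of `shiftFactor` on the grid of mesh `1 / N`. -/
noncomputable def discreteFactor (X : G.PathSpace) (h : ℝ → EuclideanSpace ℝ (Fin d₁)) (N : ℕ)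
    (t : ℝ) : G.Carrier :=
  (h t, G.stoppedSum (midBase X h) h N t)

@[simp] lemma discreteFactor_fst (X : G.PathSpace) (N : ℕ) (t : ℝ) :
    (discreteFactor X h N t).1 = h t := rfl

@[simp] lemma discreteFactor_snd (X : G.PathSpace) (N : ℕ) (t : ℝ) :
    (discreteFactor X h N t).2 = G.stoppedSum (midBase X h) h N t := rfl

/-- The discretised shift of `X` by `h`: over each cell of the grid of mesh `1 / N`, the increment
of `X` is multiplied from the right by the exponential of the increment of `h`. -/
noncomputable def discreteShift (X : G.PathSpace) (hh : IsAC0 h) (N : ℕ) : G.PathSpace :=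
  ⟨fun t => discreteFactor X h N t * X.1 t, by
    have h1 : Continuous fun t : unitInterval => h t :=
      hh.continuousOn_Icc.comp_continuous continuous_subtype_val fun t => t.2
    have h2 : Continuous fun t : unitInterval => discreteFactor X h N t :=
      continuous_carrier_iff.mpr
        ⟨h1, continuous_stoppedSum (continuousOn_midBase X hh) hh.continuousOn_Icc N⟩
    exact h2.mul X.2.1, by
    have h1 : discreteFactor X h N (0 : unitInterval) = 1 := by
      ext1
      · exact hh.2
      · exact stoppedSum_zero (midBase X h) h N
    have h2 : discreteFactor X h N (0 : unitInterval) * X.1 0 = 1 := by rw [h1, one_mul, X.2.2]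
    exact h2⟩

lemma discreteShift_apply (X : G.PathSpace) (hh : IsAC0 h) (N : ℕ) (t : unitInterval) :
    (discreteShift X hh N).1 t = discreteFactor X h N t * X.1 t := rfl

lemma tendsto_discreteShift (X : G.PathSpace) (hh : IsAC0 h) {Y : G.PathSpace}
    (hY : ∀ t : unitInterval, Y.1 t = G.shiftFactor X.base h t * X.1 t) :
    Tendsto (fun n => G.dInf (discreteShift X hh (2 ^ n)).1 Y.1) atTop (𝓝 0) := by
  obtain ⟨B, hB⟩ := hh.1.exists_bound
  rw [uIcc_of_le zero_le_one] at hB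
  have hX : Tendsto (fun _ : ℕ => G.dInf X.1 X.1) atTop (𝓝 0) :=
    tendsto_const_nhds.congr fun _ => (dInf_self X).symm
  rw [show Y.1 = fun t : unitInterval => G.shiftFactor X.base h t * X.1 t from funext hY]
  refine tendsto_dInf_mul_left (F := fun _ => X.1) hX (B := B) (fun t => hB t t.2)
    (Q := fun n t => discreteFactor X h (2 ^ n) t)
    (fun n t => rfl) ?_
  have hC := G.bracketBound_pos
  set I := ∫ r in (0 : ℝ)..1, ‖deriv h r‖ with hI
  have hI0 : 0 ≤ I := intervalIntegral.integral_nonneg zero_le_one fun _ _ => norm_nonneg _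
  rw [Metric.tendstoUniformly_iff]
  intro ε hε
  obtain ⟨N₀, hN₀⟩ := exists_modulus (continuousOn_midBase X hh)
    (δ := ε / (G.bracketBound * I + 1)) (by positivity)
  filter_upwards [(tendsto_pow_atTop_atTop_of_one_lt (r := 2) one_lt_two).eventually_ge_atTop N₀]
    with n hn t
  rw [dist_comm, dist_eq_norm]
  refine lt_of_le_of_lt (norm_stoppedSum_sub_le hh (continuousOn_midBase X hh) (by positivity)
    (hN₀ _ hn) t) ?_
  rw [← hI, mul_right_comm, ← mul_div_assoc, div_lt_iff₀ (by positivity)]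
  nlinarith

lemma discreteCost_discreteShift_le (X : G.PathSpace) (hh : IsAC0 h) (n : ℕ) :
    G.discreteCost n (X, discreteShift X hh (2 ^ n)) ≤ cameronMartinNorm h := by
  refine ENNReal.rpow_le_rpow ?_ (by norm_num)
  have h1 := hh.grid_energy_le (N := 2 ^ n) (by positivity)
  refine le_trans ?_ h1
  push_cast
  rw [← Fin.sum_univ_eq_sum_range fun k : ℕ => ‖h ((k + 1 : ℝ) / 2 ^ n) - h (k / 2 ^ n)‖ₑ ^ 2]
  gcongr with k
  have hk0 : ((dyadicTime n k.castSucc : unitInterval) : ℝ) = (k : ℕ) / (2 ^ n : ℕ) := by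
    simp [dyadicTime]
  have hk1 : ((dyadicTime n k.succ : unitInterval) : ℝ) = ((k : ℕ) + 1 : ℕ) / (2 ^ n : ℕ) := by
    simp [dyadicTime]
  rw [dyadicIncrement, dyadicIncrement, dcc_increments]
  set x := X.1 (dyadicTime n k.castSucc)
  set x' := X.1 (dyadicTime n k.succ) with hx'
  set p := discreteFactor X h (2 ^ n) (dyadicTime n k.castSucc) with hp
  set p' := discreteFactor X h (2 ^ n) (dyadicTime n k.succ) with hp'
  have h2 : (discreteShift X hh (2 ^ n)).1 (dyadicTime n k.castSucc) * x⁻¹ = p := by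
    rw [discreteShift_apply, mul_inv_cancel_right]
  have h3 : (discreteShift X hh (2 ^ n)).1 (dyadicTime n k.succ) * x'⁻¹ = p' := by
    rw [discreteShift_apply, mul_inv_cancel_right]
  have h4 : x'⁻¹ * (p⁻¹ * p') * x' =
      G.expo (h ((k + 1 : ℝ) / 2 ^ n) - h (k / 2 ^ n)) := by
    have h5 : p'.1 - p.1 = h ((k + 1 : ℝ) / 2 ^ n) - h (k / 2 ^ n) := by
      rw [hp, hp', discreteFactor_fst, discreteFactor_fst, hk0, hk1]
      push_cast
      rfl
    ext1
    · rw [conj_fst, h5, expo_fst]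
    · rw [conj_snd, expo_snd]
      have h6 : p'.2 - p.2 = G.bracket (x'.1 + (1 / 2 : ℝ) • p'.1) (p'.1 - p.1) := by
        rw [hp, hp', discreteFactor_fst, discreteFactor_fst, discreteFactor_snd,
          discreteFactor_snd, hx', ← X.base_coe, hk0, hk1, stoppedSum_node _ _ k.2,
          stoppedSum_node _ _ k.2.le, Finset.sum_range_succ, add_sub_cancel_left]
        rfl
      rw [h6, sub_self]
  rw [h2, h3, h4]
  exact G.dcc_one_expo_le _

end Recovery

end StepTwoCarnotGroup

namespace StepTwoCarnotGroup

variable {d₁ d₂ : ℕ} {G : StepTwoCarnotGroup d₁ d₂}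

/-! ### Coarsening of discrete sums -/

lemma sum_sq_norm_block_le {E : Type*} [NormedAddCommGroup E] (η : ℕ → E) (q K : ℕ) :
    ∑ k ∈ Finset.range K, ‖η (q * (k + 1)) - η (q * k)‖ ^ 2 ≤
      q * ∑ k ∈ Finset.range (q * K), ‖η (k + 1) - η k‖ ^ 2 := by
  induction K with
  | zero => simp
  | succ K ih =>
    rw [Finset.sum_range_succ, mul_add_one, Finset.sum_range_add, mul_add]
    refine add_le_add ih ?_
    have h1 : η (q * K + q) - η (q * K) =
        ∑ i ∈ Finset.range q, (η (q * K + i + 1) - η (q * K + i)) :=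
      (Finset.sum_range_sub (fun i => η (q * K + i)) q).symm
    calc ‖η (q * K + q) - η (q * K)‖ ^ 2
        ≤ (∑ i ∈ Finset.range q, ‖η (q * K + i + 1) - η (q * K + i)‖) ^ 2 := by
          rw [h1]
          gcongr
          exact norm_sum_le _ _
      _ ≤ (Finset.range q).card * ∑ i ∈ Finset.range q, ‖η (q * K + i + 1) - η (q * K + i)‖ ^ 2 :=
          sq_sum_le_card_mul_sum_sq
      _ = _ := by rw [Finset.card_range]

/-- Passing from a fine to a coarse Riemann sum for the second layer `A`: the error consists of the
local errors on the fine grid, and of the oscillation of `μ` on the blocks. -/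
lemma norm_sub_coarse_sum_le {A : ℕ → EuclideanSpace ℝ (Fin d₂)}
    {μ η : ℕ → EuclideanSpace ℝ (Fin d₁)} {q : ℕ} {δ : ℝ} (K : ℕ)
    (hμ : ∀ k < K, ∀ i < q, ‖μ (q * k + i + 1) - μ (q * k)‖ ≤ δ) :
    ‖A (q * K) - A 0 - ∑ k ∈ Finset.range K,
        G.bracket (μ (q * k)) (η (q * (k + 1)) - η (q * k))‖ ≤
      ∑ k ∈ Finset.range (q * K),
        (‖A (k + 1) - A k - G.bracket (μ (k + 1)) (η (k + 1) - η k)‖ +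
          G.bracketBound * δ * ‖η (k + 1) - η k‖) := by
  induction K with
  | zero => simp
  | succ K ih =>
    specialize ih fun k hk => hμ k (hk.trans K.lt_succ_self)
    rw [Finset.sum_range_succ, mul_add_one, Finset.sum_range_add]
    have h1 : A (q * K + q) - A 0 - (∑ k ∈ Finset.range K,
        G.bracket (μ (q * k)) (η (q * (k + 1)) - η (q * k)) +
          G.bracket (μ (q * K)) (η (q * K + q) - η (q * K))) =
        (A (q * K) - A 0 - ∑ k ∈ Finset.range K,
          G.bracket (μ (q * k)) (η (q * (k + 1)) - η (q * k))) +
        ∑ i ∈ Finset.range q, (A (q * K + i + 1) - A (q * K + i) -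
          G.bracket (μ (q * K)) (η (q * K + i + 1) - η (q * K + i))) := by
      have h2 : A (q * K + q) - A (q * K) =
          ∑ i ∈ Finset.range q, (A (q * K + i + 1) - A (q * K + i)) :=
        (Finset.sum_range_sub (fun i => A (q * K + i)) q).symm
      have h3 : G.bracket (μ (q * K)) (η (q * K + q) - η (q * K)) =
          ∑ i ∈ Finset.range q,
            G.bracket (μ (q * K)) (η (q * K + i + 1) - η (q * K + i)) := by
        have h4 : η (q * K + q) - η (q * K) =
            ∑ i ∈ Finset.range q, (η (q * K + i + 1) - η (q * K + i)) :=
          (Finset.sum_range_sub (fun i => η (q * K + i)) q).symm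
        rw [h4, ← bracketL_apply, map_sum]
        rfl
      rw [Finset.sum_sub_distrib, ← h2, ← h3]
      abel
    rw [h1]
    refine (norm_add_le _ _).trans (add_le_add ih (norm_sum_le_of_le _ fun i hi => ?_))
    have h5 : A (q * K + i + 1) - A (q * K + i) -
        G.bracket (μ (q * K)) (η (q * K + i + 1) - η (q * K + i)) =
        (A (q * K + i + 1) - A (q * K + i) -
          G.bracket (μ (q * K + i + 1)) (η (q * K + i + 1) - η (q * K + i))) +
        G.bracket (μ (q * K + i + 1) - μ (q * K)) (η (q * K + i + 1) - η (q * K + i)) := by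
      rw [bracket_sub_left]
      abel
    rw [h5]
    refine (norm_add_le _ _).trans (add_le_add le_rfl ((G.norm_bracket_le _ _).trans ?_))
    have := G.bracketBound_pos
    have := hμ K K.lt_succ_self i (Finset.mem_range.mp hi)
    gcongr

/-! ### Bounds in terms of the discretised cost -/

/-- The difference of the first layers of two paths, extended to the line by constants. -/
noncomputable def diffBase (X Y : G.PathSpace) (t : ℝ) : EuclideanSpace ℝ (Fin d₁) :=
  Y.base t - X.base t

/-- The mean of the first layers of two paths, extended to the line by constants. -/
noncomputable def meanBase (X Y : G.PathSpace) (t : ℝ) : EuclideanSpace ℝ (Fin d₁) :=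
  X.base t + (1 / 2 : ℝ) • diffBase X Y t

/-- The second layer of `Y X⁻¹`, extended to the line by constants. -/
noncomputable def ratioArea (X Y : G.PathSpace) : ℝ → EuclideanSpace ℝ (Fin d₂) :=
  IccExtend zero_le_one fun t => (Y.1 t * (X.1 t)⁻¹).2

lemma continuous_diffBase (X Y : G.PathSpace) : Continuous (diffBase X Y) :=
  Y.continuous_base.sub X.continuous_base

lemma continuous_meanBase (X Y : G.PathSpace) : Continuous (meanBase X Y) :=
  X.continuous_base.add ((continuous_diffBase X Y).const_smul (1 / 2 : ℝ))

lemma continuous_ratioArea (X Y : G.PathSpace) : Continuous (ratioArea X Y) := by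
  have h : Continuous fun t => Y.1 t * (X.1 t)⁻¹ := Y.2.1.mul X.2.1.inv
  have h2 : Continuous fun t => (Y.1 t * (X.1 t)⁻¹).2 := continuous_snd_carrier.comp h
  exact h2.Icc_extend'

lemma ratioArea_zero (X Y : G.PathSpace) : ratioArea X Y 0 = 0 := by
  have h : ratioArea X Y 0 = (Y.1 0 * (X.1 0)⁻¹).2 :=
    IccExtend_left zero_le_one fun t => (Y.1 t * (X.1 t)⁻¹).2
  rw [h, Y.2.2, X.2.2, inv_one, mul_one, one_snd]

lemma diffBase_zero (X Y : G.PathSpace) : diffBase X Y 0 = 0 := by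
  have h1 := X.base_coe 0
  have h2 := Y.base_coe 0
  rw [X.fst_zero, Set.Icc.coe_zero] at h1
  rw [Y.fst_zero, Set.Icc.coe_zero] at h2
  rw [diffBase, h1, h2, sub_zero]

/-- A bound on the discretised cost controls, on the grid of mesh `2⁻ⁿ`, the increments of the
first layer of `Y X⁻¹`, and the errors made by a Riemann sum for the second layer. The bound is
quadratic in the latter case, by homogeneity. -/
lemma exists_bound_of_discreteCost_le {X Y : G.PathSpace} {n : ℕ} {L : ℝ} (hL : 0 ≤ L)
    (hXY : G.discreteCost n (X, Y) ≤ ENNReal.ofReal L) :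
    ∃ D : ℕ → ℝ, ∑ k ∈ Finset.range (2 ^ n), D k ^ 2 ≤ L ^ 2 / 2 ^ n ∧
      ∀ k < 2 ^ n,
        ‖diffBase X Y ((k + 1 : ℕ) / 2 ^ n) - diffBase X Y (k / 2 ^ n)‖ ≤ D k ∧
        ‖ratioArea X Y ((k + 1 : ℕ) / 2 ^ n) - ratioArea X Y (k / 2 ^ n) -
          G.bracket (meanBase X Y ((k + 1 : ℕ) / 2 ^ n))
            (diffBase X Y ((k + 1 : ℕ) / 2 ^ n) - diffBase X Y (k / 2 ^ n))‖ ≤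
          G.bracketBound * D k ^ 2 := by
  set x : ℕ → G.Carrier := fun k => X.1 (projIcc 0 1 zero_le_one ((k : ℝ) / 2 ^ n)) with hx
  set y : ℕ → G.Carrier := fun k => Y.1 (projIcc 0 1 zero_le_one ((k : ℝ) / 2 ^ n)) with hy
  set z : ℕ → G.Carrier := fun k =>
    (x (k + 1))⁻¹ * ((y k * (x k)⁻¹)⁻¹ * (y (k + 1) * (x (k + 1))⁻¹)) * x (k + 1) with hz
  have h2n : (0 : ℝ) < 2 ^ n := by positivity
  -- the cost in terms of `z`
  have hcost : 2 ^ n * ∑ k ∈ Finset.range (2 ^ n), G.dcc 1 (z k) ^ 2 ≤ ENNReal.ofReal (L ^ 2) := by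
    have h1 := pow_le_pow_left₀ zero_le hXY 2
    have h2 : ∀ a : ℝ≥0∞, (a ^ (1 / 2 : ℝ)) ^ 2 = a := fun a => by
      rw [← ENNReal.rpow_natCast, ← ENNReal.rpow_mul]
      norm_num
    rw [discreteCost, h2, ← ENNReal.ofReal_pow hL] at h1
    refine le_of_eq_of_le ?_ h1
    rw [← Fin.sum_univ_eq_sum_range fun k => G.dcc 1 (z k) ^ 2]
    congr 1
    refine Finset.sum_congr rfl fun k _ => ?_
    have h3 : ∀ k : Fin (2 ^ n + 1),
        projIcc 0 1 zero_le_one (((k : ℕ) : ℝ) / 2 ^ n) = dyadicTime n k := fun k =>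
      projIcc_of_mem zero_le_one (dyadicTime n k).2
    have h4 := h3 k.castSucc
    have h5 := h3 k.succ
    rw [Fin.val_castSucc] at h4
    rw [Fin.val_succ] at h5
    rw [dyadicIncrement, dyadicIncrement, dcc_increments]
    simp only [hz, hx, hy, h4, h5]
  have hfin : ∀ k < 2 ^ n, G.dcc 1 (z k) ≠ ⊤ := fun k hk htop => by
    have h1 : ∑ k ∈ Finset.range (2 ^ n), G.dcc 1 (z k) ^ 2 = ⊤ :=
      ENNReal.sum_eq_top.mpr ⟨k, Finset.mem_range.mpr hk, by rw [htop]; simp⟩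
    rw [h1, ENNReal.mul_top (by positivity), top_le_iff] at hcost
    exact ENNReal.ofReal_ne_top hcost
  refine ⟨fun k => (G.dcc 1 (z k)).toReal, ?_, fun k hk => ?_⟩
  · have h1 := ENNReal.toReal_mono ENNReal.ofReal_ne_top hcost
    rw [ENNReal.toReal_mul, ENNReal.toReal_ofReal (sq_nonneg L), ENNReal.toReal_sum fun k hk =>
      ENNReal.pow_ne_top (hfin k (Finset.mem_range.mp hk))] at h1
    simp only [ENNReal.toReal_pow, ENNReal.toReal_ofNat] at h1
    rwa [le_div_iff₀' h2n]
  · have hd : ∀ k : ℕ, diffBase X Y (k / 2 ^ n) = (y k * (x k)⁻¹).1 := fun k => by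
      rw [mul_fst, inv_fst, ← sub_eq_add_neg]
      rfl
    have ha : ∀ k : ℕ, ratioArea X Y (k / 2 ^ n) = (y k * (x k)⁻¹).2 := fun k => rfl
    have hm : ∀ k : ℕ, meanBase X Y (k / 2 ^ n) =
        (x k).1 + (1 / 2 : ℝ) • (y k * (x k)⁻¹).1 := fun k => by
      rw [meanBase, hd]
      rfl
    have h1 := norm_fst_le_toReal_dcc (hfin k hk)
    have h2 := norm_snd_le_toReal_dcc_sq (hfin k hk)
    rw [hz] at h1 h2
    simp only [conj_fst, conj_snd] at h1 h2
    rw [hd, hd, ha, ha, hm]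
    exact ⟨h1, h2⟩

lemma energy_diffBase_le {X Y : G.PathSpace} {n p : ℕ} {L : ℝ} (hL : 0 ≤ L) (hp : p ≤ n)
    (hXY : G.discreteCost n (X, Y) ≤ ENNReal.ofReal L) :
    ∑ k ∈ Finset.range (2 ^ p),
      ‖diffBase X Y ((k + 1 : ℕ) / 2 ^ p) - diffBase X Y (k / 2 ^ p)‖ ^ 2 ≤ L ^ 2 / 2 ^ p := by
  obtain ⟨D, hD, hXYD⟩ := exists_bound_of_discreteCost_le hL hXY
  obtain ⟨m, rfl⟩ := Nat.exists_eq_add_of_le hp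
  have h1 := sum_sq_norm_block_le (fun k : ℕ => diffBase X Y (k / 2 ^ (p + m))) (2 ^ m) (2 ^ p)
  have h2 : ∀ k : ℕ, ((2 ^ m * k : ℕ) : ℝ) / 2 ^ (p + m) = k / 2 ^ p := fun k => by
    push_cast
    rw [pow_add]
    field_simp
  simp only [h2] at h1
  refine h1.trans ?_
  have h3 : 2 ^ m * 2 ^ p = 2 ^ (p + m) := by rw [pow_add, mul_comm]
  rw [h3]
  calc _ ≤ ((2 ^ m : ℕ) : ℝ) * ∑ k ∈ Finset.range (2 ^ (p + m)), D k ^ 2 := by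
        gcongr with k hk
        exact (hXYD k (Finset.mem_range.mp hk)).1
    _ ≤ ((2 ^ m : ℕ) : ℝ) * (L ^ 2 / 2 ^ (p + m)) := by gcongr
    _ = _ := by
      push_cast
      rw [pow_add]
      field_simp

/-- The second layer of `Y X⁻¹` on a coarse grid is a coarse Riemann sum, up to an error that
vanishes as the mesh of the discretised cost does, and to the oscillation of the mean first layer. -/
lemma norm_ratioArea_sub_le {X Y : G.PathSpace} {n p : ℕ} {L δ : ℝ} (hL : 0 ≤ L) (hp : p ≤ n)
    (hXY : G.discreteCost n (X, Y) ≤ ENNReal.ofReal L)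
    (hδ : ∀ r ∈ Icc (0 : ℝ) 1, ∀ s ∈ Icc (0 : ℝ) 1, |r - s| ≤ 1 / 2 ^ p →
      ‖meanBase X Y r - meanBase X Y s‖ ≤ δ) {K : ℕ} (hK : K ≤ 2 ^ p) :
    ‖ratioArea X Y (K / 2 ^ p) - ∑ k ∈ Finset.range K, G.bracket (meanBase X Y (k / 2 ^ p))
        (diffBase X Y ((k + 1 : ℕ) / 2 ^ p) - diffBase X Y (k / 2 ^ p))‖ ≤
      G.bracketBound * (L ^ 2 / 2 ^ n) + G.bracketBound * δ * L := by
  obtain ⟨D, hD, hXYD⟩ := exists_bound_of_discreteCost_le hL hXY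
  have hC := G.bracketBound_pos
  have hδ0 : 0 ≤ δ := (norm_nonneg _).trans (hδ 0 (left_mem_Icc.mpr zero_le_one) 0
    (left_mem_Icc.mpr zero_le_one) (by simp))
  obtain ⟨m, rfl⟩ := Nat.exists_eq_add_of_le hp
  have h2 : ∀ k : ℕ, ((2 ^ m * k : ℕ) : ℝ) / 2 ^ (p + m) = k / 2 ^ p := fun k => by
    push_cast
    rw [pow_add]
    field_simp
  have h2p : (0 : ℝ) < 2 ^ p := by positivity
  have h2m : (0 : ℝ) < 2 ^ m := by positivity
  have h1 := norm_sub_coarse_sum_le (G := G) (A := fun k : ℕ => ratioArea X Y (k / 2 ^ (p + m)))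
    (μ := fun k : ℕ => meanBase X Y (k / 2 ^ (p + m)))
    (η := fun k : ℕ => diffBase X Y (k / 2 ^ (p + m))) (q := 2 ^ m) (δ := δ) K
    fun k hk i hi => by
      have hk1 : (k : ℝ) + 1 ≤ 2 ^ p := by exact_mod_cast Nat.succ_le_of_lt (hk.trans_le hK)
      have hi1 : (i : ℝ) + 1 ≤ 2 ^ m := by exact_mod_cast Nat.succ_le_of_lt hi
      have h3 : ((2 ^ m * k + i + 1 : ℕ) : ℝ) / 2 ^ (p + m) =
          k / 2 ^ p + ((i : ℝ) + 1) / 2 ^ m / 2 ^ p := by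
        push_cast
        rw [pow_add]
        field_simp
        ring
      have h4 : ((i : ℝ) + 1) / 2 ^ m / 2 ^ p ≤ 1 / 2 ^ p := by
        gcongr
        exact div_le_one_of_le₀ hi1 h2m.le
      have h5 : (0 : ℝ) ≤ ((i : ℝ) + 1) / 2 ^ m / 2 ^ p := by positivity
      have h6 : (k : ℝ) / 2 ^ p + 1 / 2 ^ p ≤ 1 := by
        rw [← add_div]
        exact div_le_one_of_le₀ hk1 h2p.le
      have h7 : (0 : ℝ) ≤ k / 2 ^ p := by positivity
      rw [h2, h3]
      refine hδ _ ⟨by linarith, by linarith⟩ _ ⟨h7, by linarith⟩ ?_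
      rw [add_sub_cancel_left, abs_of_nonneg h5]
      exact h4
  simp only [h2] at h1
  rw [Nat.cast_zero, zero_div, ratioArea_zero, sub_zero] at h1
  refine h1.trans ?_
  have h3 : 2 ^ m * K ≤ 2 ^ (p + m) := by
    rw [pow_add, mul_comm]
    gcongr
  have hDn : ∀ k < 2 ^ (p + m), 0 ≤ D k := fun k hk => (norm_nonneg _).trans (hXYD k hk).1
  calc _ ≤ ∑ k ∈ Finset.range (2 ^ m * K), (G.bracketBound * D k ^ 2 +
          G.bracketBound * δ * D k) := by
        refine Finset.sum_le_sum fun k hk => ?_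
        have hk' := (Finset.mem_range.mp hk).trans_le h3
        have h4 := (hXYD k hk').1
        refine add_le_add (hXYD k hk').2 ?_
        gcongr
    _ ≤ ∑ k ∈ Finset.range (2 ^ (p + m)), (G.bracketBound * D k ^ 2 +
          G.bracketBound * δ * D k) := by
        refine Finset.sum_le_sum_of_subset_of_nonneg (Finset.range_mono h3) fun k hk _ => ?_
        have := hDn k (Finset.mem_range.mp hk)
        positivity
    _ = G.bracketBound * ∑ k ∈ Finset.range (2 ^ (p + m)), D k ^ 2 +
          G.bracketBound * δ * ∑ k ∈ Finset.range (2 ^ (p + m)), D k := by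
        rw [Finset.sum_add_distrib, ← Finset.mul_sum, ← Finset.mul_sum]
    _ ≤ _ := by
        gcongr
        refine abs_le_of_sq_le_sq' ?_ hL |>.2
        refine sq_sum_le_card_mul_sum_sq.trans ?_
        rw [Finset.card_range, Nat.cast_pow, Nat.cast_ofNat, ← le_div_iff₀' (by positivity)]
        exact hD

/-! ### The lower bound -/

section Liminf

variable {X Y : G.PathSpace} {U W : ℕ → G.PathSpace} {ν : ℕ → ℕ} {L : ℝ}

lemma tendsto_base (hU : Tendsto (fun j => G.dInf (U j).1 X.1) atTop (𝓝 0)) (t : ℝ) :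
    Tendsto (fun j => (U j).base t) atTop (𝓝 (X.base t)) :=
  (X.tendsto_dInf_iff.mp hU).1.tendsto_at (projIcc 0 1 zero_le_one t)

lemma tendsto_diffBase (hU : Tendsto (fun j => G.dInf (U j).1 X.1) atTop (𝓝 0))
    (hW : Tendsto (fun j => G.dInf (W j).1 Y.1) atTop (𝓝 0)) (t : ℝ) :
    Tendsto (fun j => diffBase (U j) (W j) t) atTop (𝓝 (diffBase X Y t)) :=
  (tendsto_base hW t).sub (tendsto_base hU t)

lemma tendsto_meanBase (hU : Tendsto (fun j => G.dInf (U j).1 X.1) atTop (𝓝 0))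
    (hW : Tendsto (fun j => G.dInf (W j).1 Y.1) atTop (𝓝 0)) (t : ℝ) :
    Tendsto (fun j => meanBase (U j) (W j) t) atTop (𝓝 (meanBase X Y t)) :=
  (tendsto_base hU t).add ((tendsto_diffBase hU hW t).const_smul (1 / 2 : ℝ))

lemma tendsto_ratioArea (hU : Tendsto (fun j => G.dInf (U j).1 X.1) atTop (𝓝 0))
    (hW : Tendsto (fun j => G.dInf (W j).1 Y.1) atTop (𝓝 0)) (t : ℝ) :
    Tendsto (fun j => ratioArea (U j) (W j) t) atTop (𝓝 (ratioArea X Y t)) := by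
  have hU' := X.tendsto_dInf_iff.mp hU
  have hW' := Y.tendsto_dInf_iff.mp hW
  set s := projIcc 0 1 zero_le_one t
  have h1 : Tendsto (fun j => (U j).1 s) atTop (𝓝 (X.1 s)) :=
    tendsto_carrier_iff.mpr ⟨hU'.1.tendsto_at s, hU'.2.tendsto_at s⟩
  have h2 : Tendsto (fun j => (W j).1 s) atTop (𝓝 (Y.1 s)) :=
    tendsto_carrier_iff.mpr ⟨hW'.1.tendsto_at s, hW'.2.tendsto_at s⟩
  exact (tendsto_carrier_iff.mp (h2.mul h1.inv)).2

lemma eventually_norm_meanBase_sub_le (hU : Tendsto (fun j => G.dInf (U j).1 X.1) atTop (𝓝 0))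
    (hW : Tendsto (fun j => G.dInf (W j).1 Y.1) atTop (𝓝 0)) {δ : ℝ} (hδ : 0 < δ) :
    ∀ᶠ j in atTop, ∀ t, ‖meanBase (U j) (W j) t - meanBase X Y t‖ ≤ δ := by
  have hU' := Metric.tendstoUniformly_iff.mp (X.tendsto_dInf_iff.mp hU).1 δ hδ
  have hW' := Metric.tendstoUniformly_iff.mp (Y.tendsto_dInf_iff.mp hW).1 δ hδ
  filter_upwards [hU', hW'] with j h1 h2 t
  have h1 := h1 (projIcc 0 1 zero_le_one t)
  have h2 := h2 (projIcc 0 1 zero_le_one t)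
  rw [dist_comm, dist_eq_norm] at h1 h2
  change ‖(U j).base t - X.base t‖ < δ at h1
  change ‖(W j).base t - Y.base t‖ < δ at h2
  have h3 : meanBase (U j) (W j) t - meanBase X Y t =
      (1 / 2 : ℝ) • (((U j).base t - X.base t) + ((W j).base t - Y.base t)) := by
    simp only [meanBase, diffBase]
    module
  rw [h3, norm_smul, Real.norm_of_nonneg (by norm_num)]
  have := norm_add_le ((U j).base t - X.base t) ((W j).base t - Y.base t)
  linarith

lemma _root_.Filter.Tendsto.bracket {ι : Type*} {l : Filter ι}
    {f g : ι → EuclideanSpace ℝ (Fin d₁)} {x y : EuclideanSpace ℝ (Fin d₁)}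
    (hf : Tendsto f l (𝓝 x)) (hg : Tendsto g l (𝓝 y)) :
    Tendsto (fun i => G.bracket (f i) (g i)) l (𝓝 (G.bracket x y)) := by
  have h1 := G.continuous_bracket.tendsto (x, y)
  have h2 := h1.comp (hf.prodMk_nhds hg)
  exact h2

/-- In the limit the second layer of `Y X⁻¹` is a Riemann sum, up to the oscillation of the mean of
the first layers. -/
lemma norm_ratioArea_sub_sum_le (hU : Tendsto (fun j => G.dInf (U j).1 X.1) atTop (𝓝 0))
    (hW : Tendsto (fun j => G.dInf (W j).1 Y.1) atTop (𝓝 0)) (hν : Tendsto ν atTop atTop)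
    (hL : 0 ≤ L) (hcost : ∀ j, G.discreteCost (ν j) (U j, W j) ≤ ENNReal.ofReal L)
    {p : ℕ} {δ : ℝ} (hδ : 0 < δ)
    (hmod : ∀ r ∈ Icc (0 : ℝ) 1, ∀ s ∈ Icc (0 : ℝ) 1, |r - s| ≤ 1 / 2 ^ p →
      ‖meanBase X Y r - meanBase X Y s‖ ≤ δ) {K : ℕ} (hK : K ≤ 2 ^ p) :
    ‖ratioArea X Y (K / 2 ^ p) - ∑ k ∈ Finset.range K, G.bracket (meanBase X Y (k / 2 ^ p))
        (diffBase X Y ((k + 1 : ℕ) / 2 ^ p) - diffBase X Y (k / 2 ^ p))‖ ≤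
      G.bracketBound * (3 * δ) * L := by
  have hlim : Tendsto (fun j => G.bracketBound * (L ^ 2 / 2 ^ ν j) +
      G.bracketBound * (3 * δ) * L) atTop (𝓝 (G.bracketBound * (3 * δ) * L)) := by
    have h3 : Tendsto (fun j => L ^ 2 / 2 ^ ν j) atTop (𝓝 0) :=
      tendsto_const_nhds.div_atTop
        ((tendsto_pow_atTop_atTop_of_one_lt one_lt_two).comp hν)
    simpa using (h3.const_mul G.bracketBound).add_const (G.bracketBound * (3 * δ) * L)
  have hterm : ∀ k : ℕ, Tendsto (fun j => G.bracket (meanBase (U j) (W j) (k / 2 ^ p))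
      (diffBase (U j) (W j) ((k + 1 : ℕ) / 2 ^ p) - diffBase (U j) (W j) (k / 2 ^ p))) atTop
      (𝓝 (G.bracket (meanBase X Y (k / 2 ^ p))
        (diffBase X Y ((k + 1 : ℕ) / 2 ^ p) - diffBase X Y (k / 2 ^ p)))) := fun k =>
    (tendsto_meanBase hU hW _).bracket ((tendsto_diffBase hU hW _).sub (tendsto_diffBase hU hW _))
  have hsum := tendsto_finsetSum (Finset.range K) fun k _ => hterm k
  have hlim' := ((tendsto_ratioArea hU hW (K / 2 ^ p)).sub hsum).norm
  refine le_of_tendsto_of_tendsto hlim' hlim ?_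
  filter_upwards [hν.eventually_ge_atTop p, eventually_norm_meanBase_sub_le hU hW hδ]
    with j hj hj'
  refine norm_ratioArea_sub_le hL hj (hcost j) (fun r hr s hs hrs => ?_) hK
  have h4 : meanBase (U j) (W j) r - meanBase (U j) (W j) s =
      (meanBase (U j) (W j) r - meanBase X Y r) + (meanBase X Y r - meanBase X Y s) -
        (meanBase (U j) (W j) s - meanBase X Y s) := by
    abel
  rw [h4]
  refine (norm_sub_le _ _).trans ?_
  have h5 := norm_add_le (meanBase (U j) (W j) r - meanBase X Y r)
    (meanBase X Y r - meanBase X Y s)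
  linarith [hj' r, hj' s, hmod r hr s hs hrs]

lemma norm_sum_sub_integral_le {m h : ℝ → EuclideanSpace ℝ (Fin d₁)} (hh : IsAC0 h)
    (hmc : ContinuousOn m (Icc 0 1)) {p : ℕ} {δ : ℝ} (hδ : 0 < δ)
    (hmod : ∀ r ∈ Icc (0 : ℝ) 1, ∀ s ∈ Icc (0 : ℝ) 1, |r - s| ≤ 1 / 2 ^ p → ‖m r - m s‖ ≤ δ)
    {K : ℕ} (hK : K ≤ 2 ^ p) :
    ‖∑ k ∈ Finset.range K, G.bracket (m (k / 2 ^ p))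
        (h ((k + 1 : ℕ) / 2 ^ p) - h (k / 2 ^ p)) -
        ∫ s in (0 : ℝ)..(K / 2 ^ p), G.bracket (m s) (deriv h s)‖ ≤
      G.bracketBound * δ * ∫ r in (0 : ℝ)..1, ‖deriv h r‖ := by
  -- the times `k / 2 ^ p` are stopped at `K / 2 ^ p` to remain in the unit interval
  have hmem : ∀ k : ℕ, ((min k K : ℕ) : ℝ) / 2 ^ p ∈ Icc (0 : ℝ) 1 := fun k =>
    ⟨by positivity, div_le_one_of_le₀
      (by exact_mod_cast (min_le_right k K).trans hK) (by positivity)⟩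
  have hmono : Monotone fun k : ℕ => ((min k K : ℕ) : ℝ) / 2 ^ p := fun k l hkl => by
    simp only
    gcongr
  have h3 := norm_riemannSum_sub_le (G := G) hh hmc hmono hmem
    (c := fun k : ℕ => m (k / 2 ^ p)) (N := K) hδ.le fun k hk r hr => by
      simp only [min_eq_left hk.le, min_eq_left (Nat.succ_le_of_lt hk)] at hr
      have h4 := hmem k
      have h5 := hmem (k + 1)
      rw [min_eq_left hk.le] at h4
      rw [min_eq_left (Nat.succ_le_of_lt hk)] at h5
      refine hmod _ h4 _ ⟨h4.1.trans hr.1, hr.2.trans h5.2⟩ ?_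
      rw [abs_sub_comm, abs_of_nonneg (by linarith [hr.1])]
      have h6 := hr.2
      push_cast at h6
      rw [add_div] at h6
      linarith
  have h4 : ∑ k ∈ Finset.range K, G.bracket (m (k / 2 ^ p))
      (h (((min (k + 1) K : ℕ) : ℝ) / 2 ^ p) - h (((min k K : ℕ) : ℝ) / 2 ^ p)) =
      ∑ k ∈ Finset.range K, G.bracket (m (k / 2 ^ p))
        (h ((k + 1 : ℕ) / 2 ^ p) - h (k / 2 ^ p)) := by
    refine Finset.sum_congr rfl fun k hk => ?_
    have hk := Finset.mem_range.mp hk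
    rw [min_eq_left hk.le, min_eq_left (Nat.succ_le_of_lt hk)]
  simp only [h4, Nat.zero_min, Nat.cast_zero, zero_div, min_self] at h3
  exact h3

/-- The second layer of `Y X⁻¹` is the one of the shift by the first layer, first on dyadic grids up
to the oscillation of the mean of the first layers, then everywhere by continuity. -/
lemma ratioArea_eq_shiftArea (hU : Tendsto (fun j => G.dInf (U j).1 X.1) atTop (𝓝 0))
    (hW : Tendsto (fun j => G.dInf (W j).1 Y.1) atTop (𝓝 0)) (hν : Tendsto ν atTop atTop)
    (hL : 0 ≤ L) (hcost : ∀ j, G.discreteCost (ν j) (U j, W j) ≤ ENNReal.ofReal L)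
    (hh : IsAC0 (diffBase X Y)) (t : unitInterval) :
    ratioArea X Y t = G.shiftArea X.base (diffBase X Y) t := by
  have hmc : ContinuousOn (meanBase X Y) (Icc 0 1) := (continuous_meanBase X Y).continuousOn
  have hC := G.bracketBound_pos
  set I := ∫ r in (0 : ℝ)..1, ‖deriv (diffBase X Y) r‖
  have hI0 : 0 ≤ I := intervalIntegral.integral_nonneg zero_le_one fun _ _ => norm_nonneg _
  have h2p : ∀ p : ℕ, (0 : ℝ) < 2 ^ p := fun p => by positivity
  have hgrid : ∀ δ > 0, ∃ p₀ : ℕ, ∀ p ≥ p₀, ∀ K : ℕ, K ≤ 2 ^ p →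
      ‖ratioArea X Y (K / 2 ^ p) - G.shiftArea X.base (diffBase X Y) (K / 2 ^ p)‖ ≤
        G.bracketBound * (3 * δ) * L + G.bracketBound * δ * I := by
    intro δ hδ
    obtain ⟨N₀, hN₀⟩ := exists_modulus hmc hδ
    refine ⟨N₀, fun p hp K hK => ?_⟩
    have hmod : ∀ r ∈ Icc (0 : ℝ) 1, ∀ s ∈ Icc (0 : ℝ) 1, |r - s| ≤ 1 / 2 ^ p →
        ‖meanBase X Y r - meanBase X Y s‖ ≤ δ := fun r hr s hs hrs =>
      hN₀ (2 ^ p) (hp.trans Nat.lt_two_pow_self.le) r hr s hs (by push_cast; exact hrs)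
    exact (norm_sub_le_norm_sub_add_norm_sub _ _ _).trans
      (add_le_add (norm_ratioArea_sub_sum_le hU hW hν hL hcost hδ hmod hK)
        (norm_sum_sub_integral_le hh hmc hδ hmod hK))
  have hlim : Tendsto (fun p : ℕ => (⌊(t : ℝ) * 2 ^ p⌋₊ : ℝ) / 2 ^ p) atTop (𝓝 (t : ℝ)) :=
    (tendsto_nat_floor_mul_div_atTop t.2.1).comp
      (tendsto_pow_atTop_atTop_of_one_lt one_lt_two)
  have hfl : ∀ p : ℕ, ⌊(t : ℝ) * 2 ^ p⌋₊ ≤ 2 ^ p := fun p => by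
    refine Nat.floor_le_of_le ?_
    push_cast
    exact mul_le_of_le_one_left (h2p p).le t.2.2
  have hcS : ContinuousOn (G.shiftArea X.base (diffBase X Y)) (Icc 0 1) := by
    have h1 := G.intervalIntegrable_bracket (a := 0) (b := 1)
      (by rw [uIcc_of_le zero_le_one]; exact hmc) hh.1.intervalIntegrable_deriv_euclidean
    have h2 := intervalIntegral.continuousOn_primitive_interval' h1 left_mem_uIcc
    rwa [uIcc_of_le zero_le_one] at h2
  have hlim' : Tendsto (fun p : ℕ => (⌊(t : ℝ) * 2 ^ p⌋₊ : ℝ) / 2 ^ p) atTop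
      (𝓝[Icc 0 1] (t : ℝ)) :=
    tendsto_nhdsWithin_iff.mpr ⟨hlim, Eventually.of_forall fun p =>
      ⟨by positivity, div_le_one_of_le₀ (by exact_mod_cast hfl p) (h2p p).le⟩⟩
  have hdiff : Tendsto (fun p : ℕ => ‖ratioArea X Y ((⌊(t : ℝ) * 2 ^ p⌋₊ : ℝ) / 2 ^ p) -
      G.shiftArea X.base (diffBase X Y) ((⌊(t : ℝ) * 2 ^ p⌋₊ : ℝ) / 2 ^ p)‖) atTop
      (𝓝 ‖ratioArea X Y t - G.shiftArea X.base (diffBase X Y) t‖) :=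
    ((((continuous_ratioArea X Y).tendsto _).comp hlim).sub
      ((hcS t t.2).tendsto.comp hlim')).norm
  rw [← sub_eq_zero, ← norm_le_zero_iff]
  refine le_of_forall_pos_le_add fun ε hε => ?_
  rw [zero_add]
  set c := G.bracketBound * 3 * L + G.bracketBound * I with hc
  have hc0 : 0 ≤ c := by positivity
  obtain ⟨p₀, hp₀⟩ := hgrid (ε / (c + 1)) (by positivity)
  refine le_of_tendsto hdiff ?_
  filter_upwards [eventually_ge_atTop p₀] with p hp
  refine (hp₀ p hp _ (hfl p)).trans ?_
  have h3 : G.bracketBound * (3 * (ε / (c + 1))) * L + G.bracketBound * (ε / (c + 1)) * I =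
      ε * (c / (c + 1)) := by
    rw [hc]
    ring
  rw [h3]
  refine mul_le_of_le_one_right hε.le (div_le_one_of_le₀ (by linarith) (by linarith))

/-- The compactness statement behind the lower bound: if the discretised costs stay below `L`, then
the limit `Y` is the shift of the limit `X` by a Cameron–Martin path of norm at most `L`. -/
theorem isShift_of_discreteCost_le (hU : Tendsto (fun j => G.dInf (U j).1 X.1) atTop (𝓝 0))
    (hW : Tendsto (fun j => G.dInf (W j).1 Y.1) atTop (𝓝 0)) (hν : Tendsto ν atTop atTop)
    (hL : 0 ≤ L) (hcost : ∀ j, G.discreteCost (ν j) (U j, W j) ≤ ENNReal.ofReal L) :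
    IsCameronMartin (diffBase X Y) ∧ cameronMartinNorm (diffBase X Y) ≤ ENNReal.ofReal L ∧
      G.IsShift (diffBase X Y) X Y := by
  have hE : ∀ p : ℕ, ∑ k ∈ Finset.range (2 ^ p),
      ‖diffBase X Y ((k + 1 : ℕ) / 2 ^ p) - diffBase X Y (k / 2 ^ p)‖ ^ 2 ≤ L ^ 2 / 2 ^ p := by
    intro p
    refine le_of_tendsto (tendsto_finsetSum _ fun k _ =>
      (((tendsto_diffBase hU hW _).sub (tendsto_diffBase hU hW _)).norm.pow 2)) ?_
    filter_upwards [hν.eventually_ge_atTop p] with j hj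
    exact energy_diffBase_le hL hj (hcost j)
  obtain ⟨hCM, hnorm⟩ := isCameronMartin_of_dyadic_energy_le (continuous_diffBase X Y)
    (diffBase_zero X Y) hL hE
  refine ⟨hCM, hnorm, (isShift_iff hCM.1).mpr fun t => ?_⟩
  have h1 : Y.1 t * (X.1 t)⁻¹ = G.shiftFactor X.base (diffBase X Y) t := by
    ext1
    · rw [shiftFactor_fst, mul_fst, inv_fst, ← X.base_coe, ← Y.base_coe, ← sub_eq_add_neg]
      rfl
    · rw [shiftFactor_snd, ← ratioArea_eq_shiftArea hU hW hν hL hcost hCM.1]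
      exact (IccExtend_val zero_le_one (fun t => (Y.1 t * (X.1 t)⁻¹).2) t).symm
  rw [← h1, inv_mul_cancel_right]

end Liminf

lemma cameronMartinNorm_eq_of_isShift {h h' : ℝ → EuclideanSpace ℝ (Fin d₁)} {X Y : G.PathSpace}
    (hh : IsAC0 h) (hh' : IsAC0 h') (hs : G.IsShift h X Y) (hs' : G.IsShift h' X Y) :
    cameronMartinNorm h = cameronMartinNorm h' := by
  rw [isShift_iff hh] at hs
  rw [isShift_iff hh'] at hs'
  have h1 : EqOn h h' (Icc 0 1) := fun t ht => by
    have h2 := (hs ⟨t, ht⟩).symm.trans (hs' ⟨t, ht⟩)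
    exact congrArg (fun x : G.Carrier => x.1) (mul_right_cancel h2)
  have h2 : EqOn (deriv h) (deriv h') (Ioo 0 1) :=
    (h1.mono Ioo_subset_Icc_self).deriv isOpen_Ioo
  rw [cameronMartinNorm, cameronMartinNorm, setLIntegral_congr Ioo_ae_eq_Icc.symm,
    setLIntegral_congr Ioo_ae_eq_Icc.symm]
  congr 1
  exact setLIntegral_congr_fun measurableSet_Ioo fun t ht => by rw [h2 ht]

end StepTwoCarnotGroup

theorem corollary5p15 {d₁ d₂ : ℕ} (G : StepTwoCarnotGroup d₁ d₂) :
    GammaConverges G.dPair G.discreteCost G.shiftCost := by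
  refine ⟨fun x u hu => le_of_forall_gt fun c hc => ?_, fun x => ?_⟩
  · -- along a subsequence the costs stay below a real number `L` below `c`
    obtain ⟨c', hc', hcc'⟩ := exists_between hc
    refine lt_of_le_of_lt ?_ hcc'
    obtain ⟨φ, hφ, hφc⟩ := extraction_of_frequently_atTop
      (frequently_lt_of_liminf_lt (by isBoundedDefault) hc')
    have hu' := hu.comp hφ.tendsto_atTop
    have hU : Tendsto (fun j => G.dInf (u (φ j)).1.1 x.1.1) atTop (𝓝 0) :=
      tendsto_of_tendsto_of_tendsto_of_le_of_le tendsto_const_nhds hu' (fun _ => zero_le)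
        fun _ => le_max_left _ _
    have hW : Tendsto (fun j => G.dInf (u (φ j)).2.1 x.2.1) atTop (𝓝 0) :=
      tendsto_of_tendsto_of_tendsto_of_le_of_le tendsto_const_nhds hu' (fun _ => zero_le)
        fun _ => le_max_right _ _
    have hL : ENNReal.ofReal c'.toReal = c' := ENNReal.ofReal_toReal (hcc'.trans_le le_top).ne
    obtain ⟨hCM, hnorm, hs⟩ := StepTwoCarnotGroup.isShift_of_discreteCost_le hU hW
      hφ.tendsto_atTop (ENNReal.toReal_nonneg (a := c')) fun j => by
        rw [hL]
        exact (hφc j).le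
    rw [hL] at hnorm
    exact (iInf₂_le_of_le _ hCM (iInf_le _ hs)).trans hnorm
  · by_cases hx : G.shiftCost x = ⊤
    · refine ⟨fun _ => x, ?_, by rw [hx]; exact le_top⟩
      have h : G.dPair x x = 0 := by
        rw [StepTwoCarnotGroup.dPair, StepTwoCarnotGroup.dInf_self, StepTwoCarnotGroup.dInf_self,
          max_self]
      exact tendsto_const_nhds.congr fun _ => h.symm
    obtain ⟨h, hCM, hs⟩ : ∃ h, IsCameronMartin h ∧ G.IsShift h x.1 x.2 := by
      by_contra! hcon
      exact hx (iInf₂_eq_top.mpr fun h hCM => iInf_eq_top.mpr fun hs => absurd hs (hcon h hCM))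
    refine ⟨fun n => (x.1, StepTwoCarnotGroup.discreteShift x.1 hCM.1 (2 ^ n)), ?_, ?_⟩
    · have h1 := StepTwoCarnotGroup.tendsto_discreteShift x.1 hCM.1
        ((StepTwoCarnotGroup.isShift_iff hCM.1).mp hs)
      simp only [StepTwoCarnotGroup.dPair, StepTwoCarnotGroup.dInf_self, zero_le, max_eq_right]
      exact h1
    · refine limsup_le_of_le (by isBoundedDefault) (Eventually.of_forall fun n => ?_)
      refine (StepTwoCarnotGroup.discreteCost_discreteShift_le x.1 hCM.1 n).trans ?_
      exact le_iInf₂ fun h' hCM' => le_iInf fun hs' =>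
        (StepTwoCarnotGroup.cameronMartinNorm_eq_of_isShift hCM.1 hCM'.1 hs hs').le
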